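/- Setting. Consider $L$ cells with one single-antenna user each, observed by the base station of cell $j$, which carries a uniform linear array (ULA) of $M$ antennas with spacing $0<D\le\lambda/2$ ($\lambda$ is the wavelength) and steering vectors $\mathbf a(\theta)=\big(e^{-\mathrm i 2\pi m\frac{D}{\lambda}\cos\theta}\big)_{m=0}^{M-1}$. The channel from user $l$ is $$\mathbf h_l=\frac{\beta_l}{\sqrt P}\sum_{p=1}^P \mathbf a(\theta_{lp})e^{\mathrm i\varphi_{lp}},\qquad l=1,\dots,L,$$ with $\beta_l>0$, a fixed (arbitrarily large) number $P\ge1$ of paths, angles $\theta_{lp}$ of probability density $p_l$ on $[0,\pi]$, and identically distributed phases $\varphi_{lp}$. The received pilot and data signals are $$\mathbf Y=\sum_l\mathbf h_l\mathbf s^T+\mathbf N\in\mathbb C^{M\times\tau},\qquad \mathbf W=\sum_l \mathbf h_l\mathbf x_l^T+\mathbf Z\in\mathbb C^{M\times C},$$ where the pilot $\mathbf s\in\mathbb C^\tau$, $\tau\ge1$, satisfies $\mathbf s^T\mathbf s^*=\tau$, the data symbols are i.i.d. with zero mean and unit variance, and the noise entries are i.i.d. $\mathcal{CN}(0,\sigma_n^2)$,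 $\sigma_n^2\ge0$. All angles, phases, symbols and noise entries are mutually independent, and the systems for different $(M,C)$ use the first $M$ antennas and the first $C$ symbols of one infinite family. Let $\mathbf R_l=\mathbb E\{\mathbf h_l\mathbf h_l^H\}$, and let $\Phi_d=\{\theta:p_j(\theta)>0\}$ be the angular support of the desired channel, assumed closed up to a Lebesgue null set (for instance a finite union of intervals). For $l\ne j$ let $\mathbf h_{l\mathrm i}=\frac{\beta_l}{\sqrt P}\sum_{p:\,\theta_{lp}\in\Phi_d}\mathbf a(\theta_{lp})e^{\mathrm i\varphi_{lp}}$ be the part of the interference channel inside $\Phi_d$. Let the columns of $\mathbf V_j$ be orthonormal eigenvectors of $\mathbf R_j$ for its non-negligible eigenvalues, meaning those that exceed a threshold $\varepsilon_M$, where $\varepsilon_M\to0$ and $M\varepsilon_M\to\infty$. With $\overline{\mathbf W}_j=\mathbf V_j\mathbf V_j^H\mathbf W$ and any unit eigenvector $\overline{\mathbf u}_{j1}$ of $\frac1C\overline{\mathbf W}_j\overline{\mathbf W}_j^H$ for its largest eigenvalue, the subspace-and-amplitude (SA) projection estimator is $$\widehat{\mathbf h}_j^{\mathrm{SA}}=\frac1\tau\,\overline{\mathbf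 u}_{j1}\overline{\mathbf u}_{j1}^H\,\mathbf Y\mathbf s^*.$$ Theorem. Suppose that there is a constant $\zeta$ with $$\big\|\mathbf R_j^{1/2}\mathbf V_j\mathbf V_j^H\mathbf R_l^{1/2}\big\|_2\le\zeta\qquad\text{for all } M \text{ and all } l\ne j .$$ Then, for almost every realization for which the interference power inside $\Phi_d$ is asymptotically strictly below the desired power, that is, $$\forall l\neq j\ \ \exists c<1:\quad \|\mathbf h_{l\mathrm i}\|_2\le c\,\|\mathbf h_j\|_2\ \text{ for all sufficiently large } M,$$ one has $\mathbf h_j\ne0$ for all sufficiently large $M$, and, for every choice of the dominant eigenvectors $\overline{\mathbf u}_{j1}$, $$\lim_{M,C\to\infty}\frac{\|\widehat{\mathbf h}_j^{\mathrm{SA}}-\mathbf h_j\|_2^2}{\|\mathbf h_j\|_2^2}=0,$$ where $M$ and $C$ tend to infinity jointly and independently of each other. -/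

import Mathlib

open MeasureTheory ProbabilityTheory Filter Topology
open scoped NNReal Matrix ComplexConjugate

noncomputable section

/-- The circularly symmetric complex Gaussian law `CN(0, v)`: independent real and imaginary parts,
each centred Gaussian with variance `v / 2`. -/
def complexGaussian (v : ℝ≥0) : Measure ℂ :=
  ((gaussianReal 0 (v / 2)).prod (gaussianReal 0 (v / 2))).map
    (fun x : ℝ × ℝ => (x.1 : ℂ) + (x.2 : ℂ) * Complex.I)

/-- The labels of the elementary random variables of the model: the angle of arrival and the phase
of path `p` of the channel from cell `l`, the `c`-th data symbol of the user in cell `l`, the noise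
at antenna `m` and time `t` of the pilot phase, and at antenna `m` and time `c` of the data phase. -/
inductive Source (L P τ : ℕ) : Type
  | angle (l : Fin L) (p : Fin P)
  | phase (l : Fin L) (p : Fin P)
  | symbol (l : Fin L) (c : ℕ)
  | pilotNoise (m : ℕ) (t : Fin τ)
  | dataNoise (m c : ℕ)

/-- The σ-algebra generated by each elementary random variable. -/
@[reducible]
def sourceSigma {L P τ : ℕ} {Ω : Type*}
    (θ φ : Fin L → Fin P → Ω → ℝ) (X : Fin L → ℕ → Ω → ℂ)
    (N : ℕ → Fin τ → Ω → ℂ) (Z : ℕ → ℕ → Ω → ℂ) : Source L P τ → MeasurableSpace Ω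
  | .angle l p => MeasurableSpace.comap (θ l p) inferInstance
  | .phase l p => MeasurableSpace.comap (φ l p) inferInstance
  | .symbol l c => MeasurableSpace.comap (X l c) inferInstance
  | .pilotNoise m t => MeasurableSpace.comap (N m t) inferInstance
  | .dataNoise m c => MeasurableSpace.comap (Z m c) inferInstance

/-- The uplink of `L` cells with one user each, seen from one base station that carries a uniform
linear array: `P` propagation paths per channel, pilots of length `τ`. Antennas and data symbols are
indexed by all of `ℕ`; a system with `M` antennas and `C` data symbols uses the first `M` antennas
and the first `C` symbols. -/
structure UplinkModel (L P τ : ℕ) {Ω : Type*} [MeasurableSpace Ω] (μ : Measure Ω) where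
  /-- antenna spacing `D` -/
  spacing : ℝ
  /-- signal wavelength -/
  wavelength : ℝ
  spacing_pos : 0 < spacing
  wavelength_pos : 0 < wavelength
  /-- the spacing is at most half a wavelength -/
  spacing_le : spacing ≤ wavelength / 2
  /-- number of paths and pilot length are positive -/
  paths_pos : 0 < P
  pilot_pos : 0 < τ
  /-- path-loss coefficients -/
  β : Fin L → ℝ
  β_pos : ∀ l, 0 < β l
  /-- probability density of the angles of arrival of each channel, carried by `[0, π]` -/
  pdf : Fin L → ℝ → ℝ
  pdf_measurable : ∀ l, Measurable (pdf l)
  pdf_nonneg : ∀ l x, 0 ≤ pdf l x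
  pdf_support : ∀ l x, x ∉ Set.Icc 0 Real.pi → pdf l x = 0
  /-- common law of the phases -/
  phaseLaw : Measure ℝ
  /-- common law of the data symbols: zero mean and unit variance -/
  symbolLaw : Measure ℂ
  symbol_mean : ∫ z, z ∂symbolLaw = 0
  symbol_var : ∫ z, ‖z‖ ^ 2 ∂symbolLaw = 1
  /-- noise variance -/
  noiseVar : ℝ≥0
  /-- the pilot sequence shared by all users, of unit average power -/
  s : Fin τ → ℂ
  s_power : s ⬝ᵥ star s = (τ : ℂ)
  /-- angles of arrival -/
  θ : Fin L → Fin P → Ω → ℝ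
  /-- phases -/
  φ : Fin L → Fin P → Ω → ℝ
  /-- data symbols -/
  X : Fin L → ℕ → Ω → ℂ
  /-- noise during the pilots -/
  N : ℕ → Fin τ → Ω → ℂ
  /-- noise during the data symbols -/
  Z : ℕ → ℕ → Ω → ℂ
  θ_measurable : ∀ l p, Measurable (θ l p)
  φ_measurable : ∀ l p, Measurable (φ l p)
  X_measurable : ∀ l c, Measurable (X l c)
  N_measurable : ∀ m t, Measurable (N m t)
  Z_measurable : ∀ m c, Measurable (Z m c)
  θ_law : ∀ l p, μ.map (θ l p) = volume.withDensity (fun x => ENNReal.ofReal (pdf l x))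
  φ_law : ∀ l p, μ.map (φ l p) = phaseLaw
  X_law : ∀ l c, μ.map (X l c) = symbolLaw
  N_law : ∀ m t, μ.map (N m t) = complexGaussian noiseVar
  Z_law : ∀ m c, μ.map (Z m c) = complexGaussian noiseVar
  /-- all the elementary random variables are mutually independent -/
  indep : iIndep (sourceSigma θ φ X N Z) μ

namespace UplinkModel

variable {L P τ : ℕ} {Ω : Type*} [MeasurableSpace Ω] {μ : Measure Ω}

/-- Steering vector of the array with `M` antennas for the angle of arrival `x`. -/
def steering (S : UplinkModel L P τ μ) (M : ℕ) (x : ℝ) : EuclideanSpace ℂ (Fin M) :=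
  WithLp.toLp 2 fun m =>
    Complex.exp (-Complex.I * ((2 * Real.pi * ((m : ℕ) * S.spacing / S.wavelength) * Real.cos x : ℝ) : ℂ))

/-- The multipath channel `h_l` from the user in cell `l`. -/
def channel (S : UplinkModel L P τ μ) (M : ℕ) (l : Fin L) (ω : Ω) : EuclideanSpace ℂ (Fin M) :=
  ((S.β l / √(P : ℝ) : ℝ) : ℂ) •
    ∑ p, Complex.exp (Complex.I * (S.φ l p ω : ℂ)) • S.steering M (S.θ l p ω)

/-- Angular support of the channel from cell `j`: the angles at which the density is positive. -/
def angularSupport (S : UplinkModel L P τ μ) (j : Fin L) : Set ℝ :=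
  {x | 0 < S.pdf j x}

open Classical in
/-- The multipath component of the channel `h_l` whose angles of arrival lie in `Φ`. -/
def channelIn (S : UplinkModel L P τ μ) (Φ : Set ℝ) (M : ℕ) (l : Fin L) (ω : Ω) :
    EuclideanSpace ℂ (Fin M) :=
  ((S.β l / √(P : ℝ) : ℝ) : ℂ) •
    ∑ p with S.θ l p ω ∈ Φ, Complex.exp (Complex.I * (S.φ l p ω : ℂ)) • S.steering M (S.θ l p ω)

/-- The channel covariance `R_l = E[h_l h_lᴴ]`. -/
def cov (S : UplinkModel L P τ μ) (M : ℕ) (l : Fin L) : Matrix (Fin M) (Fin M) ℂ :=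
  Matrix.of fun m n => ∫ ω, S.channel M l ω m * conj (S.channel M l ω n) ∂μ

theorem cov_isHermitian (S : UplinkModel L P τ μ) (M : ℕ) (l : Fin L) :
    (S.cov M l).IsHermitian := by
  ext m n
  simp only [cov, Matrix.conjTranspose_apply, Matrix.of_apply, RCLike.star_def]
  rw [← integral_conj]
  simp [mul_comm]

/-- The matrix `V_j` whose columns are the orthonormal eigenvectors of `R_j` that belong to the
eigenvalues exceeding the threshold `ε`. -/
def signalBasis (S : UplinkModel L P τ μ) (M : ℕ) (j : Fin L) (ε : ℝ) :
    Matrix (Fin M) {i : Fin M // ε < (S.cov_isHermitian M j).eigenvalues i} ℂ :=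
  Matrix.of fun m i => (S.cov_isHermitian M j).eigenvectorBasis i.1 m

/-- The orthogonal projection `V_j V_jᴴ` on the signal space of `R_j`. -/
def signalProj (S : UplinkModel L P τ μ) (M : ℕ) (j : Fin L) (ε : ℝ) :
    Matrix (Fin M) (Fin M) ℂ :=
  S.signalBasis M j ε * (S.signalBasis M j ε)ᴴ

open scoped MatrixOrder Matrix.Norms.L2Operator in
/-- The positive semidefinite square root of `R_l`. -/
def covSqrt (S : UplinkModel L P τ μ) (M : ℕ) (l : Fin L) : Matrix (Fin M) (Fin M) ℂ :=
  CFC.sqrt (S.cov M l)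

/-- The signal `Y = ∑ₗ h_l sᵀ + N` received during the pilots. -/
def pilotSignal (S : UplinkModel L P τ μ) (M : ℕ) (ω : Ω) : Matrix (Fin M) (Fin τ) ℂ :=
  (∑ l, Matrix.vecMulVec (S.channel M l ω) S.s) +
    Matrix.of fun (m : Fin M) (t : Fin τ) => S.N m t ω

/-- The signal `W = ∑ₗ h_l x_lᵀ + Z` received during the data symbols. -/
def dataSignal (S : UplinkModel L P τ μ) (M C : ℕ) (ω : Ω) : Matrix (Fin M) (Fin C) ℂ :=
  (∑ l, Matrix.vecMulVec (S.channel M l ω) (fun c : Fin C => S.X l c ω)) +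
    Matrix.of fun (m : Fin M) (c : Fin C) => S.Z m c ω

/-- The data signal projected on the signal space of `R_j`. -/
def projSignal (S : UplinkModel L P τ μ) (j : Fin L) (ε : ℝ) (M C : ℕ) (ω : Ω) :
    Matrix (Fin M) (Fin C) ℂ :=
  S.signalProj M j ε * S.dataSignal M C ω

/-- The sample covariance of the projected data signal. -/
def sampleCov (S : UplinkModel L P τ μ) (j : Fin L) (ε : ℝ) (M C : ℕ) (ω : Ω) :
    Matrix (Fin M) (Fin M) ℂ :=
  (1 / (C : ℂ)) • (S.projSignal j ε M C ω * (S.projSignal j ε M C ω)ᴴ)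

/-- The estimate `(1/τ) u uᴴ Y s^*` of the desired channel, for the direction `u`. -/
def saEstimate (S : UplinkModel L P τ μ) (M : ℕ) (u : EuclideanSpace ℂ (Fin M)) (ω : Ω) :
    EuclideanSpace ℂ (Fin M) :=
  WithLp.toLp 2 ((1 / (τ : ℂ)) •
    (Matrix.vecMulVec (u : Fin M → ℂ) (star (u : Fin M → ℂ)) *ᵥ (S.pilotSignal M ω *ᵥ star S.s)))

end UplinkModel

/-- `u` is a unit eigenvector of the Hermitian matrix `A` for its largest eigenvalue. -/
def IsDominantEigenvector {M : ℕ} (A : Matrix (Fin M) (Fin M) ℂ)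
    (u : EuclideanSpace ℂ (Fin M)) : Prop :=
  ‖u‖ = 1 ∧ ∃ r : ℝ, A *ᵥ (u : Fin M → ℂ) = (r : ℂ) • (u : Fin M → ℂ) ∧
    ∀ r' : ℝ, Module.End.HasEigenvalue (Matrix.toLin' A) (r' : ℂ) → r' ≤ r

end

/-! At the scale of √M the problem becomes finite-dimensional. Almost surely all angles are distinct
and lie in the open interval (0, π). The inner product of two steering vectors with different angles
is a geometric sum whose ratio is not 1, because D ≤ λ/2 (`ratio_ne_one`). It therefore stays
bounded, while each squared norm equals M. So the Gram matrix of the channels, or of any selection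
of their paths, divided by M, tends to a diagonal matrix (`tendsto_gram_channelIn`).

Asymptotically, the projection on the signal space of R_j keeps exactly the paths with angle in Φ_d.
The quadratic form of R_j is comparable, up to the factor P, to the integral of |⟨x, a(t)⟩|² against
p_j (`le_covForm`, `covForm_le`). If a(x) had a residual of order √M at a point x of positive
density, the residual would correlate with all a(t) for t within order 1/M of x. This would make its
quadratic form exceed the threshold, since ε_M → 0 (`residual_pow_three_le`). If x lies outside the
closure of Φ_d, the form of R_j at a(x) is bounded, so the projected squared norm is O(1/ε_M) =
o(M), since M ε_M → ∞ (`tendsto_project_of_notMem_closure`). The boundary of Φ_d outside Φ_d is null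
and is almost surely never hit.

Hence the vectors v_l = V_j V_jᴴ h_l / √M are asymptotically orthogonal, with limiting powers d_l.
Here d_j = β_j², and the power hypothesis gives d_l < d_j for the other cells. The sample
covariance, divided by M, has quadratic form close to ∑ |⟨v_l, x⟩|², uniformly over the unit ball
(`eventually_abs_sampleForm_sub_le`): the empirical Gram matrix of the symbols tends to the
identity, and the noise matrix has operator norm o(√(MC)). The spectral gap then forces the dominant
eigenvector u to align with v_j (`tendsto_dominant_direction`). The estimate is the projection on u
of ∑ h_l plus correlated pilot noise. The interference disappears because u is asymptotically
orthogonal to the other v_l, and the noise disappears because u is almost parallel to h_j, whose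
correlation with the pilot noise obeys a law of large numbers.

The delicate point is that M and C grow independently. For the noise norm (`ae_eventually_noise_le`)
the rows are grouped in blocks of a fixed large size k. Within a block the empirical correlations
deviate from a multiple of the identity by averages over C. These are dominated, for all large C at
once, by the tail of a convergent series that does not involve C. The tails of the blocks are
i.i.d., so the ordinary strong law over the blocks handles M, and their mean tends to zero as the
tail starts later. -/

noncomputable section

open scoped InnerProductSpace

/-! ### Laws of large numbers along squares -/

/-- Controls the squared averages of `z` over the ranges with lengths between `k ^ 2` and
`(k + 1) ^ 2`. -/
def sqDev (z : ℕ → ℂ) (k : ℕ) : ℝ :=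
  2 * ‖∑ c ∈ Finset.range (k ^ 2), z c‖ ^ 2 / (k : ℝ) ^ 4 +
    2 * (2 * k + 1) / (k : ℝ) ^ 4 * ∑ c ∈ Finset.Ico (k ^ 2) ((k + 1) ^ 2), ‖z c‖ ^ 2

theorem sqDev_nonneg (z : ℕ → ℂ) (k : ℕ) : 0 ≤ sqDev z k := by
  unfold sqDev
  have : 0 ≤ ∑ c ∈ Finset.Ico (k ^ 2) ((k + 1) ^ 2), ‖z c‖ ^ 2 :=
    Finset.sum_nonneg fun _ _ => by positivity
  positivity

/-- The sum up to C splits at k². The remainder lies in a gap of 2k + 1 indices, so Cauchy–Schwarz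
over the whole gap bounds it independently of C, and C ≥ k² replaces C² by k⁴. -/
theorem avg_sq_le_sqDev (z : ℕ → ℂ) {k C : ℕ} (hk : 0 < k) (h1 : k ^ 2 ≤ C)
    (h2 : C < (k + 1) ^ 2) : (‖∑ c ∈ Finset.range C, z c‖ / C) ^ 2 ≤ sqDev z k := by
  have hsplit : ∑ c ∈ Finset.range C, z c
      = ∑ c ∈ Finset.range (k ^ 2), z c + ∑ c ∈ Finset.Ico (k ^ 2) C, z c :=
    (Finset.sum_range_add_sum_Ico _ h1).symm
  set A := ∑ c ∈ Finset.range (k ^ 2), z c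
  set B := ∑ c ∈ Finset.Ico (k ^ 2) C, z c with hB
  set T := ∑ c ∈ Finset.Ico (k ^ 2) ((k + 1) ^ 2), ‖z c‖ ^ 2 with hT
  have hBT : ‖B‖ ^ 2 ≤ (2 * k + 1) * T := by
    have h3 : ‖B‖ ≤ ∑ c ∈ Finset.Ico (k ^ 2) ((k + 1) ^ 2), ‖z c‖ :=
      (norm_sum_le _ _).trans (Finset.sum_le_sum_of_subset_of_nonneg
        (Finset.Ico_subset_Ico_right h2.le) fun _ _ _ => norm_nonneg _)
    have h4 := sq_sum_le_card_mul_sum_sq (s := Finset.Ico (k ^ 2) ((k + 1) ^ 2))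
      (f := fun c => ‖z c‖)
    have h5 : ((Finset.Ico (k ^ 2) ((k + 1) ^ 2)).card : ℝ) = 2 * k + 1 := by
      rw [Nat.card_Ico, Nat.cast_sub (Nat.pow_le_pow_left (Nat.le_succ k) 2)]
      push_cast; ring
    rw [h5] at h4
    exact (pow_le_pow_left₀ (norm_nonneg _) h3 2).trans h4
  have hAB : ‖A + B‖ ^ 2 ≤ 2 * ‖A‖ ^ 2 + 2 * ‖B‖ ^ 2 := by
    have := pow_le_pow_left₀ (norm_nonneg _) (norm_add_le A B) 2
    nlinarith [sq_nonneg (‖A‖ - ‖B‖)]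
  have hk' : (0 : ℝ) < (k : ℝ) ^ 4 := by positivity
  have hC : (k : ℝ) ^ 4 ≤ (C : ℝ) ^ 2 := by
    have : ((k ^ 2 : ℕ) : ℝ) ≤ C := by exact_mod_cast h1
    push_cast at this
    calc (k : ℝ) ^ 4 = ((k : ℝ) ^ 2) ^ 2 := by ring
      _ ≤ _ := pow_le_pow_left₀ (by positivity) this 2
  rw [hsplit, div_pow]
  calc ‖A + B‖ ^ 2 / (C : ℝ) ^ 2 ≤ ‖A + B‖ ^ 2 / (k : ℝ) ^ 4 := by gcongr
    _ ≤ (2 * ‖A‖ ^ 2 + 2 * ((2 * k + 1) * T)) / (k : ℝ) ^ 4 := by gcongr; linarith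
    _ = sqDev z k := by rw [sqDev, ← hT]; simp only [A]; field_simp

theorem exists_sq_le_lt {C k₀ : ℕ} (h : k₀ ^ 2 ≤ C) :
    ∃ k, k₀ ≤ k ∧ k ^ 2 ≤ C ∧ C < (k + 1) ^ 2 :=
  ⟨Nat.sqrt C, Nat.le_sqrt'.2 h, Nat.sqrt_le' C, Nat.lt_succ_sqrt' C⟩

/-- The tail of the series of `sqDev`. -/
def sqDevTail (z : ℕ → ℂ) (k₀ : ℕ) : ENNReal := ∑' k, ENNReal.ofReal (sqDev z (k + k₀))

/-- One term of the tail already suffices. The gain is a bound valid for all C ≥ k₀² simultaneously,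
which is what later permits a joint limit in two indices. -/
theorem avg_sq_le_sqDevTail (z : ℕ → ℂ) {k₀ C : ℕ} (hk : 0 < k₀) (h : k₀ ^ 2 ≤ C) :
    ENNReal.ofReal ((‖∑ c ∈ Finset.range C, z c‖ / C) ^ 2) ≤ sqDevTail z k₀ := by
  obtain ⟨k, h0, h1, h2⟩ := exists_sq_le_lt h
  refine (ENNReal.ofReal_le_ofReal (avg_sq_le_sqDev z (hk.trans_le h0) h1 h2)).trans ?_
  obtain ⟨d, rfl⟩ := Nat.exists_eq_add_of_le' h0
  exact ENNReal.le_tsum d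

theorem tendsto_avg_of_sqDevTail (z : ℕ → ℂ) (h : sqDevTail z 1 ≠ ⊤) :
    Tendsto (fun C : ℕ => (∑ c ∈ Finset.range C, z c) / (C : ℂ)) atTop (𝓝 0) := by
  have h1 := ENNReal.tendsto_sum_nat_add _ h
  have h2 : Tendsto (fun k => sqDevTail z (k + 1)) atTop (𝓝 0) := by
    refine h1.congr fun k => ?_
    unfold sqDevTail
    exact tsum_congr fun i => by rw [add_assoc]
  rw [Metric.tendsto_atTop]
  intro e he
  obtain ⟨k, hk⟩ := ((ENNReal.tendsto_nhds_zero.1 h2) (ENNReal.ofReal ((e / 2) ^ 2))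
    (ENNReal.ofReal_pos.2 (by positivity))).exists
  refine ⟨(k + 1) ^ 2, fun C hC => ?_⟩
  have h3 := (avg_sq_le_sqDevTail z (Nat.succ_pos k) hC).trans hk
  rw [ENNReal.ofReal_le_ofReal_iff (by positivity)] at h3
  have h4 := abs_le_of_sq_le_sq' h3 (by positivity)
  rw [dist_zero_right, norm_div, Complex.norm_natCast]
  linarith [h4.2]

section

variable {Ω : Type*} [MeasurableSpace Ω] {μ : Measure Ω}

theorem integral_norm_sq_sum_of_uncorrelated {ι : Type*} (s : Finset ι) {f : ι → Ω → ℂ}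
    (hf : ∀ i, MemLp (f i) 2 μ)
    (hu : ∀ i i', i ≠ i' → ∫ ω, f i ω * conj (f i' ω) ∂μ = 0) :
    ∫ ω, ‖∑ i ∈ s, f i ω‖ ^ 2 ∂μ = ∑ i ∈ s, ∫ ω, ‖f i ω‖ ^ 2 ∂μ := by
  classical
  have hint : ∀ i i', Integrable (fun ω => f i ω * conj (f i' ω)) μ := fun i i' =>
    (hf i).integrable_mul (hf i').star
  have hsq : ∀ z : ℂ, ((‖z‖ ^ 2 : ℝ) : ℂ) = z * conj z := fun z => by
    rw [Complex.mul_conj, Complex.normSq_eq_norm_sq]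
  apply Complex.ofReal_injective
  rw [← integral_complex_ofReal]
  push_cast [← integral_complex_ofReal]
  have h1 : ∀ ω, ((‖∑ i ∈ s, f i ω‖ : ℂ)) ^ 2 = ∑ i ∈ s, ∑ i' ∈ s, f i ω * conj (f i' ω) := by
    intro ω
    have := hsq (∑ i ∈ s, f i ω)
    push_cast at this
    rw [this, map_sum, Finset.sum_mul_sum]
  simp_rw [h1]
  rw [integral_finsetSum _ fun i _ => integrable_finsetSum _ fun i' _ => hint i i']
  refine Finset.sum_congr rfl fun i hi => ?_
  rw [integral_finsetSum _ fun i' _ => hint i i', Finset.sum_eq_single i]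
  · refine integral_congr_ae (ae_of_all _ fun ω => ?_)
    have := hsq (f i ω)
    push_cast at this
    exact this.symm
  · exact fun b _ hb => hu i b hb.symm
  · exact fun h => absurd hi h

/-- Orthogonality makes the second moment of the sum up to k² at most k² v, and the gap contributes
at most (2k + 1)² v. After division by k⁴ both are O(k⁻²), hence summable: this is why the
subsequence of squares is used. -/
theorem integral_sqDev_le {f : ℕ → Ω → ℂ} {v : ℝ} (hf : ∀ i, MemLp (f i) 2 μ)
    (hu : ∀ i i', i ≠ i' → ∫ ω, f i ω * conj (f i' ω) ∂μ = 0)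
    (hv : ∀ i, ∫ ω, ‖f i ω‖ ^ 2 ∂μ ≤ v) (k : ℕ) :
    Integrable (fun ω => sqDev (fun c => f c ω) k) μ ∧
      ∫ ω, sqDev (fun c => f c ω) k ∂μ ≤ 20 * v / (k : ℝ) ^ 2 := by
  have hI : ∀ i, Integrable (fun ω => ‖f i ω‖ ^ 2) μ := fun i => (hf i).integrable_norm_pow two_ne_zero
  have hS : Integrable (fun ω => ‖∑ c ∈ Finset.range (k ^ 2), f c ω‖ ^ 2) μ :=
    (memLp_finsetSum _ fun i _ => hf i).integrable_norm_pow two_ne_zero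
  have hi1 : Integrable (fun ω => 2 * ‖∑ c ∈ Finset.range (k ^ 2), f c ω‖ ^ 2 / (k : ℝ) ^ 4) μ :=
    (hS.const_mul 2).div_const _
  have hi2 : Integrable (fun ω => 2 * (2 * k + 1) / (k : ℝ) ^ 4 *
      ∑ c ∈ Finset.Ico (k ^ 2) ((k + 1) ^ 2), ‖f c ω‖ ^ 2) μ :=
    (integrable_finsetSum _ fun i _ => hI i).const_mul _
  refine ⟨hi1.add hi2, ?_⟩
  unfold sqDev
  rw [integral_add hi1 hi2, integral_div, integral_const_mul, integral_const_mul,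
    integral_norm_sq_sum_of_uncorrelated _ hf hu, integral_finsetSum _ fun i _ => hI i]
  rcases Nat.eq_zero_or_pos k with rfl | hk
  · simp
  have hv0 : 0 ≤ v := le_trans (integral_nonneg fun ω => by positivity) (hv 0)
  have e1 : ∑ i ∈ Finset.range (k ^ 2), ∫ ω, ‖f i ω‖ ^ 2 ∂μ ≤ k ^ 2 * v := by
    refine (Finset.sum_le_sum fun i _ => hv i).trans ?_
    simp
  have e2 : ∑ i ∈ Finset.Ico (k ^ 2) ((k + 1) ^ 2), ∫ ω, ‖f i ω‖ ^ 2 ∂μ ≤ (2 * k + 1) * v := by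
    refine (Finset.sum_le_sum fun i _ => hv i).trans ?_
    rw [Finset.sum_const, Nat.card_Ico, nsmul_eq_mul,
      Nat.cast_sub (Nat.pow_le_pow_left (Nat.le_succ k) 2)]
    push_cast
    apply le_of_eq; ring
  have hk1 : (1 : ℝ) ≤ k := by exact_mod_cast hk
  calc _ ≤ 2 * (k ^ 2 * v) / (k : ℝ) ^ 4 + 2 * (2 * k + 1) / (k : ℝ) ^ 4 * ((2 * k + 1) * v) := by
        gcongr
    _ = (2 * (k ^ 2 * v) + 2 * (2 * k + 1) ^ 2 * v) / (k : ℝ) ^ 4 := by field_simp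
    _ ≤ (20 * v * k ^ 2) / (k : ℝ) ^ 4 := by
        gcongr
        -- With 2k + 1 ≤ 3k for k ≥ 1 the constant is 2 + 2 · 9 = 20.
        have : (2 * (k : ℝ) + 1) ^ 2 ≤ 9 * k ^ 2 := by nlinarith
        nlinarith
    _ = _ := by field_simp

theorem tsum_sq_ne_top (v : ℝ) : ∑' k : ℕ, ENNReal.ofReal (20 * v / (k : ℝ) ^ 2) ≠ ⊤ := by
  have : Summable fun k : ℕ => 20 * v / (k : ℝ) ^ 2 := by
    simpa [div_eq_mul_inv] using (Real.summable_nat_pow_inv.2 (by norm_num : 1 < 2)).mul_left (20 * v)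
  exact this.tsum_ofReal_ne_top

theorem lintegral_sqDevTail_le {f : ℕ → Ω → ℂ} {v : ℝ} (hf : ∀ i, MemLp (f i) 2 μ)
    (hu : ∀ i i', i ≠ i' → ∫ ω, f i ω * conj (f i' ω) ∂μ = 0)
    (hv : ∀ i, ∫ ω, ‖f i ω‖ ^ 2 ∂μ ≤ v) (k₀ : ℕ) :
    ∫⁻ ω, sqDevTail (fun c => f c ω) k₀ ∂μ
      ≤ ∑' k : ℕ, ENNReal.ofReal (20 * v / ((k + k₀ : ℕ) : ℝ) ^ 2) := by
  unfold sqDevTail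
  have h := integral_sqDev_le hf hu hv
  rw [lintegral_tsum fun k => (h (k + k₀)).1.aemeasurable.ennreal_ofReal]
  refine ENNReal.tsum_le_tsum fun k => ?_
  rw [← ofReal_integral_eq_lintegral_ofReal (h _).1 (ae_of_all _ fun ω => sqDev_nonneg _ _)]
  exact ENNReal.ofReal_le_ofReal (h _).2

theorem aemeasurable_sqDevTail {f : ℕ → Ω → ℂ} {v : ℝ} (hf : ∀ i, MemLp (f i) 2 μ)
    (hu : ∀ i i', i ≠ i' → ∫ ω, f i ω * conj (f i' ω) ∂μ = 0)
    (hv : ∀ i, ∫ ω, ‖f i ω‖ ^ 2 ∂μ ≤ v) (k₀ : ℕ) :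
    AEMeasurable (fun ω => sqDevTail (fun c => f c ω) k₀) μ :=
  AEMeasurable.tsum fun k =>
    (integral_sqDev_le hf hu hv (k + k₀)).1.aemeasurable.ennreal_ofReal

theorem ae_sqDevTail_ne_top {f : ℕ → Ω → ℂ} {v : ℝ} (hf : ∀ i, MemLp (f i) 2 μ)
    (hu : ∀ i i', i ≠ i' → ∫ ω, f i ω * conj (f i' ω) ∂μ = 0)
    (hv : ∀ i, ∫ ω, ‖f i ω‖ ^ 2 ∂μ ≤ v) (k₀ : ℕ) :
    ∀ᵐ ω ∂μ, sqDevTail (fun c => f c ω) k₀ ≠ ⊤ := by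
  have hfin : ∫⁻ ω, sqDevTail (fun c => f c ω) k₀ ∂μ ≠ ⊤ := by
    refine ne_top_of_le_ne_top (tsum_sq_ne_top v) ((lintegral_sqDevTail_le hf hu hv k₀).trans ?_)
    exact ENNReal.tsum_comp_le_tsum_of_injective (add_left_injective k₀)
      fun k : ℕ => ENNReal.ofReal (20 * v / (k : ℝ) ^ 2)
  filter_upwards [ae_lt_top' (aemeasurable_sqDevTail hf hu hv k₀) hfin] with ω hω using hω.ne

/-- Strong law of large numbers for uncorrelated variables with bounded second moments. -/
theorem ae_tendsto_avg_of_uncorrelated {f : ℕ → Ω → ℂ} {v : ℝ} (hf : ∀ i, MemLp (f i) 2 μ)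
    (hu : ∀ i i', i ≠ i' → ∫ ω, f i ω * conj (f i' ω) ∂μ = 0)
    (hv : ∀ i, ∫ ω, ‖f i ω‖ ^ 2 ∂μ ≤ v) :
    ∀ᵐ ω ∂μ, Tendsto (fun C : ℕ => (∑ c ∈ Finset.range C, f c ω) / (C : ℂ)) atTop (𝓝 0) := by
  filter_upwards [ae_sqDevTail_ne_top hf hu hv 1] with ω hω
  exact tendsto_avg_of_sqDevTail _ hω

theorem measurable_sqDevTail {G : Type*} [MeasurableSpace G] {ξ : ℕ → G → ℂ}
    (hξ : ∀ c, Measurable (ξ c)) (k₀ : ℕ) :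
    Measurable fun g => sqDevTail (fun c => ξ c g) k₀ := by
  unfold sqDevTail sqDev
  fun_prop

/-- For independent, identically distributed rows with uncorrelated entries, the mean over the rows
of the squared row averages tends to zero when both dimensions grow, independently of each other. -/
theorem ae_tendsto_mean_sq_avg {G : Type*} [MeasurableSpace G] {R : ℕ → Ω → G}
    (hR : ∀ b, Measurable (R b)) (hind : Pairwise fun b b' => IndepFun (R b) (R b') μ)
    (hid : ∀ b, μ.map (R b) = μ.map (R 0)) {ξ : ℕ → G → ℂ} (hξ : ∀ c, Measurable (ξ c)) {v : ℝ}
    (hf : ∀ i, MemLp (fun ω => ξ i (R 0 ω)) 2 μ)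
    (hu : ∀ i i', i ≠ i' → ∫ ω, ξ i (R 0 ω) * conj (ξ i' (R 0 ω)) ∂μ = 0)
    (hv : ∀ i, ∫ ω, ‖ξ i (R 0 ω)‖ ^ 2 ∂μ ≤ v) :
    ∀ᵐ ω ∂μ, Tendsto (fun q : ℕ × ℕ => (∑ b ∈ Finset.range q.1,
      (‖∑ c ∈ Finset.range q.2, ξ c (R b ω)‖ / (q.2 : ℝ)) ^ 2) / (q.1 : ℝ))
      (atTop ×ˢ atTop) (𝓝 0) := by
  have hident : ∀ b, IdentDistrib (R b) (R 0) μ μ := fun b =>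
    ⟨(hR b).aemeasurable, (hR 0).aemeasurable, hid b⟩
  set T : ℕ → G → ENNReal := fun k g => sqDevTail (fun c => ξ c g) k with hT
  have hTm : ∀ k, Measurable (T k) := fun k => measurable_sqDevTail hξ k
  have hbound := lintegral_sqDevTail_le hf hu hv
  have hlim : Tendsto (fun k₀ => ∑' k : ℕ, ENNReal.ofReal (20 * v / ((k + k₀ : ℕ) : ℝ) ^ 2))
      atTop (𝓝 0) := ENNReal.tendsto_sum_nat_add _ (tsum_sq_ne_top v)
  have hfin : ∀ k, ∫⁻ ω, T k (R 0 ω) ∂μ ≠ ⊤ := fun k => by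
    refine ne_top_of_le_ne_top (tsum_sq_ne_top v) ((hbound k).trans ?_)
    exact ENNReal.tsum_comp_le_tsum_of_injective (add_left_injective k)
      fun k : ℕ => ENNReal.ofReal (20 * v / (k : ℝ) ^ 2)
  have hae : ∀ᵐ ω ∂μ, ∀ k b, T k (R b ω) ≠ ⊤ := by
    rw [ae_all_iff]; intro k
    rw [ae_all_iff]; intro b
    have h1 : IdentDistrib (fun ω => T k (R b ω)) (fun ω => T k (R 0 ω)) μ μ :=
      (hident b).comp (hTm k)
    have h2 : ∀ᵐ ω ∂μ, T k (R b ω) < ⊤ :=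
      ae_lt_top ((hTm k).comp (hR b)) (by rw [h1.lintegral_eq]; exact hfin k)
    filter_upwards [h2] with ω h using h.ne
  -- The tails of different rows are pairwise independent, identically distributed and integrable,
  -- so the strong law applies to their mean over the rows. The column count no longer occurs.
  have hlaw : ∀ᵐ ω ∂μ, ∀ k, Tendsto (fun B : ℕ => (∑ b ∈ Finset.range B, (T k (R b ω)).toReal) / B)
      atTop (𝓝 (∫ ω, (T k (R 0 ω)).toReal ∂μ)) := by
    rw [ae_all_iff]; intro k
    have hm : Measurable fun g => (T k g).toReal := (hTm k).ennreal_toReal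
    refine strong_law_ae_real (fun b ω => (T k (R b ω)).toReal) ?_ ?_ ?_
    · exact integrable_toReal_of_lintegral_ne_top ((hTm k).comp (hR 0)).aemeasurable (hfin k)
    · exact fun b b' hbb => (hind hbb).comp hm hm
    · exact fun b => (hident b).comp hm
  filter_upwards [hae, hlaw] with ω h1 h2
  rw [Metric.tendsto_nhds]
  intro e he
  -- The expected tail is bounded by a remainder of a convergent series, so it drops below e. This k
  -- fixes a threshold k² for the column count, chosen independently of the number of rows.
  obtain ⟨k, hk0, hk⟩ : ∃ k, 0 < k ∧ ∫ ω, (T k (R 0 ω)).toReal ∂μ < e := by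
    obtain ⟨k, hk⟩ := ((eventually_gt_atTop 0).and ((ENNReal.tendsto_nhds_zero.1 hlim)
      (ENNReal.ofReal (e / 2)) (ENNReal.ofReal_pos.2 (by positivity)))).exists
    refine ⟨k, hk.1, ?_⟩
    have hm : Measurable fun ω => T k (R 0 ω) := (hTm k).comp (hR 0)
    rw [integral_toReal hm.aemeasurable (ae_lt_top hm (hfin k))]
    have := ENNReal.toReal_mono (by simp) ((hbound k).trans hk.2)
    rw [ENNReal.toReal_ofReal (by positivity)] at this
    exact this.trans_lt (by linarith)
  have hB := (h2 k).eventually (gt_mem_nhds hk)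
  filter_upwards [hB.prod_mk (eventually_ge_atTop (k ^ 2))] with q hq
  rw [Real.dist_eq, sub_zero, abs_of_nonneg (by positivity)]
  refine lt_of_le_of_lt ?_ hq.1
  gcongr with b hb
  have h3 := ENNReal.toReal_mono (h1 k b) (avg_sq_le_sqDevTail (fun c => ξ c (R b ω)) hk0 hq.2)
  rwa [ENNReal.toReal_ofReal (by positivity)] at h3

end

/-! ### Operator norm of a noise matrix -/

/-- The Gram matrix of the rows is C(κ I + E), so the left side is C times a quadratic form of κ I +
E. The operator norm of E is at most its Frobenius norm √F, and √F ≤ 1 + F keeps the bound linear in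
F, the quantity whose mean over blocks is controlled. -/
theorem sum_norm_sq_combination_le {k : ℕ} (C : ℕ) (κ : ℝ) (z : Fin k → ℕ → ℂ)
    (e : Fin k → Fin k → ℂ) (y : Fin k → ℂ)
    (he : ∀ r s, ∑ c ∈ Finset.range C, z r c * conj (z s c)
      = (C : ℂ) * (e r s + if r = s then (κ : ℂ) else 0)) :
    ∑ c ∈ Finset.range C, ‖∑ r, y r * z r c‖ ^ 2
      ≤ C * (κ + 1 + ∑ r, ∑ s, ‖e r s‖ ^ 2) * ∑ r, ‖y r‖ ^ 2 := by
  set Y := ∑ r, ‖y r‖ ^ 2 with hY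
  set F := ∑ r, ∑ s, ‖e r s‖ ^ 2 with hF
  have hY0 : 0 ≤ Y := Finset.sum_nonneg fun _ _ => by positivity
  have hF0 : 0 ≤ F := Finset.sum_nonneg fun _ _ => Finset.sum_nonneg fun _ _ => by positivity
  have hsq : ∀ z : ℂ, ((‖z‖ ^ 2 : ℝ) : ℂ) = z * conj z := fun z => by
    rw [Complex.mul_conj, Complex.normSq_eq_norm_sq]
  have hid : ((∑ c ∈ Finset.range C, ‖∑ r, y r * z r c‖ ^ 2 : ℝ) : ℂ)
      = C * (∑ r, ∑ s, y r * conj (y s) * e r s) + C * κ * Y := by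
    rw [Complex.ofReal_sum]
    simp_rw [hsq, map_sum, Finset.sum_mul_sum]
    rw [Finset.sum_comm]
    have h1 : ∀ r, ∑ c ∈ Finset.range C, ∑ s, y r * z r c * conj (y s * z s c)
        = C * (∑ s, y r * conj (y s) * e r s) + C * κ * (y r * conj (y r)) := by
      intro r
      rw [Finset.sum_comm]
      have h2 : ∀ s, ∑ c ∈ Finset.range C, y r * z r c * conj (y s * z s c)
          = C * (y r * conj (y s) * e r s) +
            C * κ * (if r = s then y r * conj (y s) else 0) := by
        intro s
        have : ∀ c, y r * z r c * conj (y s * z s c)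
            = y r * conj (y s) * (z r c * conj (z s c)) := fun c => by rw [map_mul]; ring
        simp_rw [this, ← Finset.mul_sum, he]
        split_ifs <;> ring
      simp_rw [h2, Finset.sum_add_distrib, ← Finset.mul_sum]
      simp
    simp_rw [h1, Finset.sum_add_distrib, ← Finset.mul_sum, hY, Complex.ofReal_sum, hsq]
  have hCS : ‖∑ r, ∑ s, y r * conj (y s) * e r s‖ ≤ Y * (1 + F) := by
    have h1 : ‖∑ r, ∑ s, y r * conj (y s) * e r s‖
        ≤ ∑ p : Fin k × Fin k, (‖y p.1‖ * ‖y p.2‖) * ‖e p.1 p.2‖ := by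
      rw [Fintype.sum_prod_type]
      refine (norm_sum_le _ _).trans (Finset.sum_le_sum fun r _ =>
        (norm_sum_le _ _).trans (Finset.sum_le_sum fun s _ => ?_))
      simp
    refine h1.trans (abs_le_of_sq_le_sq' ?_ (by positivity)).2
    refine (Finset.sum_mul_sq_le_sq_mul_sq _ _ _).trans ?_
    have h2 : ∑ p : Fin k × Fin k, (‖y p.1‖ * ‖y p.2‖) ^ 2 = Y ^ 2 := by
      rw [Fintype.sum_prod_type, sq Y, hY, Finset.sum_mul_sum]
      simp_rw [mul_pow]
    have h3 : ∑ p : Fin k × Fin k, ‖e p.1 p.2‖ ^ 2 = F := by rw [Fintype.sum_prod_type]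
    rw [h2, h3, mul_pow]
    gcongr
    nlinarith
  have h0 : (∑ c ∈ Finset.range C, ‖∑ r, y r * z r c‖ ^ 2 : ℝ)
      = C * (∑ r, ∑ s, y r * conj (y s) * e r s).re + C * κ * Y := by
    have := congrArg Complex.re hid
    simpa only [Complex.ofReal_re, Complex.add_re, ← Complex.ofReal_natCast, ← Complex.ofReal_mul,
      Complex.re_ofReal_mul] using this
  rw [h0]
  have := (Complex.re_le_norm _).trans hCS
  nlinarith [mul_le_mul_of_nonneg_left this (Nat.cast_nonneg (α := ℝ) C)]

theorem sum_range_mul_eq {A : Type*} [AddCommMonoid A] (f : ℕ → A) (B k : ℕ) :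
    ∑ m ∈ Finset.range (B * k), f m = ∑ b ∈ Finset.range B, ∑ r : Fin k, f (b * k + r) := by
  induction B with
  | zero => simp
  | succ n ih =>
    rw [Nat.succ_mul, Finset.sum_range_add, ih, Finset.sum_range_succ,
      ← Fin.sum_univ_eq_sum_range (fun x => f (n * k + x))]

/-- Cauchy–Schwarz over the blocks is weighted by the bound `Y b` of each block. The weights cancel
the block bounds and leave their sum as the overall factor, so only the mean of the block errors
matters, not their maximum. -/
theorem sum_norm_sq_blocks_le {k : ℕ} (B C : ℕ) {κ : ℝ} (hκ : 0 ≤ κ) (z : ℕ → ℕ → ℂ)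
    (e : ℕ → Fin k → Fin k → ℂ) (y : ℕ → ℂ)
    (he : ∀ b (r s : Fin k), ∑ c ∈ Finset.range C, z (b * k + r) c * conj (z (b * k + s) c)
      = (C : ℂ) * (e b r s + if r = s then (κ : ℂ) else 0)) :
    ∑ c ∈ Finset.range C, ‖∑ m ∈ Finset.range (B * k), y m * z m c‖ ^ 2
      ≤ C * (∑ b ∈ Finset.range B, (κ + 1 + ∑ r, ∑ s, ‖e b r s‖ ^ 2)) *
        ∑ m ∈ Finset.range (B * k), ‖y m‖ ^ 2 := by
  set Y : ℕ → ℝ := fun b => κ + 1 + ∑ r, ∑ s, ‖e b r s‖ ^ 2 with hY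
  have hYpos : ∀ b, 0 < Y b := fun b => by
    have : 0 ≤ ∑ r, ∑ s, ‖e b r s‖ ^ 2 :=
      Finset.sum_nonneg fun _ _ => Finset.sum_nonneg fun _ _ => by positivity
    simp only [hY]; linarith
  have h1 : ∀ c, ‖∑ m ∈ Finset.range (B * k), y m * z m c‖ ^ 2
      ≤ (∑ b ∈ Finset.range B, Y b) * ∑ b ∈ Finset.range B,
        ‖∑ r : Fin k, y (b * k + r) * z (b * k + r) c‖ ^ 2 / Y b := by
    intro c
    rw [sum_range_mul_eq]
    rcases B.eq_zero_or_pos with rfl | hB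
    · simp
    have hpos : 0 < ∑ b ∈ Finset.range B, Y b :=
      Finset.sum_pos (fun b _ => hYpos b) (Finset.nonempty_range_iff.2 hB.ne')
    rw [mul_comm, ← div_le_iff₀ hpos]
    refine le_trans ?_ (Finset.sq_sum_div_le_sum_sq_div _ _ fun b _ => hYpos b)
    gcongr
    exact norm_sum_le _ _
  refine (Finset.sum_le_sum fun c _ => h1 c).trans ?_
  rw [← Finset.mul_sum, Finset.sum_comm]
  rw [mul_comm (C : ℝ), mul_assoc, sum_range_mul_eq (fun m => ‖y m‖ ^ 2)]
  refine mul_le_mul_of_nonneg_left ?_ (Finset.sum_nonneg fun b _ => (hYpos b).le)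
  rw [Finset.mul_sum]
  refine Finset.sum_le_sum fun b _ => ?_
  rw [← Finset.sum_div, div_le_iff₀ (hYpos b)]
  refine (sum_norm_sq_combination_le C κ (fun r c => z (b * k + r) c) (e b)
    (fun r => y (b * k + r)) (he b)).trans (le_of_eq ?_)
  simp only [hY]; ring

theorem measurable_pi_iSup {Ω ι α β : Type*} [MeasurableSpace β] (m : ι → MeasurableSpace Ω)
    {S : Set ι} {f : α → Ω → β} (g : α → ι) (hg : ∀ a, g a ∈ S)
    (h : ∀ a, MeasurableSpace.comap (f a) inferInstance ≤ m (g a)) :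
    Measurable[⨆ i ∈ S, m i] fun ω a => f a ω := by
  refine (@measurable_pi_iff Ω α (fun _ => β) (⨆ i ∈ S, m i) _ _).2 fun a => ?_
  exact measurable_iff_comap_le.2 ((h a).trans (le_iSup₂ (f := fun i _ => m i) (g a) (hg a)))

section

variable {Ω : Type*} [MeasurableSpace Ω] {μ : Measure Ω}

theorem indepFun_of_disjoint_index {ι : Type*} {m : ι → MeasurableSpace Ω}
    (hm : ∀ i, m i ≤ ‹MeasurableSpace Ω›) (hi : iIndep m μ) {S T : Set ι} (hST : Disjoint S T)
    {β γ : Type*} [MeasurableSpace β] [MeasurableSpace γ] {f : Ω → β} {g : Ω → γ}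
    (hf : Measurable[⨆ i ∈ S, m i] f) (hg : Measurable[⨆ i ∈ T, m i] g) : IndepFun f g μ := by
  rw [IndepFun_iff_Indep]
  exact indep_of_indep_of_le (indep_iSup_of_disjoint hm hi hST) hf.comap_le hg.comap_le

variable {Z : ℕ → ℕ → Ω → ℂ} {ν : Measure ℂ}

/-- A whole block of k rows is treated as a single random element. Distinct blocks use disjoint sets
of entries, hence are independent with the same product law, and within a block the centred products
for distinct columns are uncorrelated. Fourth moments of the noise give the second moments of these
products. -/
theorem ae_tendsto_block_correlation [IsProbabilityMeasure μ] (hZ : ∀ m c, Measurable (Z m c))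
    (hlaw : ∀ m c, μ.map (Z m c) = ν) (hind : iIndepFun (fun i : ℕ × ℕ => Z i.1 i.2) μ)
    (hmean : ∫ z, z ∂ν = 0) (hmem : MemLp id 4 ν) {k : ℕ} (r s : Fin k) :
    ∀ᵐ ω ∂μ, Tendsto (fun q : ℕ × ℕ => (∑ b ∈ Finset.range q.1,
      (‖∑ c ∈ Finset.range q.2, (Z (b * k + r) c ω * conj (Z (b * k + s) c ω) -
        if r = s then ((∫ z, ‖z‖ ^ 2 ∂ν : ℝ) : ℂ) else 0)‖ / (q.2 : ℝ)) ^ 2) / (q.1 : ℝ))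
      (atTop ×ˢ atTop) (𝓝 0) := by
  set κ : ℝ := ∫ z, ‖z‖ ^ 2 ∂ν with hκ
  have hνp : IsProbabilityMeasure ν := by
    rw [← hlaw 0 0]; exact Measure.isProbabilityMeasure_map (hZ 0 0).aemeasurable
  have hmemZ : ∀ m c, MemLp (Z m c) 4 μ := fun m c => by
    rw [← hlaw m c] at hmem
    exact (memLp_map_measure_iff aestronglyMeasurable_id (hZ m c).aemeasurable).1 hmem
  have htri : ENNReal.HolderTriple 4 4 2 := ⟨by
    rw [← ENNReal.toReal_eq_toReal_iff' (by simp) (by simp), ENNReal.toReal_add (by simp) (by simp)]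
    simp; norm_num⟩
  have hprod : ∀ m n c, MemLp (fun ω => Z m c ω * conj (Z n c ω)) 2 μ := fun m n c =>
    MemLp.mul (r := 2) (hmemZ n c).star (hmemZ m c)
  have hm0 : ∀ m c, ∫ ω, Z m c ω ∂μ = 0 := fun m c => by
    rw [← hmean, ← hlaw m c, integral_map (hZ m c).aemeasurable (by fun_prop)]
  have hm2 : ∀ m c, ∫ ω, ‖Z m c ω‖ ^ 2 ∂μ = κ := fun m c => by
    rw [hκ, ← hlaw m c, integral_map (hZ m c).aemeasurable (by fun_prop)]
  have hm4 : ∀ m c, ∫ ω, ‖Z m c ω‖ ^ 4 ∂μ = ∫ z, ‖z‖ ^ 4 ∂ν := fun m c => by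
    rw [← hlaw m c, integral_map (hZ m c).aemeasurable (by fun_prop)]
  set δ : ℂ := if r = s then (κ : ℂ) else 0 with hδ
  have hδn : ‖δ‖ ≤ κ := by
    have : 0 ≤ κ := integral_nonneg fun z => by positivity
    rw [hδ]; split_ifs <;> simp [this, abs_of_nonneg]
  set ξ : ℕ → (Fin k × ℕ → ℂ) → ℂ := fun c g => g (r, c) * conj (g (s, c)) - δ with hξ
  set R : ℕ → Ω → (Fin k × ℕ → ℂ) := fun b ω i => Z (b * k + i.1) i.2 ω with hR
  have hinj : ∀ b, Function.Injective fun i : Fin k × ℕ => ((b * k + i.1 : ℕ), i.2) := by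
    rintro b ⟨i, c⟩ ⟨i', c'⟩ h
    simp only [Prod.mk.injEq, add_right_inj] at h
    exact Prod.ext (Fin.ext h.1) h.2
  have hξm : ∀ b c, MemLp (fun ω => ξ c (R b ω)) 2 μ := fun b c =>
    (hprod _ _ c).sub (memLp_const _)
  have hξ0 : ∀ c, ∫ ω, ξ c (R 0 ω) ∂μ = 0 := by
    intro c
    simp only [hξ, hR]
    rw [integral_sub ((hprod _ _ c).integrable one_le_two) (integrable_const _)]
    simp only [integral_const, probReal_univ, one_smul]
    rw [sub_eq_zero, hδ]
    split_ifs with h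
    · subst h
      rw [← hm2 (0 * k + r) c, ← integral_complex_ofReal]
      exact integral_congr_ae (ae_of_all _ fun ω => by
        simp only [Complex.mul_conj, Complex.normSq_eq_norm_sq])
    · have hne : ((0 * k + r : ℕ), c) ≠ ((0 * k + s : ℕ), c) := fun h' =>
        h (Prod.ext_iff.1 (hinj 0 (a₁ := (r, c)) (a₂ := (s, c)) h')).1
      have hi : IndepFun (Z (0 * k + r) c) (Z (0 * k + s) c) μ := hind.indepFun hne
      have hi' : IndepFun (Z (0 * k + r) c) (fun ω => conj (Z (0 * k + s) c ω)) μ :=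
        hi.comp measurable_id (by fun_prop : Measurable fun z : ℂ => conj z)
      rw [hi'.integral_fun_mul_eq_mul_integral (hZ _ _).aestronglyMeasurable
        (by have := hZ (0 * k + s) c; fun_prop), hm0, zero_mul]
  -- The value of v comes from (xy + κ)² ≤ 2x²y² + 2κ² ≤ x⁴ + y⁴ + 2κ².
  refine ae_tendsto_mean_sq_avg (R := R) (ξ := ξ)
    (v := ∫ z, ‖z‖ ^ 4 ∂ν + ∫ z, ‖z‖ ^ 4 ∂ν + 2 * κ ^ 2) ?_ ?_ ?_ ?_ (hξm 0) ?_ ?_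
  · exact fun b => measurable_pi_iff.2 fun i => hZ _ _
  · intro b b' hbb
    refine indepFun_of_disjoint_index (fun i => (hZ i.1 i.2).comap_le)
      ((iIndepFun_iff_iIndep _ _ _).1 hind)
      (S := Set.range fun i : Fin k × ℕ => ((b * k + i.1 : ℕ), i.2))
      (T := Set.range fun i : Fin k × ℕ => ((b' * k + i.1 : ℕ), i.2)) ?_ ?_ ?_
    · rw [Set.disjoint_left]
      rintro _ ⟨i, rfl⟩ ⟨i', h⟩
      simp only [Prod.mk.injEq] at h
      refine hbb ?_
      have hk : 0 < k := i.1.pos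
      have e1 : (b * k + i.1) / k = b := by
        rw [mul_comm, Nat.mul_add_div hk, Nat.div_eq_of_lt i.1.2, add_zero]
      have e2 : (b' * k + i'.1) / k = b' := by
        rw [mul_comm, Nat.mul_add_div hk, Nat.div_eq_of_lt i'.1.2, add_zero]
      rw [← e1, ← e2, h.1]
    · exact measurable_pi_iSup (fun i : ℕ × ℕ => MeasurableSpace.comap (Z i.1 i.2) inferInstance)
        (fun i : Fin k × ℕ => ((b * k + i.1 : ℕ), i.2)) (fun i => Set.mem_range_self i)
        fun i => le_rfl
    · exact measurable_pi_iSup (fun i : ℕ × ℕ => MeasurableSpace.comap (Z i.1 i.2) inferInstance)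
        (fun i : Fin k × ℕ => ((b' * k + i.1 : ℕ), i.2)) (fun i => Set.mem_range_self i)
        fun i => le_rfl
  · intro b
    have h1 : ∀ b, μ.map (R b) = Measure.infinitePi fun _ : Fin k × ℕ => ν := fun b => by
      have := (hind.precomp (hinj b)).map_fun_eq_infinitePi_map (fun i => hZ _ _)
      simp only [hlaw] at this
      exact this
    rw [h1, h1]
  · intro c
    simp only [hξ]
    fun_prop
  · intro c c' hc
    have hi : IndepFun (fun ω => (Z (0 * k + r) c ω, Z (0 * k + s) c ω))
        (fun ω => (Z (0 * k + r) c' ω, Z (0 * k + s) c' ω)) μ :=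
      hind.indepFun_prodMk_prodMk (fun i => hZ _ _) (0 * k + r, c) (0 * k + s, c)
        (0 * k + r, c') (0 * k + s, c') (by simp [hc]) (by simp [hc]) (by simp [hc]) (by simp [hc])
    have hi' : IndepFun (fun ω => ξ c (R 0 ω)) (fun ω => conj (ξ c' (R 0 ω))) μ :=
      hi.comp (φ := fun p : ℂ × ℂ => p.1 * conj p.2 - δ)
        (ψ := fun p : ℂ × ℂ => conj (p.1 * conj p.2 - δ)) (by fun_prop) (by fun_prop)
    rw [hi'.integral_fun_mul_eq_mul_integral (hξm 0 c).1 (hξm 0 c').star.1, hξ0, zero_mul]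
  · intro c
    have hI4 : ∀ m, Integrable (fun ω => ‖Z m c ω‖ ^ 4) μ := fun m =>
      (hmemZ m c).integrable_norm_pow (by norm_num)
    have hI : Integrable (fun ω => ‖Z (0 * k + r) c ω‖ ^ 4 + ‖Z (0 * k + s) c ω‖ ^ 4) μ :=
      (hI4 _).add (hI4 _)
    calc ∫ ω, ‖ξ c (R 0 ω)‖ ^ 2 ∂μ
        ≤ ∫ ω, (‖Z (0 * k + r) c ω‖ ^ 4 + ‖Z (0 * k + s) c ω‖ ^ 4 + 2 * κ ^ 2) ∂μ := by
          refine integral_mono ((hξm 0 c).integrable_norm_pow two_ne_zero)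
            (hI.add (integrable_const _)) fun ω => ?_
          have h1 : ‖ξ c (R 0 ω)‖ ≤ ‖Z (0 * k + r) c ω‖ * ‖Z (0 * k + s) c ω‖ + κ := by
            refine (norm_sub_le _ _).trans (add_le_add (le_of_eq ?_) hδn)
            simp [hR]
          have h2 := pow_le_pow_left₀ (norm_nonneg _) h1 2
          simp only
          generalize ‖Z (0 * k + r) c ω‖ = x at *
          generalize ‖Z (0 * k + s) c ω‖ = y at *
          nlinarith [sq_nonneg (x * y - κ), sq_nonneg (x ^ 2 - y ^ 2)]
      _ = _ := by
          rw [integral_add hI (integrable_const _), integral_add (hI4 _) (hI4 _), hm4, hm4]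
          simp

/-- The operator norm of the top left `M × C` corner of an infinite matrix of independent,
identically distributed, centred noise is `o(√(M C))` as `M` and `C` grow, independently of each
other. -/
theorem ae_eventually_noise_le [IsProbabilityMeasure μ] (hZ : ∀ m c, Measurable (Z m c))
    (hlaw : ∀ m c, μ.map (Z m c) = ν) (hind : iIndepFun (fun i : ℕ × ℕ => Z i.1 i.2) μ)
    (hmean : ∫ z, z ∂ν = 0) (hmem : MemLp id 4 ν) :
    ∀ᵐ ω ∂μ, ∀ δ : ℝ, 0 < δ → ∀ᶠ q : ℕ × ℕ in atTop ×ˢ atTop, ∀ y : Fin q.1 → ℂ,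
      ∑ c : Fin q.2, ‖∑ m, y m * Z m c ω‖ ^ 2 ≤ δ * q.1 * q.2 * ∑ m, ‖y m‖ ^ 2 := by
  set κ : ℝ := ∫ z, ‖z‖ ^ 2 ∂ν with hκ
  have hκ0 : 0 ≤ κ := integral_nonneg fun z => by positivity
  have hae : ∀ᵐ ω ∂μ, ∀ (k : ℕ) (r s : Fin k), Tendsto (fun q : ℕ × ℕ =>
      (∑ b ∈ Finset.range q.1,
      (‖∑ c ∈ Finset.range q.2, (Z (b * k + r) c ω * conj (Z (b * k + s) c ω) -
        if r = s then (κ : ℂ) else 0)‖ / (q.2 : ℝ)) ^ 2) / (q.1 : ℝ)) (atTop ×ˢ atTop) (𝓝 0) := by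
    simp only [ae_all_iff]
    exact fun k r s => ae_tendsto_block_correlation hZ hlaw hind hmean hmem r s
  filter_upwards [hae] with ω hω δ hδ
  -- There will be at most 2M/k blocks, each costing κ + 2 on average, so this choice of k makes the
  -- total at most δ M.
  obtain ⟨k, hk⟩ := exists_nat_ge (max 1 (2 * (κ + 2) / δ))
  have hk1 : 1 ≤ k := by exact_mod_cast (le_max_left _ _).trans hk
  have hkδ : 2 * (κ + 2) ≤ δ * k := by
    have := (le_max_right _ _).trans hk
    rw [div_le_iff₀ hδ] at this
    linarith
  set e : ℕ → ℕ → Fin k → Fin k → ℂ := fun C b r s =>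
    (∑ c ∈ Finset.range C, (Z (b * k + r) c ω * conj (Z (b * k + s) c ω) -
        if r = s then (κ : ℂ) else 0)) / C with he
  have hlim : Tendsto (fun q : ℕ × ℕ => ∑ r, ∑ s,
      (∑ b ∈ Finset.range q.1, ‖e q.2 b r s‖ ^ 2) / (q.1 : ℝ)) (atTop ×ˢ atTop) (𝓝 0) := by
    have : Tendsto (fun q : ℕ × ℕ => ∑ r, ∑ s,
      (∑ b ∈ Finset.range q.1, ‖e q.2 b r s‖ ^ 2) / (q.1 : ℝ)) (atTop ×ˢ atTop)
        (𝓝 (∑ _r : Fin k, ∑ _s : Fin k, 0)) := by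
      refine tendsto_finsetSum _ fun r _ => tendsto_finsetSum _ fun s _ => ?_
      simpa only [he, norm_div, Complex.norm_natCast] using hω k r s
    simpa using this
  have hB : Tendsto (fun M : ℕ => M / k + 1) atTop atTop :=
    (tendsto_add_atTop_nat 1).comp (Nat.tendsto_div_const_atTop (by omega))
  have hlim' := hlim.comp ((hB.comp tendsto_fst).prodMk (tendsto_snd (f := (atTop : Filter ℕ))
    (g := (atTop : Filter ℕ))))
  filter_upwards [hlim'.eventually (gt_mem_nhds zero_lt_one),
    (eventually_ge_atTop k).prod_mk (eventually_ge_atTop 1)] with q h1 h2 y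
  obtain ⟨M, C⟩ := q
  simp only [Function.comp_apply] at h1 h2 y ⊢
  set B := M / k + 1 with hBdef
  have hMB : M ≤ B * k := by
    have := Nat.lt_div_mul_add (a := M) (b := k) (by omega)
    rw [hBdef, Nat.succ_mul]; omega
  have hBk : (B : ℝ) * k ≤ 2 * M := by
    have h3 := Nat.div_mul_le_self M k
    have : B * k ≤ 2 * M := by rw [hBdef, Nat.succ_mul]; omega
    exact_mod_cast this
  have hBpos : (0 : ℝ) < B := by positivity
  -- The vector is padded with zeros so that its length becomes a multiple of k. For M ≥ k this at
  -- most doubles the length.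
  set y' : ℕ → ℂ := fun m => if h : m < M then y ⟨m, h⟩ else 0 with hy'
  have hext : ∀ {A : Type} [AddCommMonoid A] (f : ℂ → ℕ → A), (∀ m, f 0 m = 0) →
      ∑ m ∈ Finset.range (B * k), f (y' m) m = ∑ m : Fin M, f (y m) m := by
    intro A _ f hf
    rw [← Finset.sum_subset (Finset.range_subset_range.2 hMB), Finset.sum_range]
    · refine Finset.sum_congr rfl fun m _ => ?_
      simp [hy']
    · intro m _ hm
      rw [Finset.mem_range] at hm
      simp [hy', hm, hf]
  have key := sum_norm_sq_blocks_le B C hκ0 (fun m c => Z m c ω) (e C) y' (fun b r s => by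
    have hC : (C : ℂ) ≠ 0 := by
      have := h2.2; exact_mod_cast (by omega : C ≠ 0)
    simp only [he]
    rw [mul_add, mul_div_cancel₀ _ hC, Finset.sum_sub_distrib]
    simp)
  rw [hext (fun z _ => ‖z‖ ^ 2) (by simp), Finset.sum_range] at key
  have hrow : ∀ c, ∑ m ∈ Finset.range (B * k), y' m * Z m c ω = ∑ m : Fin M, y m * Z m c ω :=
    fun c => hext (fun z m => z * Z m c ω) (by simp)
  simp only [hrow] at key
  refine key.trans ?_
  have hY : ∑ b ∈ Finset.range B, (κ + 1 + ∑ r, ∑ s, ‖e C b r s‖ ^ 2) ≤ δ * M := by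
    rw [Finset.sum_add_distrib, Finset.sum_const, Finset.card_range, nsmul_eq_mul,
      Finset.sum_comm]
    have h4 : ∑ r, ∑ b ∈ Finset.range B, ∑ s, ‖e C b r s‖ ^ 2 ≤ B := by
      have h5 : ∀ r, ∑ b ∈ Finset.range B, ∑ s, ‖e C b r s‖ ^ 2
          = ∑ s, ∑ b ∈ Finset.range B, ‖e C b r s‖ ^ 2 := fun r => Finset.sum_comm
      simp_rw [h5]
      simp_rw [← Finset.sum_div] at h1
      rw [div_lt_one hBpos] at h1
      exact h1.le
    have h6 : (B : ℝ) * (2 * (κ + 2)) ≤ B * (δ * k) := by gcongr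
    nlinarith
  calc _ ≤ (C : ℝ) * (δ * M) * ∑ m, ‖y m‖ ^ 2 := by
        gcongr
    _ = _ := by ring

end

namespace UplinkModel

variable {L P τ : ℕ} {Ω : Type*} [MeasurableSpace Ω] {μ : Measure Ω}

/-! ### The channel covariance and its signal space -/

theorem norm_steering_apply (S : UplinkModel L P τ μ) (M : ℕ) (x : ℝ) (m : Fin M) :
    ‖S.steering M x m‖ = 1 := by
  simp only [steering]
  rw [Complex.norm_exp]
  simp

theorem norm_exp_phase (x : ℝ) : ‖Complex.exp (Complex.I * (x : ℂ))‖ = 1 := by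
  rw [mul_comm, Complex.norm_exp_ofReal_mul_I]

theorem norm_steering_sq (S : UplinkModel L P τ μ) (M : ℕ) (x : ℝ) :
    ‖S.steering M x‖ ^ 2 = M := by
  rw [EuclideanSpace.norm_sq_eq]
  simp [norm_steering_apply]

theorem measurable_steering_apply (S : UplinkModel L P τ μ) (M : ℕ) (m : Fin M) :
    Measurable fun x => S.steering M x m := by
  simp only [steering]
  fun_prop

theorem channel_apply (S : UplinkModel L P τ μ) (M : ℕ) (l : Fin L) (ω : Ω) (m : Fin M) :
    S.channel M l ω m = ((S.β l / √(P : ℝ) : ℝ) : ℂ) *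
      ∑ p, Complex.exp (Complex.I * (S.φ l p ω : ℂ)) * S.steering M (S.θ l p ω) m := by
  simp [channel, WithLp.ofLp_sum, WithLp.ofLp_smul]

theorem measurable_channel_apply (S : UplinkModel L P τ μ) (M : ℕ) (l : Fin L) (m : Fin M) :
    Measurable fun ω => S.channel M l ω m := by
  simp only [channel_apply]
  refine Measurable.const_mul (Finset.measurable_sum _ fun p _ => ?_) _
  have h1 := S.φ_measurable l p
  have h2 := (S.measurable_steering_apply M m).comp (S.θ_measurable l p)
  exact Measurable.mul (by fun_prop) h2

theorem scale_pos (S : UplinkModel L P τ μ) (l : Fin L) : 0 < S.β l / √(P : ℝ) := by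
  have h := S.β_pos l
  have hP : (0 : ℝ) < P := by exact_mod_cast S.paths_pos
  positivity

theorem norm_channel_apply_le (S : UplinkModel L P τ μ) (M : ℕ) (l : Fin L) (ω : Ω) (m : Fin M) :
    ‖S.channel M l ω m‖ ≤ S.β l / √(P : ℝ) * P := by
  rw [channel_apply, norm_mul, Complex.norm_real, Real.norm_of_nonneg (S.scale_pos l).le]
  refine mul_le_mul_of_nonneg_left ((norm_sum_le _ _).trans ?_) (S.scale_pos l).le
  simp [norm_steering_apply]

theorem norm_channel_le (S : UplinkModel L P τ μ) (M : ℕ) (l : Fin L) (ω : Ω) :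
    ‖S.channel M l ω‖ ≤ S.β l / √(P : ℝ) * P * √M := by
  have h0 := S.scale_pos l
  rw [EuclideanSpace.norm_eq]
  refine Real.sqrt_le_iff.2 ⟨by positivity, ?_⟩
  calc ∑ m, ‖S.channel M l ω m‖ ^ 2 ≤ ∑ m : Fin M, (S.β l / √(P : ℝ) * P) ^ 2 := by
        gcongr with m; exact S.norm_channel_apply_le M l ω m
    _ = _ := by
        rw [mul_pow _ (√(M : ℝ)), Real.sq_sqrt (Nat.cast_nonneg M)]
        simp [mul_comm]

/-- The quadratic form of the covariance of the channel from cell `l`. -/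
def covForm (S : UplinkModel L P τ μ) (M : ℕ) (l : Fin L) (x : EuclideanSpace ℂ (Fin M)) : ℝ :=
  ∫ ω, ‖⟪x, S.channel M l ω⟫_ℂ‖ ^ 2 ∂μ

theorem inner_eq_sum {M : ℕ} (x y : EuclideanSpace ℂ (Fin M)) :
    ⟪x, y⟫_ℂ = ∑ m, conj (x m) * y m := by
  rw [PiLp.inner_apply]
  simp [mul_comm]

theorem inner_cov_mulVec [IsProbabilityMeasure μ] (S : UplinkModel L P τ μ) (M : ℕ) (l : Fin L)
    (x : EuclideanSpace ℂ (Fin M)) :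
    ⟪x, WithLp.toLp 2 (S.cov M l *ᵥ (x : Fin M → ℂ))⟫_ℂ = (S.covForm M l x : ℂ) := by
  have hint : ∀ m n, Integrable (fun ω => S.channel M l ω m * conj (S.channel M l ω n)) μ := by
    intro m n
    refine Integrable.of_bound (C := (S.β l / √(P : ℝ) * P) ^ 2) ?_ (ae_of_all _ fun ω => ?_)
    · have h1 := S.measurable_channel_apply M l m
      have h2 := S.measurable_channel_apply M l n
      exact (h1.mul (Complex.continuous_conj.measurable.comp h2)).aestronglyMeasurable
    · rw [norm_mul, sq, RCLike.norm_conj]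
      have := S.scale_pos l
      exact mul_le_mul (S.norm_channel_apply_le M l ω m) (S.norm_channel_apply_le M l ω n)
        (norm_nonneg _) (by positivity)
  rw [covForm, ← integral_complex_ofReal, inner_eq_sum]
  have h1 : ∀ ω, ((‖⟪x, S.channel M l ω⟫_ℂ‖ ^ 2 : ℝ) : ℂ)
      = ∑ m, ∑ n, conj (x m) * x n * (S.channel M l ω m * conj (S.channel M l ω n)) := by
    intro ω
    rw [← Complex.normSq_eq_norm_sq, ← Complex.mul_conj, inner_eq_sum, map_sum,
      Finset.sum_mul_sum]
    refine Finset.sum_congr rfl fun m _ => Finset.sum_congr rfl fun n _ => ?_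
    simp only [map_mul, Complex.conj_conj]
    ring
  simp_rw [h1]
  rw [integral_finsetSum _ fun m _ => integrable_finsetSum _ fun n _ => (hint m n).const_mul _]
  refine Finset.sum_congr rfl fun m _ => ?_
  rw [integral_finsetSum _ fun n _ => (hint m n).const_mul _]
  simp only [Matrix.mulVec, dotProduct, cov, Matrix.of_apply, Finset.mul_sum, integral_const_mul]
  exact Finset.sum_congr rfl fun n _ => by ring

/-- The projection on the signal space of `R_j` as a function on Euclidean space. -/
def project (S : UplinkModel L P τ μ) (M : ℕ) (j : Fin L) (ε : ℝ) :
    EuclideanSpace ℂ (Fin M) →ₗ[ℂ] EuclideanSpace ℂ (Fin M) :=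
  Matrix.toEuclideanLin (S.signalProj M j ε)

open Classical in
theorem project_eq_sum (S : UplinkModel L P τ μ) (M : ℕ) (j : Fin L) (ε : ℝ)
    (x : EuclideanSpace ℂ (Fin M)) :
    S.project M j ε x = ∑ i with ε < (S.cov_isHermitian M j).eigenvalues i,
      ⟪(S.cov_isHermitian M j).eigenvectorBasis i, x⟫_ℂ •
        (S.cov_isHermitian M j).eigenvectorBasis i := by
  ext m
  simp only [project, signalProj, Matrix.toLpLin_apply, ← Matrix.mulVec_mulVec]
  simp only [WithLp.ofLp_sum, WithLp.ofLp_smul, Finset.sum_apply, Pi.smul_apply, smul_eq_mul]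
  rw [Finset.sum_subtype (p := fun i => ε < (S.cov_isHermitian M j).eigenvalues i) _ (by simp)]
  simp only [Matrix.mulVec, dotProduct, signalBasis, Matrix.of_apply, Matrix.conjTranspose_apply,
    inner_eq_sum]
  exact Finset.sum_congr rfl fun i _ => mul_comm _ _

/-! ### The signal projection and its spectral bounds -/

section projection

variable (S : UplinkModel L P τ μ) (M : ℕ) (j : Fin L) (ε : ℝ)

open Classical in
theorem inner_basis_project (x : EuclideanSpace ℂ (Fin M)) (i : Fin M) :
    ⟪(S.cov_isHermitian M j).eigenvectorBasis i, S.project M j ε x⟫_ℂ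
      = if ε < (S.cov_isHermitian M j).eigenvalues i
        then ⟪(S.cov_isHermitian M j).eigenvectorBasis i, x⟫_ℂ else 0 := by
  rw [project_eq_sum, inner_sum]
  simp only [inner_smul_right, OrthonormalBasis.inner_eq_ite, mul_ite, mul_one, mul_zero]
  rw [Finset.sum_ite_eq]
  simp

theorem inner_project_left (x y : EuclideanSpace ℂ (Fin M)) :
    ⟪S.project M j ε x, y⟫_ℂ = ⟪x, S.project M j ε y⟫_ℂ := by
  classical
  rw [← (S.cov_isHermitian M j).eigenvectorBasis.sum_inner_mul_inner,
    ← (S.cov_isHermitian M j).eigenvectorBasis.sum_inner_mul_inner x]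
  refine Finset.sum_congr rfl fun i _ => ?_
  rw [← inner_conj_symm (S.project M j ε x), inner_basis_project, inner_basis_project]
  split_ifs <;> simp

theorem project_project (x : EuclideanSpace ℂ (Fin M)) :
    S.project M j ε (S.project M j ε x) = S.project M j ε x := by
  classical
  refine (S.cov_isHermitian M j).eigenvectorBasis.repr.injective (PiLp.ext fun i => ?_)
  simp only [OrthonormalBasis.repr_apply_apply, inner_basis_project]
  split_ifs <;> rfl

theorem norm_project_sq_eq (x : EuclideanSpace ℂ (Fin M)) :
    ((‖S.project M j ε x‖ ^ 2 : ℝ) : ℂ) = ⟪x, S.project M j ε x⟫_ℂ := by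
  rw [← project_project, ← inner_project_left, inner_self_eq_norm_sq_to_K]
  simp [project_project]

theorem norm_project_le (x : EuclideanSpace ℂ (Fin M)) : ‖S.project M j ε x‖ ≤ ‖x‖ := by
  have h := congrArg norm (S.norm_project_sq_eq M j ε x)
  rw [Complex.norm_real, Real.norm_of_nonneg (by positivity)] at h
  have h2 := norm_inner_le_norm (𝕜 := ℂ) x (S.project M j ε x)
  rw [← h] at h2
  by_contra hlt
  push Not at hlt
  have := norm_nonneg x
  nlinarith

variable [IsProbabilityMeasure μ]

theorem covForm_eq_sum (x : EuclideanSpace ℂ (Fin M)) :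
    S.covForm M j x = ∑ i, (S.cov_isHermitian M j).eigenvalues i *
      ‖⟪(S.cov_isHermitian M j).eigenvectorBasis i, x⟫_ℂ‖ ^ 2 := by
  have hH := S.cov_isHermitian M j
  apply Complex.ofReal_injective
  rw [← inner_cov_mulVec, ← hH.eigenvectorBasis.sum_inner_mul_inner, Complex.ofReal_sum]
  refine Finset.sum_congr rfl fun i _ => ?_
  have h1 : ⟪hH.eigenvectorBasis i, WithLp.toLp 2 (S.cov M j *ᵥ (x : Fin M → ℂ))⟫_ℂ
      = (hH.eigenvalues i : ℂ) * ⟪hH.eigenvectorBasis i, x⟫_ℂ := by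
    have hs := (Matrix.isSymmetric_toEuclideanLin_iff.2 hH) (hH.eigenvectorBasis i) x
    simp only [Matrix.toLpLin_apply, hH.mulVec_eigenvectorBasis] at hs
    rw [← hs, WithLp.toLp_smul, WithLp.toLp_ofLp, ← Complex.coe_smul, inner_smul_left]
    simp
  rw [h1, ← inner_conj_symm]
  push_cast
  rw [← Complex.mul_conj']
  ring

theorem eigenvalues_nonneg (i : Fin M) : 0 ≤ (S.cov_isHermitian M j).eigenvalues i := by
  have h := S.covForm_eq_sum M j ((S.cov_isHermitian M j).eigenvectorBasis i)
  simp only [OrthonormalBasis.inner_eq_ite] at h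
  rw [Finset.sum_eq_single i (fun b _ hb => by simp [hb]) (by simp)] at h
  simp only [if_true, norm_one, one_pow, mul_one] at h
  rw [← h]
  exact integral_nonneg fun ω => by positivity

/-- The residual has components only along eigenvectors with eigenvalue at most ε. -/
theorem covForm_sub_project_le (x : EuclideanSpace ℂ (Fin M)) :
    S.covForm M j (x - S.project M j ε x) ≤ ε * ‖x - S.project M j ε x‖ ^ 2 := by
  classical
  rw [covForm_eq_sum, ← (S.cov_isHermitian M j).eigenvectorBasis.sum_sq_norm_inner_right,
    Finset.mul_sum]
  refine Finset.sum_le_sum fun i _ => ?_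
  rw [inner_sub_right, inner_basis_project]
  split_ifs with h
  · simp
  · exact mul_le_mul_of_nonneg_right (not_lt.1 h) (by positivity)

/-- The retained components carry eigenvalues above ε, and the discarded ones contribute
nonnegatively because R_j is positive semidefinite. -/
theorem mul_norm_project_sq_le (x : EuclideanSpace ℂ (Fin M)) :
    ε * ‖S.project M j ε x‖ ^ 2 ≤ S.covForm M j x := by
  classical
  rw [covForm_eq_sum, ← (S.cov_isHermitian M j).eigenvectorBasis.sum_sq_norm_inner_right,
    Finset.mul_sum]
  refine Finset.sum_le_sum fun i _ => ?_
  rw [inner_basis_project]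
  split_ifs with h
  · gcongr
  · simpa using mul_nonneg (S.eigenvalues_nonneg M j i) (sq_nonneg _)

end projection

end UplinkModel

namespace UplinkModel

variable {L P τ : ℕ} {Ω : Type*} [MeasurableSpace Ω] {μ : Measure Ω}

/-! ### Geometry of the steering vectors -/

/-- The ratio of the geometric progression whose sum is the inner product of two steering
vectors. -/
def ratio (S : UplinkModel L P τ μ) (x y : ℝ) : ℂ :=
  Complex.exp (Complex.I *
    ((2 * Real.pi * (S.spacing / S.wavelength) * (Real.cos x - Real.cos y) : ℝ) : ℂ))

theorem norm_ratio (S : UplinkModel L P τ μ) (x y : ℝ) : ‖S.ratio x y‖ = 1 :=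
  norm_exp_phase _

theorem inner_steering (S : UplinkModel L P τ μ) (M : ℕ) (x y : ℝ) :
    ⟪S.steering M x, S.steering M y⟫_ℂ = ∑ m ∈ Finset.range M, S.ratio x y ^ m := by
  rw [inner_eq_sum, Finset.sum_range]
  refine Finset.sum_congr rfl fun m _ => ?_
  simp only [steering, ratio, ← Complex.exp_conj, ← Complex.exp_add, ← Complex.exp_nat_mul]
  congr 1
  simp only [map_mul, map_neg, Complex.conj_I, Complex.conj_ofReal, neg_neg]
  push_cast
  ring

theorem norm_inner_steering_le (S : UplinkModel L P τ μ) (M : ℕ) {x y : ℝ}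
    (h : S.ratio x y ≠ 1) :
    ‖⟪S.steering M x, S.steering M y⟫_ℂ‖ ≤ 2 / ‖S.ratio x y - 1‖ := by
  rw [inner_steering, geom_sum_eq h, norm_div]
  gcongr
  refine (norm_sub_le _ _).trans ?_
  rw [norm_pow, norm_ratio, one_pow, norm_one]
  norm_num

theorem spacing_ratio (S : UplinkModel L P τ μ) :
    0 < S.spacing / S.wavelength ∧ S.spacing / S.wavelength ≤ 1 / 2 := by
  have h1 := S.spacing_pos
  have h2 := S.wavelength_pos
  refine ⟨by positivity, ?_⟩
  rw [div_le_iff₀ h2]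
  linarith [S.spacing_le]

/-- Ratio 1 would make (D/λ)(cos x − cos y) an integer. An interior x gives |cos x − cos y| < 2, and
D/λ ≤ 1/2 makes that integer 0, whence x = y. Interiority matters: at half-wavelength spacing the
angles 0 and π have the same steering vector. -/
theorem ratio_ne_one (S : UplinkModel L P τ μ) {x y : ℝ} (hx : x ∈ Set.Ioo 0 Real.pi)
    (hy : y ∈ Set.Icc 0 Real.pi) (hxy : x ≠ y) : S.ratio x y ≠ 1 := by
  obtain ⟨hd0, hd1⟩ := S.spacing_ratio
  set d := S.spacing / S.wavelength with hd
  intro h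
  rw [ratio, ← hd, Complex.exp_eq_one_iff] at h
  obtain ⟨n, hn⟩ := h
  have h1 : (2 * Real.pi * d * (Real.cos x - Real.cos y) : ℝ) = n * (2 * Real.pi) := by
    have h2 : Complex.I * ((2 * Real.pi * d * (Real.cos x - Real.cos y) : ℝ) : ℂ)
        = Complex.I * ((n * (2 * Real.pi) : ℝ) : ℂ) := by
      rw [hn]; push_cast; ring
    exact_mod_cast mul_left_cancel₀ Complex.I_ne_zero h2
  have h3 : d * (Real.cos x - Real.cos y) = n := by
    have hpi := Real.pi_pos
    have h4 : (2 * Real.pi) * (d * (Real.cos x - Real.cos y) - n) = 0 := by linarith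
    rcases mul_eq_zero.1 h4 with h5 | h5 <;> linarith
  have hc1 : Real.cos x < 1 := by
    have := Real.cos_lt_cos_of_nonneg_of_le_pi le_rfl hx.2.le hx.1
    rwa [Real.cos_zero] at this
  have hc2 : -1 < Real.cos x := by
    have := Real.cos_lt_cos_of_nonneg_of_le_pi hx.1.le le_rfl hx.2
    rwa [Real.cos_pi] at this
  have hy1 := Real.cos_le_one y
  have hy2 := Real.neg_one_le_cos y
  have hn1 : (n : ℝ) < 1 := by rw [← h3]; nlinarith
  have hn2 : (-1 : ℝ) < n := by rw [← h3]; nlinarith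
  have hn0 : n = 0 := by
    have : n < 1 := by exact_mod_cast hn1
    have : -1 < n := by exact_mod_cast hn2
    omega
  rw [hn0, Int.cast_zero] at h3
  rcases mul_eq_zero.1 h3 with h5 | h5
  · linarith
  · exact hxy (Real.injOn_cos ⟨hx.1.le, hx.2.le⟩ hy (by linarith))

theorem tendsto_inner_steering (S : UplinkModel L P τ μ) {x y : ℝ} (h : S.ratio x y ≠ 1) :
    Tendsto (fun M : ℕ => ⟪S.steering M x, S.steering M y⟫_ℂ / (M : ℂ)) atTop (𝓝 0) := by
  rw [tendsto_zero_iff_norm_tendsto_zero]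
  refine squeeze_zero (fun _ => norm_nonneg _) (fun M => ?_)
    (tendsto_const_div_atTop_nhds_zero_nat (2 / ‖S.ratio x y - 1‖))
  rw [norm_div, Complex.norm_natCast]
  gcongr
  exact S.norm_inner_steering_le M h

/-- The bound by 2/|ratio − 1| does not involve M and is continuous in y on the compact closure of
Φ, where the ratio never equals 1. -/
theorem exists_norm_inner_steering_le (S : UplinkModel L P τ μ) {Φ : Set ℝ}
    (hΦ : Φ ⊆ Set.Icc 0 Real.pi) {x : ℝ} (hx : x ∈ Set.Ioo 0 Real.pi) (hxΦ : x ∉ closure Φ) :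
    ∃ K : ℝ, ∀ y ∈ Φ, ∀ M : ℕ, ‖⟪S.steering M x, S.steering M y⟫_ℂ‖ ≤ K := by
  have hcl : closure Φ ⊆ Set.Icc 0 Real.pi := closure_minimal hΦ isClosed_Icc
  have hcomp : IsCompact (closure Φ) := isCompact_Icc.of_isClosed_subset isClosed_closure hcl
  have hne : ∀ y ∈ closure Φ, S.ratio x y ≠ 1 := fun y hy =>
    S.ratio_ne_one hx (hcl hy) fun h => hxΦ (h ▸ hy)
  have hcont : ContinuousOn (fun y => 2 / ‖S.ratio x y - 1‖) (closure Φ) := by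
    refine ContinuousOn.div continuousOn_const ?_ fun y hy => norm_ne_zero_iff.2
      (sub_ne_zero.2 (hne y hy))
    unfold ratio
    fun_prop
  obtain ⟨K, hK⟩ := hcomp.bddAbove_image hcont
  refine ⟨K, fun y hy M => (S.norm_inner_steering_le M (hne y (subset_closure hy))).trans ?_⟩
  exact hK ⟨y, subset_closure hy, rfl⟩

/-- Each entry is Lipschitz in the angle with constant 2π(D/λ)m ≤ πM. This sets the angular
resolution of order 1/M used for the residual bound. -/
theorem norm_steering_sub_le (S : UplinkModel L P τ μ) (M : ℕ) (x y : ℝ) :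
    ‖S.steering M x - S.steering M y‖ ≤ √M * (Real.pi * M * |x - y|) := by
  obtain ⟨hd0, hd1⟩ := S.spacing_ratio
  have hcos : |Real.cos x - Real.cos y| ≤ |x - y| := Real.abs_cos_sub_cos_le x y
  have hcomp : ∀ m : Fin M, ‖(S.steering M x - S.steering M y) m‖ ≤ Real.pi * M * |x - y| := by
    intro m
    set α : ℝ → ℝ := fun t => 2 * Real.pi * ((m : ℕ) * S.spacing / S.wavelength) * Real.cos t with hα
    have hfac : (S.steering M x - S.steering M y) m
        = Complex.exp (-Complex.I * (α y : ℂ)) *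
          (Complex.exp (Complex.I * ((α y - α x : ℝ) : ℂ)) - 1) := by
      simp only [steering, PiLp.sub_apply, mul_sub, ← Complex.exp_add, mul_one, hα]
      congr 2
      push_cast
      ring
    have hone : ‖Complex.exp (-Complex.I * (α y : ℂ))‖ = 1 := by
      rw [Complex.norm_exp]; simp
    rw [hfac, norm_mul, hone, one_mul]
    refine (Real.norm_exp_I_mul_ofReal_sub_one_le).trans ?_
    have h1 : α y - α x = 2 * Real.pi * (S.spacing / S.wavelength) * (m : ℕ) *
        (Real.cos y - Real.cos x) := by
      simp only [hα]; ring
    rw [Real.norm_eq_abs, h1, abs_mul, abs_sub_comm (Real.cos y), abs_of_nonneg (by positivity)]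
    have hm : ((m : ℕ) : ℝ) ≤ M := by exact_mod_cast m.2.le
    have h2 : 2 * Real.pi * (S.spacing / S.wavelength) ≤ Real.pi := by
      nlinarith [Real.pi_pos]
    gcongr
  rw [EuclideanSpace.norm_eq]
  refine Real.sqrt_le_iff.2 ⟨by positivity, ?_⟩
  calc ∑ m, ‖(S.steering M x - S.steering M y) m‖ ^ 2
      ≤ ∑ m : Fin M, (Real.pi * M * |x - y|) ^ 2 := by
        gcongr with m; exact hcomp m
    _ = _ := by
        rw [mul_pow (√(M : ℝ)), Real.sq_sqrt (Nat.cast_nonneg M)]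
        simp

/-! ### The covariance as an integral over the angles -/

/-- The law of the angles of arrival of the channel from cell `l`. -/
def angleLaw (S : UplinkModel L P τ μ) (l : Fin L) : Measure ℝ :=
  volume.withDensity fun x => ENNReal.ofReal (S.pdf l x)

theorem sourceSigma_le (S : UplinkModel L P τ μ) (i : Source L P τ) :
    sourceSigma S.θ S.φ S.X S.N S.Z i ≤ ‹MeasurableSpace Ω› := by
  cases i
  · exact (S.θ_measurable _ _).comap_le
  · exact (S.φ_measurable _ _).comap_le
  · exact (S.X_measurable _ _).comap_le
  · exact (S.N_measurable _ _).comap_le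
  · exact (S.Z_measurable _ _).comap_le

theorem indepFun_of_disjoint (S : UplinkModel L P τ μ) {A B : Set (Source L P τ)}
    (hAB : Disjoint A B) {β γ : Type*} [MeasurableSpace β] [MeasurableSpace γ] {f : Ω → β}
    {g : Ω → γ} (hf : Measurable[⨆ i ∈ A, sourceSigma S.θ S.φ S.X S.N S.Z i] f)
    (hg : Measurable[⨆ i ∈ B, sourceSigma S.θ S.φ S.X S.N S.Z i] g) : IndepFun f g μ :=
  indepFun_of_disjoint_index S.sourceSigma_le S.indep hAB hf hg

theorem measurable_angle_source (S : UplinkModel L P τ μ) {A : Set (Source L P τ)} {l : Fin L}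
    {p : Fin P} (h : Source.angle l p ∈ A) :
    Measurable[⨆ i ∈ A, sourceSigma S.θ S.φ S.X S.N S.Z i] (S.θ l p) :=
  measurable_iff_comap_le.2 (le_iSup₂ (f := fun i _ => sourceSigma S.θ S.φ S.X S.N S.Z i) _ h)

theorem measurable_phase_source (S : UplinkModel L P τ μ) {A : Set (Source L P τ)} {l : Fin L}
    {p : Fin P} (h : Source.phase l p ∈ A) :
    Measurable[⨆ i ∈ A, sourceSigma S.θ S.φ S.X S.N S.Z i] (S.φ l p) :=
  measurable_iff_comap_le.2 (le_iSup₂ (f := fun i _ => sourceSigma S.θ S.φ S.X S.N S.Z i) _ h)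

theorem measurable_symbol_source (S : UplinkModel L P τ μ) {A : Set (Source L P τ)} {l : Fin L}
    {c : ℕ} (h : Source.symbol l c ∈ A) :
    Measurable[⨆ i ∈ A, sourceSigma S.θ S.φ S.X S.N S.Z i] (S.X l c) :=
  measurable_iff_comap_le.2 (le_iSup₂ (f := fun i _ => sourceSigma S.θ S.φ S.X S.N S.Z i) _ h)

theorem measurable_pilotNoise_source (S : UplinkModel L P τ μ) {A : Set (Source L P τ)} {m : ℕ}
    {t : Fin τ} (h : Source.pilotNoise m t ∈ A) :
    Measurable[⨆ i ∈ A, sourceSigma S.θ S.φ S.X S.N S.Z i] (S.N m t) :=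
  measurable_iff_comap_le.2 (le_iSup₂ (f := fun i _ => sourceSigma S.θ S.φ S.X S.N S.Z i) _ h)

/-- The contribution of the path `p` to the projection of the channel on `x`. -/
def pathTerm (S : UplinkModel L P τ μ) (M : ℕ) (l : Fin L) (x : EuclideanSpace ℂ (Fin M))
    (p : Fin P) (ω : Ω) : ℂ :=
  Complex.exp (Complex.I * (S.φ l p ω : ℂ)) * ⟪x, S.steering M (S.θ l p ω)⟫_ℂ

theorem measurable_inner_steering (S : UplinkModel L P τ μ) (M : ℕ)
    (x : EuclideanSpace ℂ (Fin M)) : Measurable fun t => ⟪x, S.steering M t⟫_ℂ := by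
  simp only [inner_eq_sum]
  exact Finset.measurable_sum _ fun m _ => (S.measurable_steering_apply M m).const_mul _

theorem norm_pathTerm (S : UplinkModel L P τ μ) (M : ℕ) (l : Fin L) (x : EuclideanSpace ℂ (Fin M))
    (p : Fin P) (ω : Ω) : ‖S.pathTerm M l x p ω‖ = ‖⟪x, S.steering M (S.θ l p ω)⟫_ℂ‖ := by
  rw [pathTerm, norm_mul, norm_exp_phase, one_mul]

theorem measurable_exp_phase : Measurable fun t : ℝ => Complex.exp (Complex.I * (t : ℂ)) := by
  fun_prop

theorem measurable_pathTerm (S : UplinkModel L P τ μ) (M : ℕ) (l : Fin L)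
    (x : EuclideanSpace ℂ (Fin M)) (p : Fin P) : Measurable (S.pathTerm M l x p) :=
  (measurable_exp_phase.comp (S.φ_measurable l p)).mul
    ((S.measurable_inner_steering M x).comp (S.θ_measurable l p))

theorem memLp_pathTerm [IsProbabilityMeasure μ] (S : UplinkModel L P τ μ) (M : ℕ) (l : Fin L)
    (x : EuclideanSpace ℂ (Fin M)) (p : Fin P) : MemLp (S.pathTerm M l x p) 2 μ := by
  refine MemLp.of_bound (S.measurable_pathTerm M l x p).aestronglyMeasurable (‖x‖ * √M)
    (ae_of_all _ fun ω => ?_)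
  rw [norm_pathTerm]
  refine (norm_inner_le_norm _ _).trans (le_of_eq ?_)
  rw [← S.norm_steering_sq M (S.θ l p ω), Real.sqrt_sq (norm_nonneg _)]

theorem inner_channel (S : UplinkModel L P τ μ) (M : ℕ) (l : Fin L)
    (x : EuclideanSpace ℂ (Fin M)) (ω : Ω) :
    ⟪x, S.channel M l ω⟫_ℂ = ((S.β l / √(P : ℝ) : ℝ) : ℂ) * ∑ p, S.pathTerm M l x p ω := by
  simp only [channel, inner_smul_right, inner_sum, pathTerm]

theorem covForm_eq (S : UplinkModel L P τ μ) (M : ℕ) (l : Fin L) (x : EuclideanSpace ℂ (Fin M)) :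
    S.covForm M l x = S.β l ^ 2 / P * ∫ ω, ‖∑ p, S.pathTerm M l x p ω‖ ^ 2 ∂μ := by
  rw [covForm, ← integral_const_mul]
  congr 1
  ext ω
  rw [inner_channel, norm_mul, Complex.norm_real, mul_pow, Real.norm_eq_abs, sq_abs, div_pow,
    Real.sq_sqrt (Nat.cast_nonneg P)]

theorem integral_norm_sq_pathTerm (S : UplinkModel L P τ μ) (M : ℕ) (l : Fin L)
    (x : EuclideanSpace ℂ (Fin M)) (p : Fin P) :
    ∫ ω, ‖S.pathTerm M l x p ω‖ ^ 2 ∂μ = ∫ t, ‖⟪x, S.steering M t⟫_ℂ‖ ^ 2 ∂(S.angleLaw l) := by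
  have h := S.measurable_inner_steering M x
  rw [angleLaw, ← S.θ_law l p, integral_map (S.θ_measurable l p).aemeasurable
    (h.norm.pow_const 2).aestronglyMeasurable]
  simp only [norm_pathTerm]

/-- Cauchy–Schwarz over the P paths; since P is fixed, the loss of a factor P is harmless. -/
theorem covForm_le [IsProbabilityMeasure μ] (S : UplinkModel L P τ μ) (M : ℕ) (l : Fin L)
    (x : EuclideanSpace ℂ (Fin M)) :
    S.covForm M l x ≤ S.β l ^ 2 * P * ∫ t, ‖⟪x, S.steering M t⟫_ℂ‖ ^ 2 ∂(S.angleLaw l) := by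
  have hP : (0 : ℝ) < P := by exact_mod_cast S.paths_pos
  have hI : ∀ p, Integrable (fun ω => ‖S.pathTerm M l x p ω‖ ^ 2) μ := fun p =>
    (S.memLp_pathTerm M l x p).integrable_norm_pow two_ne_zero
  have h1 : ∫ ω, ‖∑ p, S.pathTerm M l x p ω‖ ^ 2 ∂μ
      ≤ ∫ ω, P * ∑ p, ‖S.pathTerm M l x p ω‖ ^ 2 ∂μ := by
    refine integral_mono ((memLp_finsetSum _ fun p _ =>
      S.memLp_pathTerm M l x p).integrable_norm_pow two_ne_zero)
      ((integrable_finsetSum _ fun p _ => hI p).const_mul _) fun ω => ?_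
    have h2 := sq_sum_le_card_mul_sum_sq (s := Finset.univ) (f := fun p => ‖S.pathTerm M l x p ω‖)
    rw [Finset.card_fin] at h2
    exact (pow_le_pow_left₀ (norm_nonneg _) (norm_sum_le _ _) 2).trans h2
  rw [integral_const_mul, integral_finsetSum _ fun p _ => hI p] at h1
  simp only [integral_norm_sq_pathTerm, Finset.sum_const, Finset.card_fin, nsmul_eq_mul] at h1
  rw [covForm_eq]
  calc _ ≤ S.β l ^ 2 / P * (P * (P * ∫ t, ‖⟪x, S.steering M t⟫_ℂ‖ ^ 2 ∂(S.angleLaw l))) := by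
        gcongr
    _ = _ := by field_simp

/-- Distinct paths are independent with the same mean, so the cross moment is the squared modulus of
that mean. What matters is that it is nonnegative, which makes a centring assumption on the phases
unnecessary. -/
theorem integral_pathTerm_mul_conj (S : UplinkModel L P τ μ) (M : ℕ) (l : Fin L)
    (x : EuclideanSpace ℂ (Fin M)) {p p' : Fin P} (hp : p ≠ p') :
    ∫ ω, S.pathTerm M l x p ω * conj (S.pathTerm M l x p' ω) ∂μ
      = ((‖∫ t, Complex.exp (Complex.I * (t : ℂ)) ∂S.phaseLaw‖ ^ 2 *
        ‖∫ t, ⟪x, S.steering M t⟫_ℂ ∂(S.angleLaw l)‖ ^ 2 : ℝ) : ℂ) := by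
  have hin := S.measurable_inner_steering M x
  have hmean : ∀ p, ∫ ω, S.pathTerm M l x p ω ∂μ
      = (∫ t, Complex.exp (Complex.I * (t : ℂ)) ∂S.phaseLaw) *
        ∫ t, ⟪x, S.steering M t⟫_ℂ ∂(S.angleLaw l) := by
    intro p
    have hi : IndepFun (S.φ l p) (S.θ l p) μ :=
      S.indepFun_of_disjoint (A := {Source.phase l p}) (B := {Source.angle l p}) (by simp)
        (S.measurable_phase_source rfl) (S.measurable_angle_source rfl)
    have hi' := hi.comp measurable_exp_phase hin
    have h2 := hi'.integral_fun_mul_eq_mul_integral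
      (measurable_exp_phase.comp (S.φ_measurable l p)).aestronglyMeasurable
      (hin.comp (S.θ_measurable l p)).aestronglyMeasurable
    simp only [pathTerm]
    simp only [Function.comp_apply] at h2
    rw [h2, ← S.φ_law l p, angleLaw, ← S.θ_law l p,
      integral_map (S.φ_measurable l p).aemeasurable measurable_exp_phase.aestronglyMeasurable,
      integral_map (S.θ_measurable l p).aemeasurable hin.aestronglyMeasurable]
  have hmeas : ∀ p, Measurable[⨆ i ∈ ({Source.phase l p, Source.angle l p} : Set (Source L P τ)),
      sourceSigma S.θ S.φ S.X S.N S.Z i] (S.pathTerm M l x p) := fun p =>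
    (measurable_exp_phase.comp (S.measurable_phase_source (by simp))).mul
      (hin.comp (S.measurable_angle_source (by simp)))
  have hi : IndepFun (S.pathTerm M l x p) (S.pathTerm M l x p') μ :=
    S.indepFun_of_disjoint (by simp [hp.symm]) (hmeas p) (hmeas p')
  have hi' := hi.comp measurable_id Complex.continuous_conj.measurable
  have h2 := hi'.integral_fun_mul_eq_mul_integral
    (S.measurable_pathTerm M l x p).aestronglyMeasurable
    (Complex.continuous_conj.measurable.comp (S.measurable_pathTerm M l x p')).aestronglyMeasurable
  simp only [Function.comp_apply, id] at h2
  rw [h2, integral_conj, hmean, hmean, Complex.mul_conj, Complex.normSq_eq_norm_sq, norm_mul,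
    mul_pow]

/-- Expanding the square, the cross terms between different paths are nonnegative and can be
dropped. The P diagonal terms are equal and cancel the factor 1/P. -/
theorem le_covForm [IsProbabilityMeasure μ] (S : UplinkModel L P τ μ) (M : ℕ) (l : Fin L)
    (x : EuclideanSpace ℂ (Fin M)) :
    S.β l ^ 2 * ∫ t, ‖⟪x, S.steering M t⟫_ℂ‖ ^ 2 ∂(S.angleLaw l) ≤ S.covForm M l x := by
  have hP : (0 : ℝ) < P := by exact_mod_cast S.paths_pos
  have hint : ∀ p p', Integrable (fun ω => S.pathTerm M l x p ω *
      conj (S.pathTerm M l x p' ω)) μ := fun p p' =>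
    (S.memLp_pathTerm M l x p).integrable_mul (S.memLp_pathTerm M l x p').star
  have hre : ∀ p p', Integrable (fun ω => (S.pathTerm M l x p ω *
      conj (S.pathTerm M l x p' ω)).re) μ := fun p p' => (hint p p').re
  have hsq : ∀ z : ℂ, ‖z‖ ^ 2 = (z * conj z).re := fun z => by
    rw [Complex.mul_conj, Complex.ofReal_re, Complex.normSq_eq_norm_sq]
  have h1 : ∑ p : Fin P, ∫ ω, ‖S.pathTerm M l x p ω‖ ^ 2 ∂μ
      ≤ ∫ ω, ‖∑ p, S.pathTerm M l x p ω‖ ^ 2 ∂μ := by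
    have h2 : ∀ ω, ‖∑ p, S.pathTerm M l x p ω‖ ^ 2
        = ∑ p, ∑ p', (S.pathTerm M l x p ω * conj (S.pathTerm M l x p' ω)).re := by
      intro ω
      rw [hsq, map_sum, Finset.sum_mul_sum]
      simp only [Complex.re_sum]
    simp_rw [h2]
    rw [integral_finsetSum _ fun p _ => integrable_finsetSum _ fun p' _ => hre p p']
    refine Finset.sum_le_sum fun p _ => ?_
    rw [integral_finsetSum _ fun p' _ => hre p p']
    simp_rw [hsq]
    refine Finset.single_le_sum (f := fun p' => ∫ ω, (S.pathTerm M l x p ω *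
      conj (S.pathTerm M l x p' ω)).re ∂μ) (fun p' _ => ?_) (Finset.mem_univ p)
    rcases eq_or_ne p p' with rfl | hp
    · refine integral_nonneg fun ω => ?_
      simp only [← hsq]
      positivity
    · have h3 := integral_re (hint p p')
      simp only [RCLike.re_eq_complex_re] at h3
      rw [h3, S.integral_pathTerm_mul_conj M l x hp, Complex.ofReal_re]
      positivity
  simp only [integral_norm_sq_pathTerm, Finset.sum_const, Finset.card_fin, nsmul_eq_mul] at h1
  rw [covForm_eq]
  calc _ = S.β l ^ 2 / P * (P * ∫ t, ‖⟪x, S.steering M t⟫_ℂ‖ ^ 2 ∂(S.angleLaw l)) := by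
        field_simp
    _ ≤ _ := by gcongr

end UplinkModel

namespace UplinkModel

variable {L P τ : ℕ} {Ω : Type*} [MeasurableSpace Ω] {μ : Measure Ω}

/-! ### The signal projection of a steering vector -/

theorem isProbabilityMeasure_angleLaw [IsProbabilityMeasure μ] (S : UplinkModel L P τ μ)
    (l : Fin L) : IsProbabilityMeasure (S.angleLaw l) := by
  rw [angleLaw, ← S.θ_law l ⟨0, S.paths_pos⟩]
  exact Measure.isProbabilityMeasure_map (S.θ_measurable _ _).aemeasurable

/-- Lebesgue differentiation: almost everywhere the mass of a small ball over its length 2r tends to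
the density, hence eventually exceeds half of it. So κ can be taken to be the density at x. -/
theorem ae_exists_le_angleLaw_closedBall [IsProbabilityMeasure μ] (S : UplinkModel L P τ μ)
    (l : Fin L) : ∀ᵐ x ∂(volume : Measure ℝ), 0 < S.pdf l x → ∃ κ : ℝ, 0 < κ ∧ ∃ r₀ : ℝ, 0 < r₀ ∧
      ∀ r, 0 < r → r < r₀ → κ * r ≤ (S.angleLaw l).real (Metric.closedBall x r) := by
  have := S.isProbabilityMeasure_angleLaw l
  filter_upwards [Besicovitch.ae_tendsto_rnDeriv (S.angleLaw l) volume,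
    Measure.rnDeriv_withDensity volume (S.pdf_measurable l).ennreal_ofReal] with x h1 h2 hx
  rw [angleLaw, h2, ← angleLaw] at h1
  have h3 := h1.eventually (lt_mem_nhds (a := ENNReal.ofReal (S.pdf l x / 2))
    ((ENNReal.ofReal_lt_ofReal_iff hx).2 (by linarith)))
  obtain ⟨r₀, hr₀, hr⟩ := mem_nhdsGT_iff_exists_Ioo_subset.1 h3
  refine ⟨S.pdf l x, hx, r₀, hr₀, fun r h4 h5 => ?_⟩
  have h6 : ENNReal.ofReal (S.pdf l x / 2) < S.angleLaw l (Metric.closedBall x r) /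
    volume (Metric.closedBall x r) := hr ⟨h4, h5⟩
  rw [Real.volume_closedBall] at h6
  have h7 : ENNReal.ofReal (2 * r) ≠ 0 := by simp [h4]
  rw [ENNReal.lt_div_iff_mul_lt (Or.inl h7) (Or.inl ENNReal.ofReal_ne_top),
    ← ENNReal.ofReal_mul (by linarith)] at h6
  rw [Measure.real, ← ENNReal.ofReal_le_iff_le_toReal (measure_ne_top _ _)]
  refine le_trans (le_of_eq ?_) h6.le
  congr 1; ring

/-- Let y be the residual and d its norm. Its quadratic form is at most ε d² by the spectral cut. It
is also at least β² times the integral of |⟨y, a(t)⟩|², where |⟨y, a(t)⟩| ≥ d²/2 on a ball around x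
of radius proportional to d/M^(3/2) and of mass at least κ times that radius. Comparing the two
bounds leaves a cube of d/√M. -/
theorem residual_pow_three_le [IsProbabilityMeasure μ] (S : UplinkModel L P τ μ) (j : Fin L)
    {x κ r₀ ε : ℝ} (hκ : 0 < κ)
    (hν : ∀ r, 0 < r → r < r₀ → κ * r ≤ (S.angleLaw j).real (Metric.closedBall x r)) (hε : 0 ≤ ε)
    {M : ℕ} (hM : 0 < M) (hMr : 1 / (2 * Real.pi * M) < r₀) :
    (‖S.steering M x - S.project M j ε (S.steering M x)‖ / √M) ^ 3
      ≤ 8 * Real.pi / (S.β j ^ 2 * κ) * ε := by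
  have := S.isProbabilityMeasure_angleLaw j
  have hpi := Real.pi_pos
  have hβ := S.β_pos j
  have hM' : (0 : ℝ) < M := by exact_mod_cast hM
  set a := S.steering M x with ha
  set y := a - S.project M j ε a with hy
  have hs : 0 < √(M : ℝ) := Real.sqrt_pos.2 hM'
  have hsM : √(M : ℝ) ^ 2 = M := Real.sq_sqrt hM'.le
  have hya : ⟪y, a⟫_ℂ = ((‖y‖ ^ 2 : ℝ) : ℂ) := by
    have h1 : ⟪y, S.project M j ε a⟫_ℂ = 0 := by
      rw [hy, ← inner_project_left, map_sub, project_project, sub_self, inner_zero_left]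
    have h2 : ⟪y, y⟫_ℂ = ⟪y, a⟫_ℂ := by
      conv_lhs => rw [hy, inner_sub_right, ← hy, h1, sub_zero]
    rw [← h2, inner_self_eq_norm_sq_to_K]
    simp
  have hyle : ‖y‖ ≤ √M := by
    have h1 := norm_inner_le_norm (𝕜 := ℂ) y a
    rw [hya, Complex.norm_real, Real.norm_of_nonneg (by positivity)] at h1
    have h2 : ‖a‖ = √M := by rw [← S.norm_steering_sq M x, Real.sqrt_sq (norm_nonneg _)]
    rw [h2] at h1
    by_contra hlt
    push Not at hlt
    nlinarith
  rcases eq_or_lt_of_le (norm_nonneg y) with h0 | h0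
  · rw [← h0]
    simp
    positivity
  set d := ‖y‖ with hd
  -- This radius makes the Lipschitz bound √M · πM · r equal to d/2, so moving the angle by r
  -- changes ⟨y, a⟩ = d² by at most half. Since d ≤ √M, the radius stays below 1/(2πM) and hence
  -- below r₀.
  set r := d / √M / (2 * Real.pi * M) with hr
  have hr0 : 0 < r := by positivity
  have hr1 : r < r₀ := by
    refine lt_of_le_of_lt ?_ hMr
    rw [hr]
    gcongr
    rw [div_le_one hs]
    exact hyle
  have hlow : ∀ t ∈ Metric.closedBall x r, (d ^ 2 / 2) ^ 2 ≤ ‖⟪y, S.steering M t⟫_ℂ‖ ^ 2 := by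
    intro t ht
    refine pow_le_pow_left₀ (by positivity) ?_ 2
    have h1 : ⟪y, S.steering M t⟫_ℂ = ((d ^ 2 : ℝ) : ℂ) + ⟪y, S.steering M t - a⟫_ℂ := by
      rw [inner_sub_right, hya]; ring
    have h2 : ‖⟪y, S.steering M t - a⟫_ℂ‖ ≤ d ^ 2 / 2 := by
      refine (norm_inner_le_norm _ _).trans ?_
      have h3 := S.norm_steering_sub_le M t x
      rw [Metric.mem_closedBall, Real.dist_eq] at ht
      calc ‖y‖ * ‖S.steering M t - a‖ ≤ d * (√M * (Real.pi * M * r)) := by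
            gcongr
            exact h3.trans (by gcongr)
        _ = d ^ 2 / 2 := by rw [hr]; field_simp
    have h4 := norm_sub_norm_le ((d ^ 2 : ℝ) : ℂ) (-⟪y, S.steering M t - a⟫_ℂ)
    rw [norm_neg, sub_neg_eq_add, ← h1, Complex.norm_real,
      Real.norm_of_nonneg (by positivity)] at h4
    linarith
  have hint : (d ^ 2 / 2) ^ 2 * (κ * r) ≤ ∫ t, ‖⟪y, S.steering M t⟫_ℂ‖ ^ 2 ∂(S.angleLaw j) := by
    have hI : Integrable (fun t => ‖⟪y, S.steering M t⟫_ℂ‖ ^ 2) (S.angleLaw j) := by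
      refine Integrable.of_bound (C := (‖y‖ * √M) ^ 2)
        ((S.measurable_inner_steering M y).norm.pow_const 2).aestronglyMeasurable
        (ae_of_all _ fun t => ?_)
      rw [Real.norm_of_nonneg (by positivity)]
      gcongr
      refine (norm_inner_le_norm _ _).trans (le_of_eq ?_)
      rw [← S.norm_steering_sq M t, Real.sqrt_sq (norm_nonneg _)]
    calc (d ^ 2 / 2) ^ 2 * (κ * r)
        ≤ (d ^ 2 / 2) ^ 2 * (S.angleLaw j).real (Metric.closedBall x r) := by
          gcongr; exact hν r hr0 hr1
      _ = ∫ t in Metric.closedBall x r, (d ^ 2 / 2) ^ 2 ∂(S.angleLaw j) := by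
          rw [setIntegral_const, smul_eq_mul, mul_comm]
      _ ≤ ∫ t in Metric.closedBall x r, ‖⟪y, S.steering M t⟫_ℂ‖ ^ 2 ∂(S.angleLaw j) :=
          setIntegral_mono_on (integrable_const _).integrableOn hI.integrableOn
            Metric.isClosed_closedBall.measurableSet hlow
      _ ≤ _ := setIntegral_le_integral hI (ae_of_all _ fun t => by positivity)
  have hup := S.covForm_sub_project_le M j ε a
  rw [← hy] at hup
  have hmain : S.β j ^ 2 * ((d ^ 2 / 2) ^ 2 * (κ * r)) ≤ ε * d ^ 2 :=
    (mul_le_mul_of_nonneg_left hint (by positivity)).trans ((S.le_covForm M j y).trans hup)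
  have h5 : S.β j ^ 2 * ((d ^ 2 / 2) ^ 2 * (κ * r))
      = d ^ 2 * (S.β j ^ 2 * κ / (8 * Real.pi) * (d / √M) ^ 3) := by
    rw [hr]
    have : (M : ℝ) = √(M : ℝ) ^ 2 := hsM.symm
    field_simp
    rw [hsM]
    ring
  rw [h5, mul_comm ε, mul_le_mul_iff_right₀ (by positivity)] at hmain
  calc (d / √M) ^ 3 = 8 * Real.pi / (S.β j ^ 2 * κ) *
        (S.β j ^ 2 * κ / (8 * Real.pi) * (d / √M) ^ 3) := by field_simp
    _ ≤ _ := by gcongr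

theorem tendsto_zero_of_pow_le {u w : ℕ → ℝ} (n : ℕ) (hu : ∀ M, 0 ≤ u M)
    (h : ∀ᶠ M in atTop, u M ^ n ≤ w M) (hw : Tendsto w atTop (𝓝 0)) :
    Tendsto u atTop (𝓝 0) := by
  rw [Metric.tendsto_nhds]
  intro e he
  filter_upwards [h, hw.eventually (gt_mem_nhds (pow_pos he n))] with M h1 h2
  rw [Real.dist_eq, sub_zero, abs_of_nonneg (hu M)]
  exact lt_of_pow_lt_pow_left₀ n he.le (h1.trans_lt h2)

variable {ε : ℕ → ℝ}

theorem eventually_pos_of_tendsto_mul (hεM : Tendsto (fun M : ℕ => (M : ℝ) * ε M) atTop atTop) :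
    ∀ᶠ M in atTop, 0 < ε M := by
  filter_upwards [hεM.eventually_gt_atTop 0] with M hM
  exact pos_of_mul_pos_right hM (Nat.cast_nonneg M)

theorem ae_tendsto_residual [IsProbabilityMeasure μ] (S : UplinkModel L P τ μ) (j : Fin L)
    (hε : Tendsto ε atTop (𝓝 0))
    (hεM : Tendsto (fun M : ℕ => (M : ℝ) * ε M) atTop atTop) :
    ∀ᵐ x ∂(volume : Measure ℝ), x ∈ S.angularSupport j →
      Tendsto (fun M => ‖S.steering M x - S.project M j (ε M) (S.steering M x)‖ / √M) atTop
        (𝓝 0) := by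
  filter_upwards [S.ae_exists_le_angleLaw_closedBall j] with x hx hxj
  obtain ⟨κ, hκ, r₀, hr₀, h⟩ := hx hxj
  have hw : Tendsto (fun M => 8 * Real.pi / (S.β j ^ 2 * κ) * ε M) atTop (𝓝 0) := by
    simpa using hε.const_mul (8 * Real.pi / (S.β j ^ 2 * κ))
  refine tendsto_zero_of_pow_le 3 (fun M => by positivity) ?_ hw
  have hMr : Tendsto (fun M : ℕ => 1 / (2 * Real.pi * M)) atTop (𝓝 0) := by
    have := tendsto_const_div_atTop_nhds_zero_nat (1 / (2 * Real.pi))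
    refine this.congr fun M => ?_
    rw [div_div]
  filter_upwards [eventually_pos_of_tendsto_mul hεM, eventually_gt_atTop 0,
    hMr.eventually (gt_mem_nhds hr₀)] with M h1 h2 h3
  exact S.residual_pow_three_le j hκ h h1.le h2 h3

theorem angularSupport_subset (S : UplinkModel L P τ μ) (j : Fin L) :
    S.angularSupport j ⊆ Set.Icc 0 Real.pi := fun x hx => by
  by_contra h
  exact (ne_of_gt hx) (S.pdf_support j x h)

theorem ae_angleLaw_mem (S : UplinkModel L P τ μ) (j : Fin L) :
    ∀ᵐ t ∂(S.angleLaw j), t ∈ S.angularSupport j := by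
  rw [angleLaw, ae_withDensity_iff (S.pdf_measurable j).ennreal_ofReal]
  refine ae_of_all _ fun x hx => ?_
  simpa [angularSupport] using hx

/-- Away from the closed support the inner products with a(t) are bounded uniformly in M and t, so
the form of R_j at a(x) is O(1). The spectral cut turns this into a projected squared norm of
O(1/ε_M), which is o(M). -/
theorem tendsto_project_of_notMem_closure [IsProbabilityMeasure μ] (S : UplinkModel L P τ μ)
    (j : Fin L) (hεM : Tendsto (fun M : ℕ => (M : ℝ) * ε M) atTop atTop) {x : ℝ}
    (hx : x ∈ Set.Ioo 0 Real.pi) (hxΦ : x ∉ closure (S.angularSupport j)) :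
    Tendsto (fun M => ‖S.project M j (ε M) (S.steering M x)‖ / √M) atTop (𝓝 0) := by
  have := S.isProbabilityMeasure_angleLaw j
  obtain ⟨K, hK⟩ := S.exists_norm_inner_steering_le (S.angularSupport_subset j) hx hxΦ
  have hw : Tendsto (fun M : ℕ => S.β j ^ 2 * P * K ^ 2 / ((M : ℝ) * ε M)) atTop (𝓝 0) :=
    hεM.const_div_atTop _
  refine tendsto_zero_of_pow_le 2 (fun M => by positivity) ?_ hw
  filter_upwards [eventually_pos_of_tendsto_mul hεM, eventually_gt_atTop 0] with M h1 h2
  have h3 := (S.mul_norm_project_sq_le M j (ε M) (S.steering M x)).trans (S.covForm_le M j _)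
  have h4 : ∫ t, ‖⟪S.steering M x, S.steering M t⟫_ℂ‖ ^ 2 ∂(S.angleLaw j) ≤ K ^ 2 := by
    have h5 : ∫ t, ‖⟪S.steering M x, S.steering M t⟫_ℂ‖ ^ 2 ∂(S.angleLaw j)
        ≤ ∫ _t, K ^ 2 ∂(S.angleLaw j) := by
      refine integral_mono_of_nonneg (ae_of_all _ fun t => by positivity) (integrable_const _) ?_
      filter_upwards [S.ae_angleLaw_mem j] with t ht
      exact pow_le_pow_left₀ (norm_nonneg _) (hK t ht M) 2
    simpa using h5
  have hM : (0 : ℝ) < M := by exact_mod_cast h2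
  rw [div_pow, Real.sq_sqrt hM.le, div_le_div_iff₀ hM (by positivity)]
  have h6 : ε M * ‖S.project M j (ε M) (S.steering M x)‖ ^ 2 ≤ S.β j ^ 2 * P * K ^ 2 :=
    h3.trans (by gcongr)
  nlinarith

/-! ### Almost sure properties of the angles -/

theorem ae_angles_of_ae_volume (S : UplinkModel L P τ μ) {Q : ℝ → Prop}
    (hQ : ∀ᵐ x ∂(volume : Measure ℝ), Q x) : ∀ᵐ ω ∂μ, ∀ l p, Q (S.θ l p ω) := by
  rw [ae_all_iff]; intro l
  rw [ae_all_iff]; intro p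
  refine ae_of_ae_map (S.θ_measurable l p).aemeasurable ?_
  rw [S.θ_law]
  exact (withDensity_absolutelyContinuous _ _).ae_le hQ

theorem ae_angle_mem_support (S : UplinkModel L P τ μ) :
    ∀ᵐ ω ∂μ, ∀ l p, S.θ l p ω ∈ S.angularSupport l := by
  rw [ae_all_iff]; intro l
  rw [ae_all_iff]; intro p
  refine ae_of_ae_map (S.θ_measurable l p).aemeasurable ?_
  rw [S.θ_law]
  exact S.ae_angleLaw_mem l

theorem ae_angle_mem_Ioo (S : UplinkModel L P τ μ) :
    ∀ᵐ ω ∂μ, ∀ l p, S.θ l p ω ∈ Set.Ioo 0 Real.pi := by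
  have h : ∀ᵐ x ∂(volume : Measure ℝ), x ≠ 0 ∧ x ≠ Real.pi :=
    (Measure.ae_ne volume 0).and (Measure.ae_ne volume Real.pi)
  filter_upwards [S.ae_angles_of_ae_volume h, S.ae_angle_mem_support] with ω h1 h2 l p
  have h3 := S.angularSupport_subset l (h2 l p)
  exact ⟨lt_of_le_of_ne h3.1 (h1 l p).1.symm, lt_of_le_of_ne h3.2 (h1 l p).2⟩

theorem ae_angle_ne [IsProbabilityMeasure μ] (S : UplinkModel L P τ μ) :
    ∀ᵐ ω ∂μ, ∀ l p l' p', (l, p) ≠ (l', p') → S.θ l p ω ≠ S.θ l' p' ω := by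
  simp only [ae_all_iff]
  intro l p l' p' hne
  have hi : IndepFun (S.θ l p) (S.θ l' p') μ :=
    S.indepFun_of_disjoint (A := {Source.angle l p}) (B := {Source.angle l' p'})
      (by simpa [Prod.ext_iff, eq_comm] using hne)
      (S.measurable_angle_source rfl) (S.measurable_angle_source rfl)
  have hprod := (indepFun_iff_map_prod_eq_prod_map_map (S.θ_measurable l p).aemeasurable
    (S.θ_measurable l' p').aemeasurable).1 hi
  have hd : ∀ᵐ q ∂(μ.map fun ω => (S.θ l p ω, S.θ l' p' ω)), q.1 ≠ q.2 := by
    rw [hprod, S.θ_law, S.θ_law]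
    have h1 := S.isProbabilityMeasure_angleLaw l'
    rw [angleLaw] at h1
    rw [ae_iff]
    simp only [not_not, ne_eq]
    have hm : MeasurableSet {q : ℝ × ℝ | q.1 = q.2} := measurableSet_diagonal
    rw [Measure.measure_prod_null hm]
    refine ae_of_all _ fun x => ?_
    have h2 : Prod.mk x ⁻¹' {q : ℝ × ℝ | q.1 = q.2} = {x} := by ext; simp [eq_comm]
    beta_reduce
    rw [h2]
    exact withDensity_absolutelyContinuous _ _ (measure_singleton x)
  exact ae_of_ae_map ((S.θ_measurable l p).prodMk (S.θ_measurable l' p')).aemeasurable hd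

end UplinkModel

/-! ### Perturbation of the dominant eigenvector -/

section perturbation

/-- A Bessel inequality for nearly orthogonal families. The Schur test bounds the Gram matrix by its
row sums, so z = ∑ ⟨v_l, w⟩ v_l satisfies ‖z‖² ≤ ρ T; with T = ⟨z, w⟩ ≤ ‖z‖ ‖w‖ the claim follows.
-/
theorem sum_norm_inner_sq_le {E κ : Type*} [NormedAddCommGroup E] [InnerProductSpace ℂ E]
    (s : Finset κ) (v : κ → E) (w : E) {ρ : ℝ} (hρ0 : 0 ≤ ρ)
    (hρ : ∀ l ∈ s, ∑ l' ∈ s, ‖⟪v l, v l'⟫_ℂ‖ ≤ ρ) :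
    ∑ l ∈ s, ‖⟪v l, w⟫_ℂ‖ ^ 2 ≤ ρ * ‖w‖ ^ 2 := by
  set T := ∑ l ∈ s, ‖⟪v l, w⟫_ℂ‖ ^ 2 with hT
  have hT0 : 0 ≤ T := Finset.sum_nonneg fun _ _ => by positivity
  set z : E := ∑ l ∈ s, ⟪v l, w⟫_ℂ • v l with hz
  have h1 : ⟪z, w⟫_ℂ = (T : ℂ) := by
    rw [hz, sum_inner, hT, Complex.ofReal_sum]
    refine Finset.sum_congr rfl fun l _ => ?_
    rw [inner_smul_left, Complex.conj_mul']
    push_cast; rfl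
  have h2 : ‖z‖ ^ 2 ≤ ρ * T := by
    have h3 : ‖z‖ ^ 2 ≤ ∑ l ∈ s, ∑ l' ∈ s, ‖⟪v l, w⟫_ℂ‖ * ‖⟪v l', w⟫_ℂ‖ * ‖⟪v l, v l'⟫_ℂ‖ := by
      have h4 : ‖z‖ ^ 2 = ‖⟪z, z⟫_ℂ‖ := by
        rw [inner_self_eq_norm_sq_to_K]; simp
      rw [h4]
      conv_lhs => rw [hz, sum_inner]
      refine (norm_sum_le _ _).trans (Finset.sum_le_sum fun l _ => ?_)
      rw [inner_sum]
      refine (norm_sum_le _ _).trans (Finset.sum_le_sum fun l' _ => le_of_eq ?_)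
      rw [inner_smul_left, inner_smul_right, norm_mul, norm_mul, RCLike.norm_conj]
      ring
    have h5 : ∑ l ∈ s, ∑ l' ∈ s, ‖⟪v l, w⟫_ℂ‖ * ‖⟪v l', w⟫_ℂ‖ * ‖⟪v l, v l'⟫_ℂ‖
        ≤ ∑ l ∈ s, ∑ l' ∈ s, (‖⟪v l, w⟫_ℂ‖ ^ 2 * ‖⟪v l, v l'⟫_ℂ‖ / 2 +
          ‖⟪v l', w⟫_ℂ‖ ^ 2 * ‖⟪v l', v l⟫_ℂ‖ / 2) := by
      refine Finset.sum_le_sum fun l _ => Finset.sum_le_sum fun l' _ => ?_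
      rw [norm_inner_symm (v l') (v l)]
      nlinarith [mul_nonneg (sq_nonneg (‖⟪v l, w⟫_ℂ‖ - ‖⟪v l', w⟫_ℂ‖)) (norm_nonneg ⟪v l, v l'⟫_ℂ)]
    refine h3.trans (h5.trans ?_)
    have h6 : ∑ l ∈ s, ∑ l' ∈ s, ‖⟪v l, w⟫_ℂ‖ ^ 2 * ‖⟪v l, v l'⟫_ℂ‖ / 2 ≤ ρ * T / 2 := by
      rw [hT, Finset.mul_sum, Finset.sum_div]
      refine Finset.sum_le_sum fun l hl => ?_
      rw [← Finset.sum_div, ← Finset.mul_sum, mul_comm ρ]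
      gcongr
      exact hρ l hl
    simp_rw [Finset.sum_add_distrib]
    rw [Finset.sum_comm (f := fun l l' => ‖⟪v l', w⟫_ℂ‖ ^ 2 * ‖⟪v l', v l⟫_ℂ‖ / 2)]
    linarith
  have h3 : T ≤ ‖z‖ * ‖w‖ := by
    have := norm_inner_le_norm (𝕜 := ℂ) z w
    rwa [h1, Complex.norm_real, Real.norm_of_nonneg hT0] at this
  rcases eq_or_lt_of_le hT0 with h0 | h0
  · rw [← h0]
    positivity
  · have h4 : T * T ≤ (ρ * ‖w‖ ^ 2) * T := by
      calc T * T ≤ (‖z‖ * ‖w‖) * (‖z‖ * ‖w‖) := by gcongr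
        _ = ‖z‖ ^ 2 * ‖w‖ ^ 2 := by ring
        _ ≤ (ρ * T) * ‖w‖ ^ 2 := by gcongr
        _ = _ := by ring
    exact le_of_mul_le_mul_right h4 h0

variable {ι κ : Type*} {F : Filter ι} {E : ι → Type*} [∀ i, NormedAddCommGroup (E i)]
  [∀ i, InnerProductSpace ℂ (E i)]

/-- A variational form of the Davis–Kahan argument, with errors measured as quadratic forms so that
the ambient space may change with i. Testing maximality against v_j shows that Q(u) is nearly ‖v_j‖²
or more. If w is the part of u orthogonal to v_j, the upper bound on Q(u) falls below ‖v_j‖² by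
about (‖v_j‖² − d')‖w‖², so the gap forces w → 0. -/
theorem tendsto_dominant_direction [Fintype κ] [DecidableEq κ] {j : κ} (v : κ → ∀ i, E i)
    (u : ∀ i, E i) (Q : ∀ i, E i → ℝ) {d : κ → ℝ}
    (hu : ∀ᶠ i in F, ‖u i‖ = 1)
    (hG : ∀ l l', Tendsto (fun i => ⟪v l i, v l' i⟫_ℂ) F (𝓝 (if l = l' then (d l : ℂ) else 0)))
    (hdj : 0 < d j) (hd : ∀ l, l ≠ j → d l < d j) (hd0 : ∀ l, 0 ≤ d l)
    (hQ : ∀ e : ℝ, 0 < e → ∀ᶠ i in F, ∀ x, |Q i x - ∑ l, ‖⟪v l i, x⟫_ℂ‖ ^ 2| ≤ e * ‖x‖ ^ 2)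
    (hmax : ∀ᶠ i in F, ∀ x, Q i x ≤ Q i (u i) * ‖x‖ ^ 2) :
    Tendsto (fun i => ‖v j i - ⟪u i, v j i⟫_ℂ • u i‖) F (𝓝 0) ∧
      ∀ l, l ≠ j → Tendsto (fun i => ⟪u i, v l i⟫_ℂ) F (𝓝 0) := by
  have hN : ∀ l, Tendsto (fun i => ‖v l i‖ ^ 2) F (𝓝 (d l)) := fun l => by
    have h1 := (hG l l).norm
    simp only [if_true, Complex.norm_real, Real.norm_of_nonneg (hd0 l)] at h1
    refine h1.congr fun i => ?_
    rw [inner_self_eq_norm_sq_to_K]; simp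
  have hN' : ∀ l, Tendsto (fun i => ‖v l i‖) F (𝓝 (√(d l))) := fun l =>
    ((Real.continuous_sqrt.tendsto _).comp (hN l)).congr fun i => Real.sqrt_sq (norm_nonneg _)
  -- The separating level d' exceeds every other limiting power strictly, so that the Gram row sums
  -- over the remaining vectors, which converge to those powers, eventually lie below d'.
  set s : Finset κ := Finset.univ.erase j with hs
  obtain ⟨d', hd'0, hd'j, hd'⟩ : ∃ d', 0 ≤ d' ∧ d' < d j ∧ ∀ l ∈ s, d l < d' := by
    have h1 : ∀ᶠ x in 𝓝[<] (d j), ∀ l ∈ s, d l < x := by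
      rw [Finset.eventually_all]
      intro l hl
      exact nhdsWithin_le_nhds (lt_mem_nhds (hd l (Finset.ne_of_mem_erase hl)))
    have h2 : ∀ᶠ x in 𝓝[<] (d j), 0 < x := nhdsWithin_le_nhds (lt_mem_nhds hdj)
    obtain ⟨x, hx⟩ := ((h1.and h2).and self_mem_nhdsWithin).exists
    exact ⟨x, hx.1.2.le, hx.2, hx.1.1⟩
  have hrow : ∀ᶠ i in F, ∀ l ∈ s, ∑ l' ∈ s, ‖⟪v l i, v l' i⟫_ℂ‖ ≤ d' := by
    rw [Finset.eventually_all]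
    intro l hl
    have h1 : Tendsto (fun i => ∑ l' ∈ s, ‖⟪v l i, v l' i⟫_ℂ‖) F
        (𝓝 (∑ l' ∈ s, ‖(if l = l' then (d l : ℂ) else 0)‖)) :=
      tendsto_finsetSum _ fun l' _ => (hG l l').norm
    have h2 : ∑ l' ∈ s, ‖(if l = l' then (d l : ℂ) else 0)‖ = d l := by
      rw [Finset.sum_eq_single l]
      · simp [abs_of_nonneg (hd0 l)]
      · intro b _ hb; simp [hb.symm]
      · exact fun h => absurd hl h
    rw [h2] at h1
    exact (h1.eventually (gt_mem_nhds (hd' l hl))).mono fun i hi => hi.le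
  set ν : κ → ι → ℝ := fun l i => ‖⟪v l i, v j i⟫_ℂ‖ / ‖v j i‖ with hν
  have hνlim : ∀ l ∈ s, Tendsto (ν l) F (𝓝 0) := by
    intro l hl
    have h1 : Tendsto (ν l) F (𝓝 (‖(if l = j then (d l : ℂ) else 0)‖ / √(d j))) :=
      (hG l j).norm.div (hN' j) (Real.sqrt_pos.2 hdj).ne'
    rwa [if_neg (Finset.ne_of_mem_erase hl), norm_zero, zero_div] at h1
  set w : ∀ i, E i := fun i => u i - (⟪v j i, u i⟫_ℂ / ((‖v j i‖ ^ 2 : ℝ) : ℂ)) • v j i with hw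
  -- Error made in replacing u by w in the inner products with the other vectors: it is the excess
  -- of (ν + |⟨v_l, w⟩|)² over |⟨v_l, w⟩|², bounded using ‖w‖ ≤ 1.
  set R : ι → ℝ := fun i => ∑ l ∈ s, ν l i * (ν l i + 2 * ‖v l i‖) with hR
  have hRlim : Tendsto R F (𝓝 0) := by
    have h1 : Tendsto R F (𝓝 (∑ l ∈ s, 0 * (0 + 2 * √(d l)))) :=
      tendsto_finsetSum _ fun l hl => (hνlim l hl).mul ((hνlim l hl).add ((hN' l).const_mul 2))
    simpa using h1
  have hpos : ∀ᶠ i in F, (d' + d j) / 2 < ‖v j i‖ ^ 2 :=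
    (hN j).eventually (lt_mem_nhds (by linarith))
  have hvw : ∀ᶠ i in F, ⟪v j i, w i⟫_ℂ = 0 := by
    filter_upwards [hpos] with i hi
    have h0 : ‖v j i‖ ^ 2 ≠ 0 := by linarith
    simp only [hw]
    rw [inner_sub_right, inner_smul_right, inner_self_eq_norm_sq_to_K]
    have h0' : ((‖v j i‖ ^ 2 : ℝ) : ℂ) ≠ 0 := by exact_mod_cast h0
    have h1 : (RCLike.ofReal ‖v j i‖ : ℂ) ^ 2 = ((‖v j i‖ ^ 2 : ℝ) : ℂ) := by push_cast; rfl
    rw [h1, div_mul_cancel₀ _ h0', sub_self]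
  have hdecomp : ∀ i, u i = (⟪v j i, u i⟫_ℂ / ((‖v j i‖ ^ 2 : ℝ) : ℂ)) • v j i + w i := fun i => by
    simp only [hw]; abel
  have hwnorm : ∀ᶠ i in F, ‖⟪v j i, u i⟫_ℂ‖ ^ 2 = ‖v j i‖ ^ 2 * (1 - ‖w i‖ ^ 2) := by
    filter_upwards [hpos, hvw, hu] with i hi h1 h2
    have h0 : 0 < ‖v j i‖ ^ 2 := by linarith
    have h3 := norm_add_sq_eq_norm_sq_add_norm_sq_of_inner_eq_zero
      ((⟪v j i, u i⟫_ℂ / ((‖v j i‖ ^ 2 : ℝ) : ℂ)) • v j i) (w i) (𝕜 := ℂ)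
      (by rw [inner_smul_left, h1, mul_zero])
    rw [← hdecomp i, h2, norm_smul, norm_div, Complex.norm_real,
      Real.norm_of_nonneg h0.le] at h3
    have h4 : ‖v j i‖ ≠ 0 := fun h => by simp [h] at h0
    field_simp at h3
    nlinarith
  have hcross : ∀ᶠ i in F, ∀ l, ‖⟪v l i, u i⟫_ℂ‖ ≤ ν l i + ‖⟪v l i, w i⟫_ℂ‖ := by
    filter_upwards [hpos, hu] with i hi h2 l
    have h0 : 0 < ‖v j i‖ ^ 2 := by linarith
    have h4 : 0 < ‖v j i‖ := lt_of_le_of_ne (norm_nonneg _) fun h => by simp [← h] at h0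
    conv_lhs => rw [hdecomp i]
    rw [inner_add_right, inner_smul_right]
    refine (norm_add_le _ _).trans (add_le_add_left ?_ _)
    rw [norm_mul, norm_div, Complex.norm_real, Real.norm_of_nonneg h0.le]
    have h5 := norm_inner_le_norm (𝕜 := ℂ) (v j i) (u i)
    rw [h2, mul_one] at h5
    calc ‖⟪v j i, u i⟫_ℂ‖ / ‖v j i‖ ^ 2 * ‖⟪v l i, v j i⟫_ℂ‖
        ≤ ‖v j i‖ / ‖v j i‖ ^ 2 * ‖⟪v l i, v j i⟫_ℂ‖ := by gcongr
      _ = ν l i := by simp only [hν]; field_simp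
  have hwle : ∀ᶠ i in F, ‖w i‖ ≤ 1 := by
    filter_upwards [hpos, hwnorm] with i hi h1
    have h2 : 0 ≤ ‖v j i‖ ^ 2 * (1 - ‖w i‖ ^ 2) := h1 ▸ sq_nonneg _
    have h3 := nonneg_of_mul_nonneg_right h2 (by linarith)
    nlinarith [norm_nonneg (w i)]
  have hwlim : Tendsto (fun i => ‖w i‖ ^ 2) F (𝓝 0) := by
    rw [Metric.tendsto_nhds]
    intro e he
    set g := (d j - d') / 2 with hg
    have hg0 : 0 < g := by simp only [hg]; linarith
    filter_upwards [hQ (e * g / 4) (by positivity), hRlim.eventually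
      (gt_mem_nhds (show 0 < e * g / 4 by positivity)), hpos, hwnorm, hcross, hrow, hmax, hu, hwle]
      with i h1 h2 h3 h4 h5 h6 h7 h8 h9
    rw [Real.dist_eq, sub_zero, abs_of_nonneg (by positivity)]
    have hN0 : 0 < ‖v j i‖ ^ 2 := by linarith
    have a1 := (abs_le.1 (h1 (u i))).2
    rw [h8, one_pow, mul_one, ← Finset.add_sum_erase _ _ (Finset.mem_univ j), ← hs, h4] at a1
    have a2 := (abs_le.1 (h1 (v j i))).1
    have a3 : ‖v j i‖ ^ 2 * ‖v j i‖ ^ 2 ≤ ∑ l, ‖⟪v l i, v j i⟫_ℂ‖ ^ 2 := by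
      have : ‖v j i‖ ^ 2 * ‖v j i‖ ^ 2 = ‖⟪v j i, v j i⟫_ℂ‖ ^ 2 := by
        rw [inner_self_eq_norm_sq_to_K]; simp; ring
      rw [this]
      exact Finset.single_le_sum (f := fun l => ‖⟪v l i, v j i⟫_ℂ‖ ^ 2)
        (fun _ _ => by positivity) (Finset.mem_univ j)
    have a4 := h7 (v j i)
    have a5 : ‖v j i‖ ^ 2 - e * g / 4 ≤ Q i (u i) := by
      refine le_of_mul_le_mul_right ?_ hN0
      linarith
    have a6 : ∑ l ∈ s, ‖⟪v l i, u i⟫_ℂ‖ ^ 2 ≤ d' * ‖w i‖ ^ 2 + R i := by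
      refine le_trans ?_ (add_le_add_left (sum_norm_inner_sq_le s (fun l => v l i) (w i) hd'0 h6) _)
      rw [hR, ← Finset.sum_add_distrib]
      refine Finset.sum_le_sum fun l _ => ?_
      have b1 := pow_le_pow_left₀ (norm_nonneg _) (h5 l) 2
      have b2 : ‖⟪v l i, w i⟫_ℂ‖ ≤ ‖v l i‖ :=
        (norm_inner_le_norm _ _).trans (mul_le_of_le_one_right (norm_nonneg _) h9)
      have b3 : 0 ≤ ν l i := by simp only [hν]; positivity
      nlinarith
    have a7 : g * ‖w i‖ ^ 2 ≤ (‖v j i‖ ^ 2 - d') * ‖w i‖ ^ 2 := by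
      gcongr; simp only [hg]; linarith
    have a8 : g * ‖w i‖ ^ 2 < g * e := by nlinarith
    exact lt_of_mul_lt_mul_left a8 hg0.le
  have hwlim' : Tendsto (fun i => ‖w i‖) F (𝓝 0) := by
    have := (Real.continuous_sqrt.tendsto _).comp hwlim
    rw [Real.sqrt_zero] at this
    exact this.congr fun i => Real.sqrt_sq (norm_nonneg _)
  constructor
  · have h1 : Tendsto (fun i => ‖v j i‖ * ‖w i‖) F (𝓝 (√(d j) * 0)) := (hN' j).mul hwlim'
    rw [mul_zero] at h1
    refine h1.congr' ?_
    filter_upwards [hwnorm, hu] with i h2 h3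
    -- For unit u the squared distance is ‖v_j‖² − |⟨u, v_j⟩|², and the Pythagorean relation
    -- `hwnorm` identifies it with ‖v_j‖² ‖w‖².
    have h4 : ‖v j i - ⟪u i, v j i⟫_ℂ • u i‖ ^ 2 = (‖v j i‖ * ‖w i‖) ^ 2 := by
      rw [@norm_sub_sq ℂ, norm_smul, h3, mul_one, inner_smul_right, ← inner_conj_symm (v j i) (u i),
        Complex.mul_conj']
      rw [norm_inner_symm] at h2
      have h5 : ∀ r : ℝ, RCLike.re ((r : ℂ) ^ 2) = r ^ 2 := fun r => by
        rw [← Complex.ofReal_pow]; exact Complex.ofReal_re _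
      rw [h5, h2]
      ring
    exact ((pow_left_inj₀ (by positivity) (by positivity) two_ne_zero).1 h4).symm
  · intro l hl
    have hl' : l ∈ s := Finset.mem_erase.2 ⟨hl, Finset.mem_univ l⟩
    have h1 : Tendsto (fun i => ν l i + ‖v l i‖ * ‖w i‖) F (𝓝 (0 + √(d l) * 0)) :=
      (hνlim l hl').add ((hN' l).mul hwlim')
    rw [mul_zero, add_zero] at h1
    rw [tendsto_zero_iff_norm_tendsto_zero]
    refine squeeze_zero' (Eventually.of_forall fun _ => norm_nonneg _) ?_ h1
    filter_upwards [hcross] with i h2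
    rw [norm_inner_symm]
    exact (h2 l).trans (by gcongr; exact norm_inner_le_norm _ _)

end perturbation

namespace UplinkModel

variable {L P τ : ℕ} {Ω : Type*} [MeasurableSpace Ω] {μ : Measure Ω}

/-! ### Asymptotic orthogonality of the channels -/

theorem tendsto_gram_steering (S : UplinkModel L P τ μ) {ω : Ω}
    (hI : ∀ l p, S.θ l p ω ∈ Set.Ioo 0 Real.pi)
    (hne : ∀ l p l' p', (l, p) ≠ (l', p') → S.θ l p ω ≠ S.θ l' p' ω) (l l' : Fin L)
    (p p' : Fin P) :
    Tendsto (fun M : ℕ => ⟪S.steering M (S.θ l p ω), S.steering M (S.θ l' p' ω)⟫_ℂ / (M : ℂ))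
      atTop (𝓝 (if (l, p) = (l', p') then 1 else 0)) := by
  split_ifs with h
  · obtain ⟨rfl, rfl⟩ := Prod.mk.inj h
    refine (tendsto_const_nhds (x := (1 : ℂ))).congr' ?_
    filter_upwards [eventually_gt_atTop 0] with M hM
    have h1 := S.norm_steering_sq M (S.θ l p ω)
    have hM' : (M : ℂ) ≠ 0 := by exact_mod_cast hM.ne'
    have h2 : ((‖S.steering M (S.θ l p ω)‖ ^ 2 : ℝ) : ℂ) = M := by rw [h1]; simp
    push_cast at h2
    rw [inner_self_eq_norm_sq_to_K]
    exact ((div_eq_one_iff_eq hM').2 h2).symm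
  · exact S.tendsto_inner_steering
      (S.ratio_ne_one (hI l p) ⟨(hI l' p').1.le, (hI l' p').2.le⟩ (hne l p l' p' h))

open Classical in
/-- The asymptotic power per antenna of the part of the channel from cell `l` whose angles of
arrival lie in `Φ`. -/
def powerIn (S : UplinkModel L P τ μ) (Φ : Set ℝ) (l : Fin L) (ω : Ω) : ℝ :=
  (S.β l / √(P : ℝ)) ^ 2 * (Finset.univ.filter fun p => S.θ l p ω ∈ Φ).card

theorem tendsto_gram_channelIn (S : UplinkModel L P τ μ) {ω : Ω}
    (hI : ∀ l p, S.θ l p ω ∈ Set.Ioo 0 Real.pi)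
    (hne : ∀ l p l' p', (l, p) ≠ (l', p') → S.θ l p ω ≠ S.θ l' p' ω) (Φ : Set ℝ) (l l' : Fin L) :
    Tendsto (fun M : ℕ => ⟪S.channelIn Φ M l ω, S.channelIn Φ M l' ω⟫_ℂ / (M : ℂ))
      atTop (𝓝 (if l = l' then (S.powerIn Φ l ω : ℂ) else 0)) := by
  classical
  set b : Fin L → ℂ := fun l => ((S.β l / √(P : ℝ) : ℝ) : ℂ) with hb
  set e : Fin L → Fin P → ℂ := fun l p => Complex.exp (Complex.I * (S.φ l p ω : ℂ)) with he
  set A : Fin L → Finset (Fin P) := fun l => Finset.univ.filter fun p => S.θ l p ω ∈ Φ with hA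
  have h1 : ∀ M : ℕ, ⟪S.channelIn Φ M l ω, S.channelIn Φ M l' ω⟫_ℂ / (M : ℂ)
      = b l * b l' * ∑ p ∈ A l, ∑ p' ∈ A l', conj (e l p) * e l' p' *
        (⟪S.steering M (S.θ l p ω), S.steering M (S.θ l' p' ω)⟫_ℂ / (M : ℂ)) := by
    intro M
    have hc : ∀ l, S.channelIn Φ M l ω = b l • ∑ p ∈ A l, e l p • S.steering M (S.θ l p ω) :=
      fun l => rfl
    rw [hc, hc, inner_smul_left, inner_smul_right, sum_inner, hb, Complex.conj_ofReal, mul_assoc,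
      mul_div_assoc, mul_div_assoc, Finset.sum_div]
    congr 2
    refine Finset.sum_congr rfl fun p _ => ?_
    rw [inner_sum, Finset.sum_div]
    refine Finset.sum_congr rfl fun p' _ => ?_
    rw [inner_smul_left, inner_smul_right]
    ring
  simp_rw [h1]
  have h2 := (tendsto_finsetSum (A l) fun p _ => tendsto_finsetSum (A l') fun p' _ =>
    (S.tendsto_gram_steering hI hne l l' p p').const_mul (conj (e l p) * e l' p')).const_mul
      (b l * b l')
  convert h2 using 2
  by_cases h : l = l'
  · subst h
    have h3 : ∀ p, conj (e l p) * e l p = 1 := fun p => by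
      rw [Complex.conj_mul', he, norm_exp_phase]; simp
    have h4 : ∀ p ∈ A l, ∑ p' ∈ A l, conj (e l p) * e l p' *
        (if (l, p) = (l, p') then (1 : ℂ) else 0) = 1 := by
      intro p hp
      rw [Finset.sum_eq_single p]
      · simp [h3]
      · intro p' _ hp'; simp [hp'.symm]
      · exact fun h => absurd hp h
    rw [if_pos rfl, Finset.sum_congr rfl h4]
    simp only [powerIn, hb, hA, Finset.sum_const, nsmul_eq_mul, mul_one]
    push_cast
    ring
  · rw [if_neg h]
    simp [h]

theorem channelIn_eq_channel (S : UplinkModel L P τ μ) (Φ : Set ℝ) (M : ℕ) (l : Fin L) {ω : Ω}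
    (h : ∀ p, S.θ l p ω ∈ Φ) : S.channelIn Φ M l ω = S.channel M l ω := by
  classical
  rw [channelIn, channel, Finset.filter_true_of_mem fun p _ => h p]

theorem powerIn_of_forall_mem (S : UplinkModel L P τ μ) (Φ : Set ℝ) (l : Fin L) {ω : Ω}
    (h : ∀ p, S.θ l p ω ∈ Φ) : S.powerIn Φ l ω = S.β l ^ 2 := by
  classical
  have hP : (P : ℝ) ≠ 0 := by exact_mod_cast S.paths_pos.ne'
  rw [powerIn, Finset.filter_true_of_mem fun p _ => h p, Finset.card_fin, div_pow,
    Real.sq_sqrt (Nat.cast_nonneg P)]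
  field_simp

theorem powerIn_nonneg (S : UplinkModel L P τ μ) (Φ : Set ℝ) (l : Fin L) (ω : Ω) :
    0 ≤ S.powerIn Φ l ω := by
  unfold powerIn; positivity

/-- The projection is linear and a channel has a fixed finite number of paths with unit-modulus
coefficients, so the triangle inequality reduces the claim to single steering vectors. -/
theorem tendsto_norm_project_sub_channelIn (S : UplinkModel L P τ μ) (Φ : Set ℝ) (j : Fin L)
    (ε : ℕ → ℝ) {ω : Ω} (l : Fin L)
    (hin : ∀ p, S.θ l p ω ∈ Φ → Tendsto (fun M : ℕ => ‖S.steering M (S.θ l p ω) -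
      S.project M j (ε M) (S.steering M (S.θ l p ω))‖ / √M) atTop (𝓝 0))
    (hout : ∀ p, S.θ l p ω ∉ Φ → Tendsto (fun M : ℕ =>
      ‖S.project M j (ε M) (S.steering M (S.θ l p ω))‖ / √M) atTop (𝓝 0)) :
    Tendsto (fun M : ℕ => ‖S.project M j (ε M) (S.channel M l ω) - S.channelIn Φ M l ω‖ / √M)
      atTop (𝓝 0) := by
  classical
  set r : ℕ → Fin P → ℝ := fun M p => ‖S.project M j (ε M) (S.steering M (S.θ l p ω)) -
    if S.θ l p ω ∈ Φ then S.steering M (S.θ l p ω) else 0‖ with hr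
  have hlim : Tendsto (fun M : ℕ => S.β l / √(P : ℝ) * ∑ p, r M p / √M) atTop (𝓝 0) := by
    have : Tendsto (fun M : ℕ => S.β l / √(P : ℝ) * ∑ p, r M p / √M) atTop
        (𝓝 (S.β l / √(P : ℝ) * ∑ _p : Fin P, 0)) := by
      refine (tendsto_finsetSum _ fun p _ => ?_).const_mul _
      by_cases h : S.θ l p ω ∈ Φ
      · simpa only [hr, if_pos h, norm_sub_rev] using hin p h
      · simpa only [hr, if_neg h, sub_zero] using hout p h
    simpa using this
  refine squeeze_zero (fun M => by positivity) (fun M => ?_) hlim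
  rw [← Finset.sum_div, ← mul_div_assoc]
  gcongr
  have h1 : S.project M j (ε M) (S.channel M l ω) - S.channelIn Φ M l ω
      = ((S.β l / √(P : ℝ) : ℝ) : ℂ) • ∑ p, Complex.exp (Complex.I * (S.φ l p ω : ℂ)) •
        (S.project M j (ε M) (S.steering M (S.θ l p ω)) -
          if S.θ l p ω ∈ Φ then S.steering M (S.θ l p ω) else 0) := by
    rw [channel, channelIn, map_smul, map_sum, ← smul_sub]
    congr 1
    rw [Finset.sum_filter, ← Finset.sum_sub_distrib]
    refine Finset.sum_congr rfl fun p _ => ?_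
    rw [map_smul, smul_sub, smul_ite, smul_zero]
  rw [h1, norm_smul, Complex.norm_real, Real.norm_of_nonneg (S.scale_pos l).le]
  refine mul_le_mul_of_nonneg_left ((norm_sum_le _ _).trans (Finset.sum_le_sum fun p _ => ?_))
    (S.scale_pos l).le
  rw [norm_smul, norm_exp_phase, one_mul]

theorem tendsto_inner_of_norm_sub {ι : Type*} {F : Filter ι} {E : ι → Type*}
    [∀ i, NormedAddCommGroup (E i)] [∀ i, InnerProductSpace ℂ (E i)] {a b a' b' : ∀ i, E i}
    {K : ℝ} {g : ℂ} (h : Tendsto (fun i => ‖a i - b i‖) F (𝓝 0))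
    (h' : Tendsto (fun i => ‖a' i - b' i‖) F (𝓝 0)) (hb : ∀ i, ‖b i‖ ≤ K) (hb' : ∀ i, ‖b' i‖ ≤ K)
    (hg : Tendsto (fun i => ⟪b i, b' i⟫_ℂ) F (𝓝 g)) :
    Tendsto (fun i => ⟪a i, a' i⟫_ℂ) F (𝓝 g) := by
  have h0 : Tendsto (fun i => ⟪a i, a' i⟫_ℂ - ⟪b i, b' i⟫_ℂ) F (𝓝 0) := by
    rw [tendsto_zero_iff_norm_tendsto_zero]
    have hlim : Tendsto (fun i => ‖a i - b i‖ * (‖a' i - b' i‖ + K) + K * ‖a' i - b' i‖) F (𝓝 0) := by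
      have := (h.mul (h'.add_const K)).add (h'.const_mul K)
      simpa using this
    refine squeeze_zero (fun _ => norm_nonneg _) (fun i => ?_) hlim
    have e1 : ⟪a i, a' i⟫_ℂ - ⟪b i, b' i⟫_ℂ = ⟪a i - b i, a' i⟫_ℂ + ⟪b i, a' i - b' i⟫_ℂ := by
      rw [inner_sub_left, inner_sub_right]; ring
    have e2 : ‖a' i‖ ≤ ‖a' i - b' i‖ + K := by
      have := norm_add_le (a' i - b' i) (b' i)
      rw [sub_add_cancel] at this
      linarith [hb' i]
    rw [e1]
    refine (norm_add_le _ _).trans (add_le_add ?_ ?_)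
    · exact (norm_inner_le_norm _ _).trans (by gcongr)
    · exact (norm_inner_le_norm _ _).trans (by gcongr; exact hb i)
  simpa using h0.add hg

theorem norm_channelIn_le (S : UplinkModel L P τ μ) (Φ : Set ℝ) (M : ℕ) (l : Fin L) (ω : Ω) :
    ‖S.channelIn Φ M l ω‖ ≤ S.β l / √(P : ℝ) * P * √M := by
  classical
  rw [channelIn, norm_smul, Complex.norm_real, Real.norm_of_nonneg (S.scale_pos l).le, mul_assoc]
  refine mul_le_mul_of_nonneg_left ?_ (S.scale_pos l).le
  have h : ∀ p, ‖Complex.exp (Complex.I * (S.φ l p ω : ℂ)) • S.steering M (S.θ l p ω)‖ = √M := by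
    intro p
    rw [norm_smul, norm_exp_phase, one_mul, ← S.norm_steering_sq M (S.θ l p ω),
      Real.sqrt_sq (norm_nonneg _)]
  refine (norm_sum_le _ _).trans ?_
  simp only [h, Finset.sum_const, nsmul_eq_mul]
  gcongr
  exact (Finset.card_filter_le _ _).trans (by simp)

/-- The channel from cell `l` projected on the signal space and normalized by the size of the
array. -/
def signalPart (S : UplinkModel L P τ μ) (j : Fin L) (ε : ℕ → ℝ) (ω : Ω) (l : Fin L) (M : ℕ) :
    EuclideanSpace ℂ (Fin M) :=
  (((√(M : ℝ))⁻¹ : ℝ) : ℂ) • S.project M j (ε M) (S.channel M l ω)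

theorem norm_inv_sqrt_smul {M : ℕ} (x : EuclideanSpace ℂ (Fin M)) :
    ‖(((√(M : ℝ))⁻¹ : ℝ) : ℂ) • x‖ = ‖x‖ / √M := by
  rw [norm_smul, Complex.norm_real, Real.norm_of_nonneg (by positivity), div_eq_inv_mul]

theorem tendsto_norm_signalPart_sub (S : UplinkModel L P τ μ) (Φ : Set ℝ) (j : Fin L)
    (ε : ℕ → ℝ) {ω : Ω} (l : Fin L)
    (h : Tendsto (fun M : ℕ => ‖S.project M j (ε M) (S.channel M l ω) - S.channelIn Φ M l ω‖ / √M)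
      atTop (𝓝 0)) :
    Tendsto (fun M : ℕ => ‖S.signalPart j ε ω l M -
      (((√(M : ℝ))⁻¹ : ℝ) : ℂ) • S.channelIn Φ M l ω‖) atTop (𝓝 0) := by
  refine h.congr fun M => ?_
  rw [signalPart, ← smul_sub, norm_inv_sqrt_smul]

theorem tendsto_gram_signalPart (S : UplinkModel L P τ μ) (Φ : Set ℝ) (j : Fin L)
    (ε : ℕ → ℝ) {ω : Ω} (hI : ∀ l p, S.θ l p ω ∈ Set.Ioo 0 Real.pi)
    (hne : ∀ l p l' p', (l, p) ≠ (l', p') → S.θ l p ω ≠ S.θ l' p' ω)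
    (h : ∀ l, Tendsto (fun M : ℕ =>
      ‖S.project M j (ε M) (S.channel M l ω) - S.channelIn Φ M l ω‖ / √M) atTop (𝓝 0))
    (l l' : Fin L) :
    Tendsto (fun M : ℕ => ⟪S.signalPart j ε ω l M, S.signalPart j ε ω l' M⟫_ℂ)
      atTop (𝓝 (if l = l' then (S.powerIn Φ l ω : ℂ) else 0)) := by
  have hK : ∀ l : Fin L, ∀ M : ℕ, ‖(((√(M : ℝ))⁻¹ : ℝ) : ℂ) • S.channelIn Φ M l ω‖
      ≤ ∑ l, S.β l / √(P : ℝ) * P := by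
    intro l M
    have h1 : S.β l / √(P : ℝ) * P ≤ ∑ l, S.β l / √(P : ℝ) * P :=
      Finset.single_le_sum (f := fun l => S.β l / √(P : ℝ) * P)
        (fun l _ => mul_nonneg (S.scale_pos l).le (Nat.cast_nonneg P)) (Finset.mem_univ l)
    rw [norm_inv_sqrt_smul]
    have h0 : 0 ≤ S.β l / √(P : ℝ) * P := mul_nonneg (S.scale_pos l).le (Nat.cast_nonneg P)
    exact (div_le_of_le_mul₀ (Real.sqrt_nonneg _) h0 (S.norm_channelIn_le Φ M l ω)).trans h1
  refine tendsto_inner_of_norm_sub (S.tendsto_norm_signalPart_sub Φ j ε l (h l))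
    (S.tendsto_norm_signalPart_sub Φ j ε l' (h l')) (hK l) (hK l') ?_
  refine (S.tendsto_gram_channelIn hI hne Φ l l').congr fun M => ?_
  rw [inner_smul_left, inner_smul_right, Complex.conj_ofReal, ← mul_assoc, ← Complex.ofReal_mul,
    ← mul_inv, Real.mul_self_sqrt (Nat.cast_nonneg M), div_eq_inv_mul]
  simp

/-! ### The sample covariance -/

/-- The data vector received at time `c`. -/
def dataVector (S : UplinkModel L P τ μ) (M : ℕ) (ω : Ω) (c : ℕ) : EuclideanSpace ℂ (Fin M) :=
  (∑ l, S.X l c ω • S.channel M l ω) + WithLp.toLp 2 fun m : Fin M => S.Z m c ω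

theorem projSignal_apply (S : UplinkModel L P τ μ) (j : Fin L) (ε : ℝ) (M C : ℕ) (ω : Ω)
    (m : Fin M) (c : Fin C) :
    S.projSignal j ε M C ω m c = S.project M j ε (S.dataVector M ω c) m := by
  have h : ∀ n, S.dataSignal M C ω n c = S.dataVector M ω c n := by
    intro n
    simp [dataSignal, dataVector, Matrix.sum_apply, Matrix.vecMulVec_apply, WithLp.ofLp_sum, mul_comm]
  simp only [projSignal, Matrix.mul_apply, h, project, Matrix.toLpLin_apply, Matrix.mulVec,
    dotProduct]

theorem inner_sampleCov (S : UplinkModel L P τ μ) (j : Fin L) (ε : ℝ) (M C : ℕ) (ω : Ω)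
    (x : EuclideanSpace ℂ (Fin M)) :
    ⟪x, WithLp.toLp 2 (S.sampleCov j ε M C ω *ᵥ (x : Fin M → ℂ))⟫_ℂ
      = (((∑ c : Fin C, ‖⟪S.project M j ε x, S.dataVector M ω c⟫_ℂ‖ ^ 2) / C : ℝ) : ℂ) := by
  have h1 : ∀ c : Fin C, ((S.projSignal j ε M C ω)ᴴ *ᵥ (x : Fin M → ℂ)) c
      = ⟪S.dataVector M ω c, S.project M j ε x⟫_ℂ := by
    intro c
    rw [← inner_project_left, inner_eq_sum]
    simp only [Matrix.mulVec, dotProduct, Matrix.conjTranspose_apply, projSignal_apply]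
    rfl
  rw [sampleCov, Matrix.smul_mulVec, ← Matrix.mulVec_mulVec, WithLp.toLp_smul, inner_smul_right,
    inner_eq_sum]
  simp only [Matrix.mulVec, dotProduct] at h1 ⊢
  simp only [h1, Finset.mul_sum]
  rw [Finset.sum_comm, Complex.ofReal_div, Complex.ofReal_sum, Finset.sum_div]
  refine Finset.sum_congr rfl fun c _ => ?_
  have h2 : ⟪S.project M j ε x, S.dataVector M ω c⟫_ℂ
      = ∑ m, conj (x m) * S.projSignal j ε M C ω m c := by
    rw [inner_project_left, inner_eq_sum]
    simp only [projSignal_apply]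
  rw [← inner_conj_symm (S.dataVector M ω c)]
  push_cast
  rw [← Complex.mul_conj']
  conv_rhs => rw [h2]
  rw [Finset.sum_mul, Finset.sum_div]
  refine Finset.sum_congr rfl fun m _ => ?_
  rw [h2]
  ring

/-- The range of the sample covariance lies in the signal space; this places its eigenvectors with
nonzero eigenvalue there. -/
theorem project_sampleCov_mulVec (S : UplinkModel L P τ μ) (j : Fin L) (ε : ℝ) (M C : ℕ) (ω : Ω)
    (x : EuclideanSpace ℂ (Fin M)) :
    S.project M j ε (WithLp.toLp 2 (S.sampleCov j ε M C ω *ᵥ (x : Fin M → ℂ)))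
      = WithLp.toLp 2 (S.sampleCov j ε M C ω *ᵥ (x : Fin M → ℂ)) := by
  have h : WithLp.toLp 2 (S.sampleCov j ε M C ω *ᵥ (x : Fin M → ℂ))
      = S.project M j ε (WithLp.toLp 2 (((1 / (C : ℂ)) • (S.dataSignal M C ω *
        (S.projSignal j ε M C ω)ᴴ)) *ᵥ (x : Fin M → ℂ))) := by
    rw [project, Matrix.toLpLin_apply, Matrix.mulVec_mulVec, sampleCov]
    conv_lhs => rw [projSignal, Matrix.mul_assoc]
    rw [Matrix.mul_smul]
    rfl
  rw [h, project_project]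

theorem sampleCov_isHermitian (S : UplinkModel L P τ μ) (j : Fin L) (ε : ℝ) (M C : ℕ) (ω : Ω) :
    (S.sampleCov j ε M C ω).IsHermitian := by
  rw [sampleCov, Matrix.IsHermitian, Matrix.conjTranspose_smul, Matrix.conjTranspose_mul,
    Matrix.conjTranspose_conjTranspose]
  simp

end UplinkModel

/-- Expanding in an orthonormal eigenbasis bounds the Rayleigh quotient by the eigenvalue of u. Only
this variational property of the dominant eigenvector enters the asymptotics, so its choice is
irrelevant. -/
theorem IsDominantEigenvector.re_inner_mulVec_le {M : ℕ} {A : Matrix (Fin M) (Fin M) ℂ}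
    {u : EuclideanSpace ℂ (Fin M)} (h : IsDominantEigenvector A u) (hA : A.IsHermitian)
    (x : EuclideanSpace ℂ (Fin M)) :
    (⟪x, WithLp.toLp 2 (A *ᵥ (x : Fin M → ℂ))⟫_ℂ).re
      ≤ (⟪u, WithLp.toLp 2 (A *ᵥ (u : Fin M → ℂ))⟫_ℂ).re * ‖x‖ ^ 2 := by
  obtain ⟨hu, r, hr, hmax⟩ := h
  have h1 : (⟪u, WithLp.toLp 2 (A *ᵥ (u : Fin M → ℂ))⟫_ℂ).re = r := by
    rw [hr, WithLp.toLp_smul, WithLp.toLp_ofLp, inner_smul_right, inner_self_eq_norm_sq_to_K, hu]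
    simp
  have heig : ∀ i, hA.eigenvalues i ≤ r := by
    intro i
    refine hmax _ (Module.End.hasEigenvalue_of_hasEigenvector
      (x := (hA.eigenvectorBasis i : Fin M → ℂ)) ⟨?_, ?_⟩)
    · rw [Module.End.mem_eigenspace_iff, Matrix.toLin'_apply, hA.mulVec_eigenvectorBasis]
      rfl
    · intro h0
      refine hA.eigenvectorBasis.orthonormal.ne_zero i ?_
      ext m
      exact congrFun h0 m
  have h2 : ⟪x, WithLp.toLp 2 (A *ᵥ (x : Fin M → ℂ))⟫_ℂ
      = ((∑ i, hA.eigenvalues i * ‖⟪hA.eigenvectorBasis i, x⟫_ℂ‖ ^ 2 : ℝ) : ℂ) := by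
    rw [← hA.eigenvectorBasis.sum_inner_mul_inner, Complex.ofReal_sum]
    refine Finset.sum_congr rfl fun i _ => ?_
    have h3 : ⟪hA.eigenvectorBasis i, WithLp.toLp 2 (A *ᵥ (x : Fin M → ℂ))⟫_ℂ
        = (hA.eigenvalues i : ℂ) * ⟪hA.eigenvectorBasis i, x⟫_ℂ := by
      have hs := (Matrix.isSymmetric_toEuclideanLin_iff.2 hA) (hA.eigenvectorBasis i) x
      simp only [Matrix.toLpLin_apply, hA.mulVec_eigenvectorBasis] at hs
      rw [← hs, WithLp.toLp_smul, WithLp.toLp_ofLp, ← Complex.coe_smul, inner_smul_left]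
      simp
    rw [h3, ← inner_conj_symm]
    push_cast
    rw [← Complex.mul_conj']
    ring
  rw [h1, h2, Complex.ofReal_re, ← hA.eigenvectorBasis.sum_sq_norm_inner_right, Finset.mul_sum]
  gcongr with i
  exact heig i

/-! ### Moments of the noise -/

theorem memLp_id_complexGaussian (v : ℝ≥0) : MemLp id 4 (complexGaussian v) := by
  rw [complexGaussian, memLp_map_measure_iff aestronglyMeasurable_id (by fun_prop)]
  have h : MemLp id 4 (gaussianReal 0 (v / 2)) := by exact_mod_cast memLp_id_gaussianReal 4
  have h1 : MemLp (fun x : ℝ × ℝ => x.1) 4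
      ((gaussianReal 0 (v / 2)).prod (gaussianReal 0 (v / 2))) :=
    h.comp_measurePreserving measurePreserving_fst
  have h2 : MemLp (fun x : ℝ × ℝ => x.2) 4
      ((gaussianReal 0 (v / 2)).prod (gaussianReal 0 (v / 2))) :=
    h.comp_measurePreserving measurePreserving_snd
  exact (h1.ofReal (K := ℂ)).add ((h2.ofReal (K := ℂ)).mul_const Complex.I)

theorem integral_id_complexGaussian (v : ℝ≥0) : ∫ z, z ∂(complexGaussian v) = 0 := by
  rw [complexGaussian, integral_map (by fun_prop) (by fun_prop)]
  have h : MemLp id 1 (gaussianReal 0 (v / 2)) := by exact_mod_cast memLp_id_gaussianReal 1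
  have h1 : Integrable (fun x : ℝ × ℝ => (x.1 : ℂ))
      ((gaussianReal 0 (v / 2)).prod (gaussianReal 0 (v / 2))) :=
    ((h.comp_measurePreserving measurePreserving_fst).ofReal (K := ℂ)).integrable le_rfl
  have h2 : Integrable (fun x : ℝ × ℝ => (x.2 : ℂ) * Complex.I)
      ((gaussianReal 0 (v / 2)).prod (gaussianReal 0 (v / 2))) :=
    (((h.comp_measurePreserving measurePreserving_snd).ofReal (K := ℂ)).integrable le_rfl).mul_const _
  rw [integral_add h1 h2, integral_mul_const, integral_complex_ofReal, integral_complex_ofReal]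
  have h3 : ∫ x : ℝ × ℝ, x.1 ∂((gaussianReal 0 (v / 2)).prod (gaussianReal 0 (v / 2))) = 0 := by
    rw [integral_fun_fst (f := fun x : ℝ => x), integral_id_gaussianReal]; simp
  have h4 : ∫ x : ℝ × ℝ, x.2 ∂((gaussianReal 0 (v / 2)).prod (gaussianReal 0 (v / 2))) = 0 := by
    rw [integral_fun_snd (f := fun x : ℝ => x), integral_id_gaussianReal]; simp
  rw [h3, h4]; simp

/-! ### Received power compared with the power of the channels -/

theorem abs_sum_norm_add_sq_sub_le {κ : Type*} (s : Finset κ) (a z : κ → ℂ) {t : ℝ} (ht : 0 < t) :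
    |∑ c ∈ s, ‖a c + z c‖ ^ 2 - ∑ c ∈ s, ‖a c‖ ^ 2|
      ≤ t * ∑ c ∈ s, ‖a c‖ ^ 2 + (1 + 1 / t) * ∑ c ∈ s, ‖z c‖ ^ 2 := by
  rw [← Finset.sum_sub_distrib, Finset.mul_sum, Finset.mul_sum, ← Finset.sum_add_distrib]
  refine (Finset.abs_sum_le_sum_abs _ _).trans (Finset.sum_le_sum fun c _ => ?_)
  have h1 : ‖a c + z c‖ ≤ ‖a c‖ + ‖z c‖ := norm_add_le _ _
  have h2 : ‖a c‖ ≤ ‖a c + z c‖ + ‖z c‖ := by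
    simpa using norm_sub_le (a c + z c) (z c)
  have hw := norm_nonneg (a c + z c)
  generalize ‖a c + z c‖ = w at *
  have hx := norm_nonneg (a c)
  have hy := norm_nonneg (z c)
  generalize ‖a c‖ = x at *
  generalize ‖z c‖ = y at *
  -- Young's inequality for the cross term, with a free parameter t that trades a small share of the
  -- signal power against a large multiple of the noise power.
  have h3 : 2 * (x * y) ≤ t * x ^ 2 + 1 / t * y ^ 2 := by
    have : 0 ≤ (t * x - y) ^ 2 / t := by positivity
    have h4 : (t * x - y) ^ 2 / t = t * x ^ 2 + 1 / t * y ^ 2 - 2 * (x * y) := by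
      field_simp; ring
    linarith
  rcases le_or_gt x w with h | h
  · rw [abs_of_nonneg (by nlinarith)]
    nlinarith
  · rw [abs_of_nonpos (by nlinarith)]
    nlinarith

namespace UplinkModel

variable {L P τ : ℕ} {Ω : Type*} [MeasurableSpace Ω] {μ : Measure Ω}

/-- The size of the largest possible channel, per square root of the number of antennas. -/
def maxGain (S : UplinkModel L P τ μ) : ℝ := ∑ l, S.β l / √(P : ℝ) * P

theorem maxGain_nonneg (S : UplinkModel L P τ μ) : 0 ≤ S.maxGain :=
  Finset.sum_nonneg fun l _ => mul_nonneg (S.scale_pos l).le (Nat.cast_nonneg P)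

theorem gain_le_maxGain (S : UplinkModel L P τ μ) (l : Fin L) :
    S.β l / √(P : ℝ) * P ≤ S.maxGain :=
  Finset.single_le_sum (f := fun l => S.β l / √(P : ℝ) * P)
    (fun l _ => mul_nonneg (S.scale_pos l).le (Nat.cast_nonneg P)) (Finset.mem_univ l)

theorem norm_channel_le_maxGain (S : UplinkModel L P τ μ) (M : ℕ) (l : Fin L) (ω : Ω) :
    ‖S.channel M l ω‖ ≤ S.maxGain * √M :=
  (S.norm_channel_le M l ω).trans (by gcongr; exact S.gain_le_maxGain l)

/-- The empirical Gram matrix of the symbols is C(I + G), so the difference is C times the quadratic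
form of G at the numbers ⟨y, h_l⟩, each of size at most `maxGain` √M ‖y‖. -/
theorem abs_symbol_form_sub_le (S : UplinkModel L P τ μ) (M C : ℕ) (ω : Ω)
    (y : EuclideanSpace ℂ (Fin M)) (G : Fin L → Fin L → ℂ)
    (hG : ∀ l l', ∑ c ∈ Finset.range C, S.X l c ω * conj (S.X l' c ω)
      = (C : ℂ) * (G l l' + if l = l' then 1 else 0)) :
    |∑ c ∈ Finset.range C, ‖∑ l, S.X l c ω * ⟪y, S.channel M l ω⟫_ℂ‖ ^ 2 -
      C * ∑ l, ‖⟪y, S.channel M l ω⟫_ℂ‖ ^ 2|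
      ≤ C * (S.maxGain ^ 2 * M * ∑ l, ∑ l', ‖G l l'‖) * ‖y‖ ^ 2 := by
  set g : Fin L → ℂ := fun l => ⟪y, S.channel M l ω⟫_ℂ with hg
  have hgn : ∀ l, ‖g l‖ ≤ ‖y‖ * (S.maxGain * √M) := fun l =>
    (norm_inner_le_norm _ _).trans (by gcongr; exact S.norm_channel_le_maxGain M l ω)
  have hsq : ∀ z : ℂ, ((‖z‖ ^ 2 : ℝ) : ℂ) = z * conj z := fun z => by
    rw [Complex.mul_conj, Complex.normSq_eq_norm_sq]
  have hid : ((∑ c ∈ Finset.range C, ‖∑ l, S.X l c ω * g l‖ ^ 2 - C * ∑ l, ‖g l‖ ^ 2 : ℝ) : ℂ)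
      = C * ∑ l, ∑ l', g l * conj (g l') * G l l' := by
    rw [Complex.ofReal_sub, Complex.ofReal_sum, sub_eq_iff_eq_add]
    simp_rw [hsq, map_sum, Finset.sum_mul_sum]
    rw [Finset.sum_comm]
    have h1 : ∀ l, ∑ c ∈ Finset.range C, ∑ l', S.X l c ω * g l * conj (S.X l' c ω * g l')
        = C * ∑ l', g l * conj (g l') * G l l' + C * (g l * conj (g l)) := by
      intro l
      rw [Finset.sum_comm]
      have h2 : ∀ l', ∑ c ∈ Finset.range C, S.X l c ω * g l * conj (S.X l' c ω * g l')
          = C * (g l * conj (g l') * G l l') +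
            C * (if l = l' then g l * conj (g l') else 0) := by
        intro l'
        have : ∀ c, S.X l c ω * g l * conj (S.X l' c ω * g l')
            = g l * conj (g l') * (S.X l c ω * conj (S.X l' c ω)) := fun c => by
          rw [map_mul]; ring
        simp_rw [this, ← Finset.mul_sum, hG]
        split_ifs <;> ring
      simp_rw [h2, Finset.sum_add_distrib, ← Finset.mul_sum]
      simp
    simp_rw [h1, Finset.sum_add_distrib, ← Finset.mul_sum]
    rw [Complex.ofReal_mul, Complex.ofReal_sum]
    simp_rw [hsq]
    simp
  rw [← Real.norm_eq_abs, ← Complex.norm_real, hid, norm_mul, Complex.norm_natCast, mul_assoc]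
  refine mul_le_mul_of_nonneg_left ?_ (Nat.cast_nonneg C)
  rw [Finset.mul_sum, Finset.sum_mul]
  refine (norm_sum_le _ _).trans (Finset.sum_le_sum fun l _ => ?_)
  rw [Finset.mul_sum, Finset.sum_mul]
  refine (norm_sum_le _ _).trans (Finset.sum_le_sum fun l' _ => ?_)
  rw [norm_mul, norm_mul, RCLike.norm_conj]
  have h0 : 0 ≤ ‖y‖ * (S.maxGain * √M) := by
    have := S.maxGain_nonneg; positivity
  calc ‖g l‖ * ‖g l'‖ * ‖G l l'‖
      ≤ (‖y‖ * (S.maxGain * √M)) * (‖y‖ * (S.maxGain * √M)) * ‖G l l'‖ := by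
        gcongr
        · exact hgn l
        · exact hgn l'
    _ = S.maxGain ^ 2 * (√M) ^ 2 * ‖G l l'‖ * ‖y‖ ^ 2 := by ring
    _ = _ := by rw [Real.sq_sqrt (Nat.cast_nonneg M)]

theorem inner_dataVector (S : UplinkModel L P τ μ) (M : ℕ) (ω : Ω) (c : ℕ)
    (y : EuclideanSpace ℂ (Fin M)) :
    ⟪y, S.dataVector M ω c⟫_ℂ = ∑ l, S.X l c ω * ⟪y, S.channel M l ω⟫_ℂ +
      ∑ m, conj (y m) * S.Z m c ω := by
  rw [dataVector, inner_add_right, inner_sum]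
  simp only [inner_smul_right]
  congr 1
  rw [inner_eq_sum]

theorem eventually_abs_data_form_sub_le (S : UplinkModel L P τ μ) {ω : Ω}
    (hX : ∀ l l', Tendsto (fun C : ℕ => (∑ c ∈ Finset.range C, S.X l c ω * conj (S.X l' c ω)) /
      (C : ℂ)) atTop (𝓝 (if l = l' then 1 else 0)))
    (hZ : ∀ δ : ℝ, 0 < δ → ∀ᶠ q : ℕ × ℕ in atTop ×ˢ atTop, ∀ y : Fin q.1 → ℂ,
      ∑ c : Fin q.2, ‖∑ m, y m * S.Z m c ω‖ ^ 2 ≤ δ * q.1 * q.2 * ∑ m, ‖y m‖ ^ 2)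
    {e : ℝ} (he : 0 < e) :
    ∀ᶠ q : ℕ × ℕ in atTop ×ˢ atTop, ∀ y : EuclideanSpace ℂ (Fin q.1),
      |(∑ c : Fin q.2, ‖⟪y, S.dataVector q.1 ω c⟫_ℂ‖ ^ 2) / q.2 / q.1 -
        (∑ l, ‖⟪y, S.channel q.1 l ω⟫_ℂ‖ ^ 2) / q.1| ≤ e * ‖y‖ ^ 2 := by
  set H := S.maxGain ^ 2 with hH
  have hH0 : 0 ≤ H := sq_nonneg _
  set G : ℕ → Fin L → Fin L → ℂ := fun C l l' =>
    (∑ c ∈ Finset.range C, S.X l c ω * conj (S.X l' c ω)) / (C : ℂ) - if l = l' then 1 else 0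
    with hGdef
  have hγ : Tendsto (fun C => ∑ l, ∑ l', ‖G C l l'‖) atTop (𝓝 0) := by
    have : Tendsto (fun C => ∑ l, ∑ l', ‖G C l l'‖) atTop
        (𝓝 (∑ _l : Fin L, ∑ _l' : Fin L, ‖(0 : ℂ)‖)) := by
      refine tendsto_finsetSum _ fun l _ => tendsto_finsetSum _ fun l' _ => Tendsto.norm ?_
      have h1 := (hX l l').sub_const (if l = l' then (1 : ℂ) else 0)
      rwa [sub_self] at h1
    simpa using this
  -- The tolerance is shared by three errors of e/3 each: the symbol correlations, the share t of
  -- the signal power, which is at most CM(L + 1)(H + 1)‖y‖², and the noise power multiplied by 1 +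
  -- 1/t, for which δ is chosen.
  set t := e / (3 * ((L + 1) * (H + 1))) with ht
  have ht0 : 0 < t := by positivity
  set δ := e / 3 / (1 + 1 / t) with hδ
  have hδ0 : 0 < δ := by positivity
  have hγ1 := hγ.eventually (gt_mem_nhds (show 0 < min 1 (e / (3 * (H + 1))) by positivity))
  filter_upwards [hZ δ hδ0,
    (eventually_gt_atTop 0).prod_mk (hγ1.and (eventually_gt_atTop 0))] with q h1 h2 y
  obtain ⟨M, C⟩ := q
  obtain ⟨hM, hγC, hC⟩ := h2
  simp only at h1 hM hγC hC y ⊢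
  have hM' : (0 : ℝ) < M := by exact_mod_cast hM
  have hC' : (0 : ℝ) < C := by exact_mod_cast hC
  set γ := ∑ l, ∑ l', ‖G C l l'‖ with hγdef
  have hγ0 : 0 ≤ γ := Finset.sum_nonneg fun _ _ => Finset.sum_nonneg fun _ _ => norm_nonneg _
  have hγ2 : γ ≤ 1 := hγC.le.trans (min_le_left _ _)
  have hγ3 : H * γ ≤ e / 3 := by
    have h3 := hγC.le.trans (min_le_right _ _)
    rw [le_div_iff₀ (by positivity)] at h3
    nlinarith
  have hA := S.abs_symbol_form_sub_le M C ω y (G C) (fun l l' => by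
    have hC2 : (C : ℂ) ≠ 0 := by exact_mod_cast hC.ne'
    simp only [hGdef]
    rw [sub_add_cancel, mul_div_cancel₀ _ hC2])
  have hZ' := h1 fun m => conj (y m)
  simp only [RCLike.norm_conj] at hZ'
  rw [← EuclideanSpace.norm_sq_eq] at hZ'
  have hB := abs_sum_norm_add_sq_sub_le (Finset.univ : Finset (Fin C))
    (fun c => ∑ l, S.X l c ω * ⟪y, S.channel M l ω⟫_ℂ) (fun c => ∑ m, conj (y m) * S.Z m c ω) ht0
  simp only [inner_dataVector]
  rw [Finset.sum_range] at hA
  set a := ∑ c : Fin C, ‖∑ l, S.X l c ω * ⟪y, S.channel M l ω⟫_ℂ‖ ^ 2 with ha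
  set g := ∑ l, ‖⟪y, S.channel M l ω⟫_ℂ‖ ^ 2 with hg
  have hgle : g ≤ L * (H * M * ‖y‖ ^ 2) := by
    have h4 : ∀ l ∈ Finset.univ, ‖⟪y, S.channel M l ω⟫_ℂ‖ ^ 2 ≤ H * M * ‖y‖ ^ 2 := by
      intro l _
      have h5 : ‖⟪y, S.channel M l ω⟫_ℂ‖ ≤ ‖y‖ * (S.maxGain * √M) :=
        (norm_inner_le_norm _ _).trans (by gcongr; exact S.norm_channel_le_maxGain M l ω)
      refine (pow_le_pow_left₀ (norm_nonneg _) h5 2).trans (le_of_eq ?_)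
      rw [mul_pow, mul_pow, Real.sq_sqrt hM'.le]
      ring
    simpa using Finset.sum_le_card_nsmul _ _ _ h4
  have hY0 : 0 ≤ ‖y‖ ^ 2 := by positivity
  have hale : a ≤ C * M * ((L + 1) * (H + 1)) * ‖y‖ ^ 2 := by
    have h6 := (abs_le.1 hA).2
    have h7 : C * (H * M * γ) * ‖y‖ ^ 2 ≤ C * M * (H + 1) * ‖y‖ ^ 2 := by
      have : H * γ ≤ H + 1 := by nlinarith
      calc (C : ℝ) * (H * M * γ) * ‖y‖ ^ 2 = C * M * (H * γ) * ‖y‖ ^ 2 := by ring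
        _ ≤ _ := by gcongr
    have h8 : C * g ≤ C * M * (L * (H + 1)) * ‖y‖ ^ 2 := by
      calc C * g ≤ C * (L * (H * M * ‖y‖ ^ 2)) := by gcongr
        _ ≤ C * (L * ((H + 1) * M * ‖y‖ ^ 2)) := by gcongr; linarith
        _ = _ := by ring
    nlinarith
  have hta : t * a ≤ C * M * (e / 3) * ‖y‖ ^ 2 := by
    calc t * a ≤ t * (C * M * ((L + 1) * (H + 1)) * ‖y‖ ^ 2) := by gcongr
      _ = _ := by simp only [ht]; field_simp
  have hnoise : (1 + 1 / t) * ∑ c : Fin C, ‖∑ m, conj (y m) * S.Z m c ω‖ ^ 2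
      ≤ C * M * (e / 3) * ‖y‖ ^ 2 := by
    calc _ ≤ (1 + 1 / t) * (δ * M * C * ‖y‖ ^ 2) := by gcongr
      _ = _ := by simp only [hδ]; field_simp
  have hAe : |a - C * g| ≤ C * M * (e / 3) * ‖y‖ ^ 2 := by
    refine hA.trans ?_
    calc (C : ℝ) * (H * M * γ) * ‖y‖ ^ 2 = C * M * (H * γ) * ‖y‖ ^ 2 := by ring
      _ ≤ _ := by gcongr
  set b := ∑ c : Fin C, ‖∑ l, S.X l c ω * ⟪y, S.channel M l ω⟫_ℂ +
    ∑ m, conj (y m) * S.Z m c ω‖ ^ 2 with hb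
  have hfin : |b - C * g| ≤ C * M * e * ‖y‖ ^ 2 := by
    have h9 := abs_sub_le b a (C * g)
    nlinarith
  have h10 : b / C / M - g / M = (b - C * g) / (C * M) := by field_simp
  rw [h10, abs_div, abs_of_pos (by positivity : (0 : ℝ) < C * M), div_le_iff₀ (by positivity)]
  linarith

end UplinkModel

namespace UplinkModel

variable {L P τ : ℕ} {Ω : Type*} [MeasurableSpace Ω] {μ : Measure Ω}

/-! ### Laws of large numbers for the symbols and for the noise -/

theorem ae_eventually_dataNoise_le [IsProbabilityMeasure μ] (S : UplinkModel L P τ μ) :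
    ∀ᵐ ω ∂μ, ∀ δ : ℝ, 0 < δ → ∀ᶠ q : ℕ × ℕ in atTop ×ˢ atTop, ∀ y : Fin q.1 → ℂ,
      ∑ c : Fin q.2, ‖∑ m, y m * S.Z m c ω‖ ^ 2 ≤ δ * q.1 * q.2 * ∑ m, ‖y m‖ ^ 2 := by
  refine ae_eventually_noise_le S.Z_measurable S.Z_law ?_ (integral_id_complexGaussian _)
    (memLp_id_complexGaussian _)
  rw [iIndepFun_iff_iIndep]
  exact S.indep.precomp (g := fun i : ℕ × ℕ => Source.dataNoise i.1 i.2)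
    fun i i' h => by simpa [Prod.ext_iff] using h

theorem memLp_symbol (S : UplinkModel L P τ μ) (l : Fin L) (c : ℕ) : MemLp (S.X l c) 2 μ := by
  have h1 : MemLp id 2 S.symbolLaw := by
    rw [memLp_two_iff_integrable_sq_norm aestronglyMeasurable_id]
    -- Were the squared modulus not integrable, its integral would take the default value 0,
    -- contradicting unit variance. So finiteness of the second moment is contained in `symbol_var`.
    by_contra h
    have h2 : ∫ z, ‖id z‖ ^ 2 ∂S.symbolLaw = 1 := S.symbol_var
    rw [integral_undef h] at h2
    exact zero_ne_one h2
  rw [← S.X_law l c] at h1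
  exact (memLp_map_measure_iff aestronglyMeasurable_id (S.X_measurable l c).aemeasurable).1 h1

theorem integral_symbol (S : UplinkModel L P τ μ) (l : Fin L) (c : ℕ) : ∫ ω, S.X l c ω ∂μ = 0 := by
  rw [← S.symbol_mean, ← S.X_law l c, integral_map (S.X_measurable l c).aemeasurable (by fun_prop)]

theorem integral_norm_sq_symbol (S : UplinkModel L P τ μ) (l : Fin L) (c : ℕ) :
    ∫ ω, ‖S.X l c ω‖ ^ 2 ∂μ = 1 := by
  rw [← S.symbol_var, ← S.X_law l c, integral_map (S.X_measurable l c).aemeasurable (by fun_prop)]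

theorem indepFun_symbol (S : UplinkModel L P τ μ) {l l' : Fin L} {c c' : ℕ}
    (h : (l, c) ≠ (l', c')) : IndepFun (S.X l c) (S.X l' c') μ :=
  S.indepFun_of_disjoint (A := {Source.symbol l c}) (B := {Source.symbol l' c'})
    (by simpa [Prod.ext_iff, eq_comm] using h)
    (S.measurable_symbol_source rfl) (S.measurable_symbol_source rfl)

/-- Only second moments of the symbols are assumed, so |x|² is merely integrable and the strong law
for i.i.d. integrable variables is needed here rather than the second-moment law. -/
theorem ae_tendsto_symbol_power (S : UplinkModel L P τ μ) (l : Fin L) :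
    ∀ᵐ ω ∂μ, Tendsto (fun C : ℕ => (∑ c ∈ Finset.range C, S.X l c ω * conj (S.X l c ω)) /
      (C : ℂ)) atTop (𝓝 1) := by
  have h := strong_law_ae_real (μ := μ) (fun c ω => ‖S.X l c ω‖ ^ 2)
    ((S.memLp_symbol l 0).integrable_norm_pow two_ne_zero)
    (fun c c' hc => (S.indepFun_symbol (l := l) (l' := l) (by simp [hc])).comp
      (φ := fun z : ℂ => ‖z‖ ^ 2) (ψ := fun z : ℂ => ‖z‖ ^ 2) (by fun_prop) (by fun_prop))
    (fun c => IdentDistrib.comp (u := fun z : ℂ => ‖z‖ ^ 2)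
      ⟨(S.X_measurable l c).aemeasurable, (S.X_measurable l 0).aemeasurable,
        by rw [S.X_law, S.X_law]⟩ (by fun_prop))
  filter_upwards [h] with ω hω
  rw [S.integral_norm_sq_symbol] at hω
  have h1 := (Complex.continuous_ofReal.tendsto _).comp hω
  rw [Complex.ofReal_one] at h1
  refine h1.congr fun C => ?_
  simp only [Function.comp_apply, Complex.mul_conj']
  push_cast
  rfl

/-- For different users the factors are independent, so the product is square integrable with second
moment 1, and the products at different times are uncorrelated. -/
theorem ae_tendsto_symbol_cross (S : UplinkModel L P τ μ) {l l' : Fin L} (hl : l ≠ l') :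
    ∀ᵐ ω ∂μ, Tendsto (fun C : ℕ => (∑ c ∈ Finset.range C, S.X l c ω * conj (S.X l' c ω)) /
      (C : ℂ)) atTop (𝓝 0) := by
  have hconj : Measurable fun z : ℂ => conj z := Complex.continuous_conj.measurable
  have hmeas : ∀ c, AEStronglyMeasurable (fun ω => S.X l c ω * conj (S.X l' c ω)) μ := fun c =>
    ((S.X_measurable l c).mul (hconj.comp (S.X_measurable l' c))).aestronglyMeasurable
  have hi : ∀ c, IndepFun (S.X l c) (S.X l' c) μ := fun c => S.indepFun_symbol (by simp [hl])
  have hnorm : ∀ c ω, ‖S.X l c ω * conj (S.X l' c ω)‖ ^ 2 = ‖S.X l c ω‖ ^ 2 * ‖S.X l' c ω‖ ^ 2 :=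
    fun c ω => by rw [norm_mul, RCLike.norm_conj, mul_pow]
  have hi2 : ∀ c, IndepFun (fun ω => ‖S.X l c ω‖ ^ 2) (fun ω => ‖S.X l' c ω‖ ^ 2) μ := fun c =>
    (hi c).comp (φ := fun z : ℂ => ‖z‖ ^ 2) (ψ := fun z : ℂ => ‖z‖ ^ 2) (by fun_prop) (by fun_prop)
  have hI : ∀ l c, Integrable (fun ω => ‖S.X l c ω‖ ^ 2) μ := fun l c =>
    (S.memLp_symbol l c).integrable_norm_pow two_ne_zero
  refine ae_tendsto_avg_of_uncorrelated (v := 1) (fun c => ?_) (fun c c' hc => ?_) fun c => ?_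
  · rw [memLp_two_iff_integrable_sq_norm (hmeas c)]
    simp only [hnorm]
    exact (hi2 c).integrable_mul (hI l c) (hI l' c)
  · have hm : ∀ c, Measurable[⨆ i ∈ ({Source.symbol l c, Source.symbol l' c} : Set (Source L P τ)),
        sourceSigma S.θ S.φ S.X S.N S.Z i] fun ω => S.X l c ω * conj (S.X l' c ω) := fun c =>
      (S.measurable_symbol_source (by simp)).mul
        (hconj.comp (S.measurable_symbol_source (by simp)))
    have h1 : IndepFun (fun ω => S.X l c ω * conj (S.X l' c ω))
        (fun ω => conj (S.X l c' ω * conj (S.X l' c' ω))) μ :=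
      S.indepFun_of_disjoint (by simp [hc.symm]) (hm c) (hconj.comp (hm c'))
    have h2 : IndepFun (S.X l c) (fun ω => conj (S.X l' c ω)) μ :=
      (hi c).comp measurable_id hconj
    rw [h1.integral_fun_mul_eq_mul_integral (hmeas c)
      (Complex.continuous_conj.comp_aestronglyMeasurable (hmeas c')),
      h2.integral_fun_mul_eq_mul_integral (S.X_measurable l c).aestronglyMeasurable
      (hconj.comp (S.X_measurable l' c)).aestronglyMeasurable, S.integral_symbol]
    simp
  · simp only [hnorm]
    rw [(hi2 c).integral_fun_mul_eq_mul_integral (hI l c).1 (hI l' c).1,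
      S.integral_norm_sq_symbol, S.integral_norm_sq_symbol, one_mul]

theorem ae_tendsto_symbol_gram (S : UplinkModel L P τ μ) :
    ∀ᵐ ω ∂μ, ∀ l l', Tendsto (fun C : ℕ =>
      (∑ c ∈ Finset.range C, S.X l c ω * conj (S.X l' c ω)) / (C : ℂ)) atTop
        (𝓝 (if l = l' then 1 else 0)) := by
  rw [ae_all_iff]; intro l
  rw [ae_all_iff]; intro l'
  split_ifs with h
  · subst h; exact S.ae_tendsto_symbol_power l
  · exact S.ae_tendsto_symbol_cross h

/-! ### The pilot noise -/

/-- The entry of the steering vectors at antenna `m`. -/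
def steeringEntry (S : UplinkModel L P τ μ) (m : ℕ) (x : ℝ) : ℂ :=
  Complex.exp (-Complex.I *
    ((2 * Real.pi * (m * S.spacing / S.wavelength) * Real.cos x : ℝ) : ℂ))

theorem steering_apply (S : UplinkModel L P τ μ) (M : ℕ) (x : ℝ) (m : Fin M) :
    S.steering M x m = S.steeringEntry m x := rfl

theorem norm_steeringEntry (S : UplinkModel L P τ μ) (m : ℕ) (x : ℝ) :
    ‖S.steeringEntry m x‖ = 1 :=
  S.norm_steering_apply (m + 1) x (Fin.last m)

theorem measurable_steeringEntry (S : UplinkModel L P τ μ) (m : ℕ) :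
    Measurable (S.steeringEntry m) := by
  unfold steeringEntry; fun_prop

theorem memLp_pilotNoise [IsProbabilityMeasure μ] (S : UplinkModel L P τ μ) (m : ℕ) (t : Fin τ) :
    MemLp (S.N m t) 2 μ := by
  have h := memLp_id_complexGaussian S.noiseVar
  rw [← S.N_law m t] at h
  exact ((memLp_map_measure_iff aestronglyMeasurable_id
    (S.N_measurable m t).aemeasurable).1 h).mono_exponent (by norm_num)

theorem integral_pilotNoise (S : UplinkModel L P τ μ) (m : ℕ) (t : Fin τ) :
    ∫ ω, S.N m t ω ∂μ = 0 := by
  rw [← integral_id_complexGaussian S.noiseVar, ← S.N_law m t,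
    integral_map (S.N_measurable m t).aemeasurable (by fun_prop)]

theorem indepFun_pilotNoise (S : UplinkModel L P τ μ) {m m' : ℕ} (t : Fin τ) (h : m ≠ m') :
    IndepFun (S.N m t) (S.N m' t) μ :=
  S.indepFun_of_disjoint (A := {Source.pilotNoise m t}) (B := {Source.pilotNoise m' t})
    (by simp [h]) (S.measurable_pilotNoise_source rfl) (S.measurable_pilotNoise_source rfl)

/-- The summands all share the random angle, but they are uncorrelated: the noise entries are
centred, mutually independent and independent of the angle. The weights have modulus 1, so the
second moments are those of the noise. -/
theorem ae_tendsto_steering_pilotNoise [IsProbabilityMeasure μ] (S : UplinkModel L P τ μ)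
    (l : Fin L) (p : Fin P) (t : Fin τ) :
    ∀ᵐ ω ∂μ, Tendsto (fun M : ℕ => (∑ m ∈ Finset.range M,
      conj (S.steeringEntry m (S.θ l p ω)) * S.N m t ω) / (M : ℂ)) atTop (𝓝 0) := by
  have hconj : Measurable fun z : ℂ => conj z := Complex.continuous_conj.measurable
  have hs : ∀ m, Measurable fun ω => conj (S.steeringEntry m (S.θ l p ω)) := fun m =>
    hconj.comp ((S.measurable_steeringEntry m).comp (S.θ_measurable l p))
  have hnorm : ∀ m ω, ‖conj (S.steeringEntry m (S.θ l p ω)) * S.N m t ω‖ = ‖S.N m t ω‖ :=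
    fun m ω => by rw [norm_mul, RCLike.norm_conj, norm_steeringEntry, one_mul]
  have hmem : ∀ m, MemLp (fun ω => conj (S.steeringEntry m (S.θ l p ω)) * S.N m t ω) 2 μ := fun m =>
    (S.memLp_pilotNoise m t).of_le ((hs m).mul (S.N_measurable m t)).aestronglyMeasurable
      (ae_of_all _ fun ω => (hnorm m ω).le)
  refine ae_tendsto_avg_of_uncorrelated (v := ∫ z, ‖z‖ ^ 2 ∂(complexGaussian S.noiseVar)) hmem
    (fun m m' hm => ?_) fun m => ?_
  · have h1 : IndepFun (fun ω => conj (S.steeringEntry m (S.θ l p ω)) *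
        S.steeringEntry m' (S.θ l p ω)) (fun ω => S.N m t ω * conj (S.N m' t ω)) μ := by
      refine S.indepFun_of_disjoint (A := {Source.angle l p})
        (B := {Source.pilotNoise m t, Source.pilotNoise m' t}) (by simp) ?_ ?_
      · exact ((hconj.comp (S.measurable_steeringEntry m)).mul (S.measurable_steeringEntry m')).comp
          (S.measurable_angle_source rfl)
      · exact (S.measurable_pilotNoise_source (by simp)).mul
          (hconj.comp (S.measurable_pilotNoise_source (by simp)))
    have h2 : IndepFun (S.N m t) (fun ω => conj (S.N m' t ω)) μ :=
      (S.indepFun_pilotNoise t hm).comp measurable_id hconj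
    have h3 : ∀ ω, conj (S.steeringEntry m (S.θ l p ω)) * S.N m t ω *
        conj (conj (S.steeringEntry m' (S.θ l p ω)) * S.N m' t ω)
        = (conj (S.steeringEntry m (S.θ l p ω)) * S.steeringEntry m' (S.θ l p ω)) *
          (S.N m t ω * conj (S.N m' t ω)) := fun ω => by
      rw [map_mul, Complex.conj_conj]; ring
    simp_rw [h3]
    rw [h1.integral_fun_mul_eq_mul_integral
      ((hs m).mul ((S.measurable_steeringEntry m').comp (S.θ_measurable l p))).aestronglyMeasurable
      ((S.N_measurable m t).mul (hconj.comp (S.N_measurable m' t))).aestronglyMeasurable,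
      h2.integral_fun_mul_eq_mul_integral (S.N_measurable m t).aestronglyMeasurable
      (hconj.comp (S.N_measurable m' t)).aestronglyMeasurable, S.integral_pilotNoise]
    simp
  · simp only [hnorm]
    rw [← S.N_law m t, integral_map (S.N_measurable m t).aemeasurable (by fun_prop)]

theorem ae_tendsto_pilotNoise_power [IsProbabilityMeasure μ] (S : UplinkModel L P τ μ)
    (t : Fin τ) : ∀ᵐ ω ∂μ, ∃ K : ℝ, Tendsto (fun M : ℕ =>
      (∑ m ∈ Finset.range M, ‖S.N m t ω‖ ^ 2) / (M : ℝ)) atTop (𝓝 K) := by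
  have h := strong_law_ae_real (μ := μ) (fun m ω => ‖S.N m t ω‖ ^ 2)
    ((S.memLp_pilotNoise 0 t).integrable_norm_pow two_ne_zero)
    (fun m m' hm => (S.indepFun_pilotNoise t hm).comp
      (φ := fun z : ℂ => ‖z‖ ^ 2) (ψ := fun z : ℂ => ‖z‖ ^ 2) (by fun_prop) (by fun_prop))
    (fun m => IdentDistrib.comp (u := fun z : ℂ => ‖z‖ ^ 2)
      ⟨(S.N_measurable m t).aemeasurable, (S.N_measurable 0 t).aemeasurable,
        by rw [S.N_law, S.N_law]⟩ (by fun_prop))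
  filter_upwards [h] with ω hω using ⟨_, hω⟩

/-- The pilot noise after correlation with the pilot sequence. -/
def pilotResidual (S : UplinkModel L P τ μ) (M : ℕ) (ω : Ω) : EuclideanSpace ℂ (Fin M) :=
  WithLp.toLp 2 fun m : Fin M => (1 / (τ : ℂ)) * ∑ t, S.N m t ω * conj (S.s t)

/-- Correlation with the shared pilot yields the sum of all channels, since sᵀs* = τ. This is pilot
contamination, and only the direction u can separate the users. -/
theorem saEstimate_eq (S : UplinkModel L P τ μ) (M : ℕ) (u : EuclideanSpace ℂ (Fin M)) (ω : Ω) :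
    S.saEstimate M u ω
      = (∑ l, ⟪u, S.channel M l ω⟫_ℂ + ⟪u, S.pilotResidual M ω⟫_ℂ) • u := by
  have hτ : (τ : ℂ) ≠ 0 := by exact_mod_cast S.pilot_pos.ne'
  have hs : ∑ t, S.s t * conj (S.s t) = (τ : ℂ) := S.s_power
  have h1 : ∀ n : Fin M, (1 / (τ : ℂ)) * (S.pilotSignal M ω *ᵥ star S.s) n
      = ∑ l, S.channel M l ω n + S.pilotResidual M ω n := by
    intro n
    have h2 : ∀ t, S.pilotSignal M ω n t * conj (S.s t)
        = ∑ l, S.channel M l ω n * (S.s t * conj (S.s t)) + S.N n t ω * conj (S.s t) := by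
      intro t
      simp only [pilotSignal, Matrix.add_apply, Matrix.sum_apply, Matrix.vecMulVec_apply,
        Matrix.of_apply, add_mul, Finset.sum_mul, mul_assoc]
    have h3 : (S.pilotSignal M ω *ᵥ star S.s) n = ∑ t, S.pilotSignal M ω n t * conj (S.s t) := rfl
    rw [h3]
    simp_rw [h2, Finset.sum_add_distrib]
    rw [Finset.sum_comm]
    simp_rw [← Finset.mul_sum, hs, ← Finset.sum_mul]
    rw [mul_add, pilotResidual]
    congr 1
    field_simp
  ext m
  rw [saEstimate]
  simp only [PiLp.smul_apply, Pi.smul_apply, smul_eq_mul, Matrix.mulVec, dotProduct,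
    Matrix.vecMulVec_apply, mul_assoc, ← Finset.mul_sum]
  rw [mul_left_comm, mul_comm]
  congr 1
  rw [← inner_sum, ← inner_add_right, inner_eq_sum, Finset.mul_sum]
  refine Finset.sum_congr rfl fun n _ => ?_
  have h3 := h1 n
  simp only [Matrix.mulVec, dotProduct] at h3
  rw [mul_left_comm, h3]
  simp [WithLp.ofLp_sum]

theorem ae_tendsto_inner_channel_pilotResidual [IsProbabilityMeasure μ] (S : UplinkModel L P τ μ)
    (l : Fin L) : ∀ᵐ ω ∂μ, Tendsto (fun M : ℕ =>
      ⟪S.channel M l ω, S.pilotResidual M ω⟫_ℂ / (M : ℂ)) atTop (𝓝 0) := by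
  have h : ∀ᵐ ω ∂μ, ∀ p t, Tendsto (fun M : ℕ => (∑ m ∈ Finset.range M,
      conj (S.steeringEntry m (S.θ l p ω)) * S.N m t ω) / (M : ℂ)) atTop (𝓝 0) := by
    simp only [ae_all_iff]
    exact fun p t => S.ae_tendsto_steering_pilotNoise l p t
  filter_upwards [h] with ω hω
  have h1 := (tendsto_finsetSum Finset.univ fun p _ => tendsto_finsetSum Finset.univ fun t _ =>
    (hω p t).const_mul (((S.β l / √(P : ℝ) : ℝ) : ℂ) *
      conj (Complex.exp (Complex.I * (S.φ l p ω : ℂ))) * (1 / (τ : ℂ)) * conj (S.s t)))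
  simp only [mul_zero, Finset.sum_const_zero] at h1
  refine h1.congr fun M => ?_
  have h2 : ⟪S.channel M l ω, S.pilotResidual M ω⟫_ℂ
      = ∑ p, ∑ t, ∑ m : Fin M, ((S.β l / √(P : ℝ) : ℝ) : ℂ) *
        conj (Complex.exp (Complex.I * (S.φ l p ω : ℂ))) * (1 / (τ : ℂ)) * conj (S.s t) *
        (conj (S.steeringEntry m (S.θ l p ω)) * S.N m t ω) := by
    rw [channel, inner_smul_left, Complex.conj_ofReal, sum_inner, Finset.mul_sum]
    refine Finset.sum_congr rfl fun p _ => ?_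
    rw [inner_smul_left, inner_eq_sum, Finset.mul_sum, Finset.mul_sum, Finset.sum_comm]
    refine Finset.sum_congr rfl fun m _ => ?_
    simp only [pilotResidual, steering_apply, Finset.mul_sum]
    exact Finset.sum_congr rfl fun t _ => by ring
  rw [h2, Finset.sum_div]
  refine Finset.sum_congr rfl fun p _ => ?_
  rw [Finset.sum_div]
  refine Finset.sum_congr rfl fun t _ => ?_
  rw [← Finset.mul_sum, Finset.sum_range, mul_div_assoc]

theorem ae_eventually_norm_pilotResidual_le [IsProbabilityMeasure μ] (S : UplinkModel L P τ μ) :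
    ∀ᵐ ω ∂μ, ∃ K : ℝ, ∀ᶠ M : ℕ in atTop, ‖S.pilotResidual M ω‖ / √M ≤ K := by
  have h : ∀ᵐ ω ∂μ, ∀ t, ∃ K : ℝ, Tendsto (fun M : ℕ =>
      (∑ m ∈ Finset.range M, ‖S.N m t ω‖ ^ 2) / (M : ℝ)) atTop (𝓝 K) :=
    ae_all_iff.2 fun t => S.ae_tendsto_pilotNoise_power t
  filter_upwards [h] with ω hω
  choose K hK using hω
  have h1 : Tendsto (fun M : ℕ => ∑ t, √((∑ m ∈ Finset.range M, ‖S.N m t ω‖ ^ 2) / (M : ℝ)) *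
      ‖S.s t‖) atTop (𝓝 (∑ t, √(K t) * ‖S.s t‖)) :=
    tendsto_finsetSum _ fun t _ => ((Real.continuous_sqrt.tendsto _).comp (hK t)).mul_const _
  refine ⟨∑ t, √(K t) * ‖S.s t‖ + 1, ?_⟩
  filter_upwards [h1.eventually (gt_mem_nhds (lt_add_one _))] with M hM
  refine le_trans ?_ hM.le
  have hτ : (1 : ℝ) ≤ τ := by exact_mod_cast S.pilot_pos
  have h2 : S.pilotResidual M ω = (1 / (τ : ℂ)) • ∑ t, conj (S.s t) •
      (WithLp.toLp 2 fun m : Fin M => S.N m t ω : EuclideanSpace ℂ (Fin M)) := by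
    ext m
    simp [pilotResidual, WithLp.ofLp_sum, mul_comm]
  have h3 : ‖S.pilotResidual M ω‖ ≤ ∑ t, ‖S.s t‖ *
      ‖(WithLp.toLp 2 fun m : Fin M => S.N m t ω : EuclideanSpace ℂ (Fin M))‖ := by
    rw [h2, norm_smul]
    refine (mul_le_of_le_one_left (norm_nonneg _) ?_).trans
      ((norm_sum_le _ _).trans (Finset.sum_le_sum fun t _ => ?_))
    · rw [norm_div, norm_one, Complex.norm_natCast]
      exact div_le_one_of_le₀ hτ (by positivity)
    · rw [norm_smul, RCLike.norm_conj]
  calc ‖S.pilotResidual M ω‖ / √M ≤ (∑ t, ‖S.s t‖ *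
      ‖(WithLp.toLp 2 fun m : Fin M => S.N m t ω : EuclideanSpace ℂ (Fin M))‖) / √M := by gcongr
    _ = _ := by
      rw [Finset.sum_div]
      refine Finset.sum_congr rfl fun t _ => ?_
      rw [EuclideanSpace.norm_eq, Real.sqrt_div (Finset.sum_nonneg fun _ _ => by positivity),
        Finset.sum_range]
      ring

end UplinkModel

namespace UplinkModel

variable {L P τ : ℕ} {Ω : Type*} [MeasurableSpace Ω] {μ : Measure Ω}

/-! ### Convergence of the estimator -/

/-- The support and the complement of its closure are covered by the two single-vector limits. What
remains of the closure is null, and the angle laws have densities, so no angle falls there. -/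
theorem ae_tendsto_norm_project_sub_channelIn [IsProbabilityMeasure μ] (S : UplinkModel L P τ μ)
    (j : Fin L) (hΦ : volume (closure (S.angularSupport j) \ S.angularSupport j) = 0) {ε : ℕ → ℝ}
    (hε : Tendsto ε atTop (𝓝 0)) (hεM : Tendsto (fun M : ℕ => (M : ℝ) * ε M) atTop atTop) :
    ∀ᵐ ω ∂μ, ∀ l, Tendsto (fun M : ℕ => ‖S.project M j (ε M) (S.channel M l ω) -
      S.channelIn (S.angularSupport j) M l ω‖ / √M) atTop (𝓝 0) := by
  have hcl : ∀ᵐ x ∂(volume : Measure ℝ), x ∉ closure (S.angularSupport j) \ S.angularSupport j :=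
    measure_eq_zero_iff_ae_notMem.1 hΦ
  filter_upwards [S.ae_angles_of_ae_volume (S.ae_tendsto_residual j hε hεM),
    S.ae_angles_of_ae_volume hcl, S.ae_angle_mem_Ioo] with ω h1 h2 h3 l
  refine S.tendsto_norm_project_sub_channelIn _ j ε l (fun p hp => h1 l p hp) fun p hp => ?_
  exact S.tendsto_project_of_notMem_closure j hεM (h3 l p) fun h => h2 l p ⟨h, hp⟩

theorem tendsto_norm_channelIn (S : UplinkModel L P τ μ) {ω : Ω}
    (hI : ∀ l p, S.θ l p ω ∈ Set.Ioo 0 Real.pi)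
    (hne : ∀ l p l' p', (l, p) ≠ (l', p') → S.θ l p ω ≠ S.θ l' p' ω) (Φ : Set ℝ) (l : Fin L) :
    Tendsto (fun M : ℕ => ‖S.channelIn Φ M l ω‖ / √M) atTop (𝓝 (√(S.powerIn Φ l ω))) := by
  have h1 := (S.tendsto_gram_channelIn hI hne Φ l l).norm
  simp only [if_true, Complex.norm_real, Real.norm_of_nonneg (S.powerIn_nonneg Φ l ω)] at h1
  refine ((Real.continuous_sqrt.tendsto _).comp h1).congr fun M => ?_
  simp only [Function.comp_apply]
  rw [norm_div, inner_self_eq_norm_sq_to_K, Complex.norm_natCast,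
    Real.sqrt_div' _ (Nat.cast_nonneg M), norm_pow]
  simp

theorem inner_signalPart (S : UplinkModel L P τ μ) (j : Fin L) (ε : ℕ → ℝ) (ω : Ω) (l : Fin L)
    (M : ℕ) (x : EuclideanSpace ℂ (Fin M)) :
    ⟪x, S.signalPart j ε ω l M⟫_ℂ
      = (((√(M : ℝ))⁻¹ : ℝ) : ℂ) * ⟪S.project M j (ε M) x, S.channel M l ω⟫_ℂ := by
  rw [signalPart, inner_smul_right, inner_project_left]

/-- The quadratic form of the sample covariance, normalized by the number of antennas. -/
def sampleForm (S : UplinkModel L P τ μ) (j : Fin L) (ε : ℕ → ℝ) (ω : Ω) (q : ℕ × ℕ)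
    (x : EuclideanSpace ℂ (Fin q.1)) : ℝ :=
  (∑ c : Fin q.2, ‖⟪S.project q.1 j (ε q.1) x, S.dataVector q.1 ω c⟫_ℂ‖ ^ 2) / q.2 / q.1

theorem eventually_abs_sampleForm_sub_le (S : UplinkModel L P τ μ) (j : Fin L) (ε : ℕ → ℝ) {ω : Ω}
    (hX : ∀ l l', Tendsto (fun C : ℕ => (∑ c ∈ Finset.range C, S.X l c ω * conj (S.X l' c ω)) /
      (C : ℂ)) atTop (𝓝 (if l = l' then 1 else 0)))
    (hZ : ∀ δ : ℝ, 0 < δ → ∀ᶠ q : ℕ × ℕ in atTop ×ˢ atTop, ∀ y : Fin q.1 → ℂ,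
      ∑ c : Fin q.2, ‖∑ m, y m * S.Z m c ω‖ ^ 2 ≤ δ * q.1 * q.2 * ∑ m, ‖y m‖ ^ 2)
    {e : ℝ} (he : 0 < e) :
    ∀ᶠ q : ℕ × ℕ in atTop ×ˢ atTop, ∀ x, |S.sampleForm j ε ω q x -
      ∑ l, ‖⟪S.signalPart j ε ω l q.1, x⟫_ℂ‖ ^ 2| ≤ e * ‖x‖ ^ 2 := by
  filter_upwards [S.eventually_abs_data_form_sub_le hX hZ he] with q h x
  have h1 : ∑ l, ‖⟪S.signalPart j ε ω l q.1, x⟫_ℂ‖ ^ 2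
      = (∑ l, ‖⟪S.project q.1 j (ε q.1) x, S.channel q.1 l ω⟫_ℂ‖ ^ 2) / q.1 := by
    rw [Finset.sum_div]
    refine Finset.sum_congr rfl fun l _ => ?_
    rw [norm_inner_symm, inner_signalPart, norm_mul, Complex.norm_real, mul_pow,
      Real.norm_of_nonneg (by positivity), inv_pow, Real.sq_sqrt (Nat.cast_nonneg _),
      div_eq_inv_mul]
  rw [h1, sampleForm]
  refine (h _).trans ?_
  gcongr
  exact S.norm_project_le _ _ _ x

theorem sampleForm_le_of_isDominantEigenvector (S : UplinkModel L P τ μ) (j : Fin L) (ε : ℕ → ℝ)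
    (ω : Ω) (q : ℕ × ℕ) {u : EuclideanSpace ℂ (Fin q.1)}
    (hu : IsDominantEigenvector (S.sampleCov j (ε q.1) q.1 q.2 ω) u)
    (x : EuclideanSpace ℂ (Fin q.1)) :
    S.sampleForm j ε ω q x ≤ S.sampleForm j ε ω q u * ‖x‖ ^ 2 := by
  have h := hu.re_inner_mulVec_le (S.sampleCov_isHermitian j _ _ _ ω) x
  rw [inner_sampleCov, inner_sampleCov, Complex.ofReal_re, Complex.ofReal_re] at h
  rw [sampleForm, sampleForm, div_mul_eq_mul_div]
  gcongr

/-- Positivity of the form rules out the eigenvalue 0, the only one whose eigenvectors may leave the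
signal space. -/
theorem project_eq_self_of_isDominantEigenvector (S : UplinkModel L P τ μ) (j : Fin L)
    (ε : ℕ → ℝ) (ω : Ω) (q : ℕ × ℕ) {u : EuclideanSpace ℂ (Fin q.1)}
    (hu : IsDominantEigenvector (S.sampleCov j (ε q.1) q.1 q.2 ω) u)
    (hpos : 0 < S.sampleForm j ε ω q u) : S.project q.1 j (ε q.1) u = u := by
  obtain ⟨hu1, r, hr, -⟩ := hu
  have h1 := S.inner_sampleCov j (ε q.1) q.1 q.2 ω u
  have h2 := S.project_sampleCov_mulVec j (ε q.1) q.1 q.2 ω u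
  rw [hr, WithLp.toLp_smul, WithLp.toLp_ofLp] at h1 h2
  rw [inner_smul_right, inner_self_eq_norm_sq_to_K, hu1] at h1
  have hr0 : (r : ℂ) ≠ 0 := by
    intro h0
    rw [h0, zero_mul] at h1
    have h3 := Complex.ofReal_eq_zero.1 h1.symm
    rw [sampleForm, h3, zero_div] at hpos
    exact lt_irrefl _ hpos
  rw [map_smul] at h2
  exact smul_right_injective _ hr0 h2

/-- Testing with the desired signal part v gives a form of at least ‖v‖⁴ − (d/4)‖v‖², which is
positive once ‖v‖² > d/2; the maximal value is then positive too. -/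
theorem eventually_sampleForm_pos (S : UplinkModel L P τ μ) (j : Fin L) (ε : ℕ → ℝ) {ω : Ω}
    {d : ℝ} (hd : 0 < d) (u : ∀ q : ℕ × ℕ, EuclideanSpace ℂ (Fin q.1))
    (hN : Tendsto (fun q : ℕ × ℕ => ‖S.signalPart j ε ω j q.1‖) (atTop ×ˢ atTop) (𝓝 (√d)))
    (hQ : ∀ᶠ q : ℕ × ℕ in atTop ×ˢ atTop, ∀ x, |S.sampleForm j ε ω q x -
      ∑ l, ‖⟪S.signalPart j ε ω l q.1, x⟫_ℂ‖ ^ 2| ≤ d / 4 * ‖x‖ ^ 2)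
    (hmax : ∀ᶠ q in atTop ×ˢ atTop, ∀ x,
      S.sampleForm j ε ω q x ≤ S.sampleForm j ε ω q (u q) * ‖x‖ ^ 2) :
    ∀ᶠ q in atTop ×ˢ atTop, 0 < S.sampleForm j ε ω q (u q) := by
  have hN2 := hN.pow 2
  rw [Real.sq_sqrt hd.le] at hN2
  filter_upwards [hQ, hmax, hN2.eventually (lt_mem_nhds (show d / 2 < d by linarith))] with q h1 h2 h3
  set v := S.signalPart j ε ω j q.1 with hv
  have h4 := (abs_le.1 (h1 v)).1
  have h5 : ‖v‖ ^ 2 * ‖v‖ ^ 2 ≤ ∑ l, ‖⟪S.signalPart j ε ω l q.1, v⟫_ℂ‖ ^ 2 := by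
    have h6 : ‖v‖ ^ 2 * ‖v‖ ^ 2 = ‖⟪S.signalPart j ε ω j q.1, v⟫_ℂ‖ ^ 2 := by
      rw [← hv, inner_self_eq_norm_sq_to_K]; simp; ring
    rw [h6]
    exact Finset.single_le_sum (f := fun l => ‖⟪S.signalPart j ε ω l q.1, v⟫_ℂ‖ ^ 2)
      (fun _ _ => by positivity) (Finset.mem_univ j)
  have h7 := h2 v
  have hpos : 0 < ‖v‖ ^ 2 := by linarith
  by_contra hneg
  push Not at hneg
  nlinarith

/-- The direction u is replaced by the channel itself: α u is close to v, where α = ⟨u, v⟩ stays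
away from 0, and v is close to h_j/√M. Both replacement errors meet a noise vector of norm O(√M),
and ⟨h_j, n⟩ is o(M). -/
theorem tendsto_inner_pilotResidual (S : UplinkModel L P τ μ) (j : Fin L) (ε : ℕ → ℝ) {ω : Ω}
    {d K : ℝ} (hd : 0 < d) (u : ∀ q : ℕ × ℕ, EuclideanSpace ℂ (Fin q.1))
    (hu : ∀ᶠ q in atTop ×ˢ atTop, ‖u q‖ = 1)
    (hN : Tendsto (fun q : ℕ × ℕ => ‖S.signalPart j ε ω j q.1‖) (atTop ×ˢ atTop) (𝓝 (√d)))
    (hv : Tendsto (fun q : ℕ × ℕ => ‖S.signalPart j ε ω j q.1 -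
      ⟪u q, S.signalPart j ε ω j q.1⟫_ℂ • u q‖) (atTop ×ˢ atTop) (𝓝 0))
    (hc : Tendsto (fun M : ℕ => ‖S.signalPart j ε ω j M -
      (((√(M : ℝ))⁻¹ : ℝ) : ℂ) • S.channel M j ω‖) atTop (𝓝 0))
    (hn : Tendsto (fun M : ℕ => ⟪S.channel M j ω, S.pilotResidual M ω⟫_ℂ / (M : ℂ)) atTop (𝓝 0))
    (hK : ∀ᶠ M : ℕ in atTop, ‖S.pilotResidual M ω‖ / √M ≤ K) :
    Tendsto (fun q : ℕ × ℕ => ‖⟪u q, S.pilotResidual q.1 ω⟫_ℂ‖ / √q.1) (atTop ×ˢ atTop) (𝓝 0) := by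
  have hc' := hc.comp (tendsto_fst (f := (atTop : Filter ℕ)) (g := (atTop : Filter ℕ)))
  have hn' := (tendsto_zero_iff_norm_tendsto_zero.1 hn).comp
    (tendsto_fst (f := (atTop : Filter ℕ)) (g := (atTop : Filter ℕ)))
  have hlim := (((hv.add hc').mul_const K).add hn').const_mul (2 / √d)
  simp only [Function.comp_apply, add_zero, zero_mul, mul_zero] at hlim
  have hd' : 0 < √d := Real.sqrt_pos.2 hd
  refine squeeze_zero' (Eventually.of_forall fun _ => by positivity) ?_ hlim
  have hinner : ∀ᶠ q : ℕ × ℕ in atTop ×ˢ atTop, √d / 2 < ‖⟪u q, S.signalPart j ε ω j q.1⟫_ℂ‖ := by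
    have h1 := hN.sub hv
    rw [sub_zero] at h1
    filter_upwards [h1.eventually (lt_mem_nhds (show √d / 2 < √d by linarith)), hu] with q h2 h3
    have h4 := norm_sub_norm_le (S.signalPart j ε ω j q.1)
      (⟪u q, S.signalPart j ε ω j q.1⟫_ℂ • u q)
    rw [norm_smul, h3, mul_one] at h4
    linarith
  filter_upwards [hinner, hK.prod_inl (atTop : Filter ℕ)] with q h1 h2
  set v := S.signalPart j ε ω j q.1 with hvdef
  set n := S.pilotResidual q.1 ω with hndef
  set α := ⟪u q, v⟫_ℂ with hα
  set h := S.channel q.1 j ω with hh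
  set σ := √(q.1 : ℝ) with hσ
  have hσ0 : 0 ≤ σ := Real.sqrt_nonneg _
  have e1 : conj α * ⟪u q, n⟫_ℂ = ⟪v - ((σ⁻¹ : ℝ) : ℂ) • h, n⟫_ℂ +
      ((σ⁻¹ : ℝ) : ℂ) * ⟪h, n⟫_ℂ - ⟪v - α • u q, n⟫_ℂ := by
    rw [inner_sub_left, inner_sub_left, inner_smul_left, inner_smul_left, Complex.conj_ofReal]
    ring
  have e2 : ‖α‖ * ‖⟪u q, n⟫_ℂ‖ ≤ (‖v - α • u q‖ + ‖v - ((σ⁻¹ : ℝ) : ℂ) • h‖) * ‖n‖ +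
      σ⁻¹ * ‖⟪h, n⟫_ℂ‖ := by
    have h3 : ‖α‖ * ‖⟪u q, n⟫_ℂ‖ = ‖conj α * ⟪u q, n⟫_ℂ‖ := by rw [norm_mul, RCLike.norm_conj]
    rw [h3, e1]
    refine (norm_sub_le _ _).trans ?_
    have h4 := norm_add_le ⟪v - ((σ⁻¹ : ℝ) : ℂ) • h, n⟫_ℂ (((σ⁻¹ : ℝ) : ℂ) * ⟪h, n⟫_ℂ)
    rw [norm_mul, Complex.norm_real, Real.norm_of_nonneg (inv_nonneg.2 hσ0)] at h4
    have h5 := norm_inner_le_norm (𝕜 := ℂ) (v - ((σ⁻¹ : ℝ) : ℂ) • h) n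
    have h6 := norm_inner_le_norm (𝕜 := ℂ) (v - α • u q) n
    linarith
  have e3 : σ⁻¹ * ‖⟪h, n⟫_ℂ‖ / σ = ‖⟪h, n⟫_ℂ / (q.1 : ℂ)‖ := by
    rw [norm_div, Complex.norm_natCast, ← Real.mul_self_sqrt (Nat.cast_nonneg q.1 : (0 : ℝ) ≤ q.1),
      ← hσ, div_mul_eq_div_div, div_eq_inv_mul, div_eq_inv_mul, div_eq_inv_mul]
  have e4 : √d / 2 * (‖⟪u q, n⟫_ℂ‖ / σ) ≤
      (‖v - α • u q‖ + ‖v - ((σ⁻¹ : ℝ) : ℂ) • h‖) * K + ‖⟪h, n⟫_ℂ / (q.1 : ℂ)‖ := by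
    calc √d / 2 * (‖⟪u q, n⟫_ℂ‖ / σ) ≤ ‖α‖ * (‖⟪u q, n⟫_ℂ‖ / σ) := by gcongr
      _ = ‖α‖ * ‖⟪u q, n⟫_ℂ‖ / σ := by ring
      _ ≤ ((‖v - α • u q‖ + ‖v - ((σ⁻¹ : ℝ) : ℂ) • h‖) * ‖n‖ + σ⁻¹ * ‖⟪h, n⟫_ℂ‖) / σ := by gcongr
      _ = (‖v - α • u q‖ + ‖v - ((σ⁻¹ : ℝ) : ℂ) • h‖) * (‖n‖ / σ) +
          ‖⟪h, n⟫_ℂ / (q.1 : ℂ)‖ := by rw [← e3]; ring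
      _ ≤ _ := by gcongr
  calc ‖⟪u q, n⟫_ℂ‖ / σ = 2 / √d * (√d / 2 * (‖⟪u q, n⟫_ℂ‖ / σ)) := by field_simp
    _ ≤ _ := by gcongr

/-- Because u lies in the signal space, ⟨u, h_l⟩ only sees the projected channel. An exact
decomposition then isolates four errors: leakage from other cells, misalignment of u with v_j, the
part of h_j lost in the projection, and pilot noise. -/
theorem norm_saEstimate_sub_le (S : UplinkModel L P τ μ) (j : Fin L) (ε : ℕ → ℝ) (ω : Ω) {M : ℕ}
    {u : EuclideanSpace ℂ (Fin M)} (hu : ‖u‖ = 1) (hproj : S.project M j (ε M) u = u) :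
    ‖S.saEstimate M u ω - S.channel M j ω‖ / √M
      ≤ ∑ l ∈ Finset.univ.erase j, ‖⟪u, S.signalPart j ε ω l M⟫_ℂ‖ +
        ‖S.signalPart j ε ω j M - ⟪u, S.signalPart j ε ω j M⟫_ℂ • u‖ +
        ‖S.signalPart j ε ω j M - (((√(M : ℝ))⁻¹ : ℝ) : ℂ) • S.channel M j ω‖ +
        ‖⟪u, S.pilotResidual M ω⟫_ℂ‖ / √M := by
  set σ : ℂ := (((√(M : ℝ))⁻¹ : ℝ) : ℂ) with hσ
  have h1 : ∀ l, σ * ⟪u, S.channel M l ω⟫_ℂ = ⟪u, S.signalPart j ε ω l M⟫_ℂ := fun l => by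
    rw [inner_signalPart, hproj]
  have h2 : σ • (S.saEstimate M u ω - S.channel M j ω)
      = (∑ l ∈ Finset.univ.erase j, ⟪u, S.signalPart j ε ω l M⟫_ℂ) • u -
        (S.signalPart j ε ω j M - ⟪u, S.signalPart j ε ω j M⟫_ℂ • u) +
        (S.signalPart j ε ω j M - σ • S.channel M j ω) +
        (σ * ⟪u, S.pilotResidual M ω⟫_ℂ) • u := by
    rw [saEstimate_eq, smul_sub, smul_smul, mul_add, Finset.mul_sum]
    simp_rw [h1]
    rw [← Finset.sum_erase_add _ _ (Finset.mem_univ j)]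
    module
  rw [← norm_inv_sqrt_smul, ← hσ, h2]
  refine (norm_add_le _ _).trans (add_le_add ((norm_add_le _ _).trans (add_le_add
    ((norm_sub_le _ _).trans (add_le_add ?_ le_rfl)) le_rfl)) ?_)
  · rw [norm_smul, hu, mul_one]
    exact norm_sum_le _ _
  · rw [norm_smul, hu, mul_one, norm_mul, hσ, Complex.norm_real,
      Real.norm_of_nonneg (by positivity), div_eq_inv_mul]

end UplinkModel

/-! ### Assembly of the limits -/

namespace UplinkModel

variable {L P τ : ℕ} {Ω : Type*} [MeasurableSpace Ω] {μ : Measure Ω}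

theorem tendsto_norm_channel (S : UplinkModel L P τ μ) {ω : Ω}
    (hI : ∀ l p, S.θ l p ω ∈ Set.Ioo 0 Real.pi)
    (hne : ∀ l p l' p', (l, p) ≠ (l', p') → S.θ l p ω ≠ S.θ l' p' ω) (l : Fin L) :
    Tendsto (fun M : ℕ => ‖S.channel M l ω‖ / √M) atTop (𝓝 (S.β l)) := by
  have h := S.tendsto_norm_channelIn hI hne Set.univ l
  rw [S.powerIn_of_forall_mem _ l fun _ => Set.mem_univ _, Real.sqrt_sq (S.β_pos l).le] at h
  simpa only [S.channelIn_eq_channel Set.univ _ l fun _ => Set.mem_univ _] using h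

theorem eventually_channel_ne_zero (S : UplinkModel L P τ μ) {ω : Ω}
    (hI : ∀ l p, S.θ l p ω ∈ Set.Ioo 0 Real.pi)
    (hne : ∀ l p l' p', (l, p) ≠ (l', p') → S.θ l p ω ≠ S.θ l' p' ω) (l : Fin L) :
    ∀ᶠ M : ℕ in atTop, S.channel M l ω ≠ 0 := by
  filter_upwards [(S.tendsto_norm_channel hI hne l).eventually (lt_mem_nhds (S.β_pos l))]
    with M hM h
  rw [h, norm_zero, zero_div] at hM
  exact lt_irrefl _ hM

/-- After division by √M both sides converge, and the factor c < 1 keeps the inequality strict in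
the limit. This supplies the spectral gap. -/
theorem powerIn_lt_of_eventually_le (S : UplinkModel L P τ μ) {ω : Ω}
    (hI : ∀ l p, S.θ l p ω ∈ Set.Ioo 0 Real.pi)
    (hne : ∀ l p l' p', (l, p) ≠ (l', p') → S.θ l p ω ≠ S.θ l' p' ω) (Φ : Set ℝ) {j l : Fin L}
    {c : ℝ} (hc : c < 1)
    (h : ∀ᶠ M : ℕ in atTop, ‖S.channelIn Φ M l ω‖ ≤ c * ‖S.channel M j ω‖) :
    S.powerIn Φ l ω < S.β j ^ 2 := by
  have hle : √(S.powerIn Φ l ω) ≤ c * S.β j := by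
    refine le_of_tendsto_of_tendsto (S.tendsto_norm_channelIn hI hne Φ l)
      ((S.tendsto_norm_channel hI hne j).const_mul c) ?_
    filter_upwards [h] with M hM
    rw [← mul_div_assoc]
    gcongr
  refine (Real.sqrt_lt' (S.β_pos j)).1 (hle.trans_lt ?_)
  exact mul_lt_of_lt_one_left (S.β_pos j) hc

theorem tendsto_saEstimate_error (S : UplinkModel L P τ μ) (j : Fin L) {ε : ℕ → ℝ} {ω : Ω}
    (hI : ∀ l p, S.θ l p ω ∈ Set.Ioo 0 Real.pi)
    (hne : ∀ l p l' p', (l, p) ≠ (l', p') → S.θ l p ω ≠ S.θ l' p' ω) (Φ : Set ℝ)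
    (hmem : ∀ p, S.θ j p ω ∈ Φ)
    (hproj : ∀ l, Tendsto (fun M : ℕ => ‖S.project M j (ε M) (S.channel M l ω) -
      S.channelIn Φ M l ω‖ / √M) atTop (𝓝 0))
    (hX : ∀ l l', Tendsto (fun C : ℕ => (∑ c ∈ Finset.range C, S.X l c ω * conj (S.X l' c ω)) /
      (C : ℂ)) atTop (𝓝 (if l = l' then 1 else 0)))
    (hZ : ∀ δ : ℝ, 0 < δ → ∀ᶠ q : ℕ × ℕ in atTop ×ˢ atTop, ∀ y : Fin q.1 → ℂ,
      ∑ c : Fin q.2, ‖∑ m, y m * S.Z m c ω‖ ^ 2 ≤ δ * q.1 * q.2 * ∑ m, ‖y m‖ ^ 2)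
    (hn : Tendsto (fun M : ℕ => ⟪S.channel M j ω, S.pilotResidual M ω⟫_ℂ / (M : ℂ)) atTop (𝓝 0))
    {K : ℝ} (hK : ∀ᶠ M : ℕ in atTop, ‖S.pilotResidual M ω‖ / √M ≤ K)
    (hd : ∀ l, l ≠ j → S.powerIn Φ l ω < S.β j ^ 2)
    (u : ∀ q : ℕ × ℕ, EuclideanSpace ℂ (Fin q.1))
    (hu : ∀ᶠ q : ℕ × ℕ in atTop ×ˢ atTop,
      IsDominantEigenvector (S.sampleCov j (ε q.1) q.1 q.2 ω) (u q)) :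
    Tendsto (fun q : ℕ × ℕ => ‖S.saEstimate q.1 (u q) ω - S.channel q.1 j ω‖ / √q.1)
      (atTop ×ˢ atTop) (𝓝 0) := by
  have hfst := tendsto_fst (f := (atTop : Filter ℕ)) (g := (atTop : Filter ℕ))
  have hβ : 0 < S.β j ^ 2 := pow_pos (S.β_pos j) 2
  have hpj : S.powerIn Φ j ω = S.β j ^ 2 := S.powerIn_of_forall_mem Φ j hmem
  have hu1 : ∀ᶠ q in atTop ×ˢ atTop, ‖u q‖ = 1 := hu.mono fun q h => h.1
  have hQ : ∀ e : ℝ, 0 < e → _ := fun e he => S.eventually_abs_sampleForm_sub_le j ε hX hZ he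
  have hmax : ∀ᶠ q in atTop ×ˢ atTop, ∀ x,
      S.sampleForm j ε ω q x ≤ S.sampleForm j ε ω q (u q) * ‖x‖ ^ 2 :=
    hu.mono fun q h => S.sampleForm_le_of_isDominantEigenvector j ε ω q h
  have hc : Tendsto (fun M : ℕ => ‖S.signalPart j ε ω j M -
      (((√(M : ℝ))⁻¹ : ℝ) : ℂ) • S.channel M j ω‖) atTop (𝓝 0) := by
    simpa only [S.channelIn_eq_channel Φ _ j hmem]
      using S.tendsto_norm_signalPart_sub Φ j ε j (hproj j)
  have hG : ∀ l l', Tendsto (fun q : ℕ × ℕ =>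
      ⟪S.signalPart j ε ω l q.1, S.signalPart j ε ω l' q.1⟫_ℂ) (atTop ×ˢ atTop)
      (𝓝 (if l = l' then (S.powerIn Φ l ω : ℂ) else 0)) := fun l l' =>
    (S.tendsto_gram_signalPart Φ j ε hI hne hproj l l').comp hfst
  have hN : Tendsto (fun q : ℕ × ℕ => ‖S.signalPart j ε ω j q.1‖) (atTop ×ˢ atTop)
      (𝓝 √(S.β j ^ 2)) := by
    have h1 := (hG j j).norm
    simp only [if_true, Complex.norm_real, hpj, Real.norm_of_nonneg hβ.le] at h1
    refine ((Real.continuous_sqrt.tendsto _).comp h1).congr fun q => ?_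
    rw [Function.comp_apply, inner_self_eq_norm_sq_to_K, norm_pow]
    simp
  obtain ⟨hv, hcross⟩ := tendsto_dominant_direction
    (v := fun l (q : ℕ × ℕ) => S.signalPart j ε ω l q.1) (u := u)
    (Q := fun q => S.sampleForm j ε ω q) (d := fun l => S.powerIn Φ l ω) (j := j)
    hu1 hG (by rwa [hpj]) (fun l hl => by rw [hpj]; exact hd l hl)
    (fun l => S.powerIn_nonneg Φ l ω) hQ hmax
  have hpos := S.eventually_sampleForm_pos j ε hβ u hN (hQ _ (by linarith)) hmax
  have hres := S.tendsto_inner_pilotResidual j ε hβ u hu1 hN hv hc hn hK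
  have hsum := tendsto_finsetSum (Finset.univ.erase j) fun l hl =>
    (hcross l (Finset.ne_of_mem_erase hl)).norm
  have hlim := ((hsum.add hv).add (hc.comp hfst)).add hres
  simp only [norm_zero, Finset.sum_const_zero, add_zero] at hlim
  refine squeeze_zero' (Eventually.of_forall fun _ => by positivity) ?_ hlim
  filter_upwards [hu, hpos] with q h1 h2
  exact S.norm_saEstimate_sub_le j ε ω h1.1
    (S.project_eq_self_of_isDominantEigenvector j ε ω q h1 h2)

end UplinkModel

end

theorem theorem3 {L P τ : ℕ} {Ω : Type*} [MeasurableSpace Ω] (μ : Measure Ω)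
    [IsProbabilityMeasure μ] (S : UplinkModel L P τ μ) (j : Fin L)
    (hΦ : volume (closure (S.angularSupport j) \ S.angularSupport j) = 0)
    (ε : ℕ → ℝ) (hε : Tendsto ε atTop (𝓝 0))
    (hεM : Tendsto (fun M : ℕ => (M : ℝ) * ε M) atTop atTop)
    (hbound : ∃ ζ : ℝ, ∀ M : ℕ, ∀ l : Fin L, l ≠ j →
      ‖Matrix.toEuclideanCLM (𝕜 := ℂ)
        (S.covSqrt M j * S.signalProj M j (ε M) * S.covSqrt M l)‖ ≤ ζ) :
    ∀ᵐ ω ∂μ,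
      (∀ l : Fin L, l ≠ j → ∃ c : ℝ, c < 1 ∧ ∀ᶠ M : ℕ in atTop,
        ‖S.channelIn (S.angularSupport j) M l ω‖ ≤ c * ‖S.channel M j ω‖) →
      (∀ᶠ M : ℕ in atTop, S.channel M j ω ≠ 0) ∧
      ∀ u : (M C : ℕ) → EuclideanSpace ℂ (Fin M),
        (∀ M C : ℕ, 0 < M → 0 < C →
          IsDominantEigenvector (S.sampleCov j (ε M) M C ω) (u M C)) →
        Tendsto (fun q : ℕ × ℕ =>
            ‖S.saEstimate q.1 (u q.1 q.2) ω - S.channel q.1 j ω‖ ^ 2 / ‖S.channel q.1 j ω‖ ^ 2)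
          (atTop ×ˢ atTop) (𝓝 0) := by
  filter_upwards [S.ae_angle_mem_Ioo, S.ae_angle_ne, S.ae_angle_mem_support,
    S.ae_tendsto_norm_project_sub_channelIn j hΦ hε hεM, S.ae_tendsto_symbol_gram,
    S.ae_eventually_dataNoise_le, S.ae_tendsto_inner_channel_pilotResidual j,
    S.ae_eventually_norm_pilotResidual_le] with ω hI hne hsupp hproj hX hZ hn hK hpow
  refine ⟨S.eventually_channel_ne_zero hI hne j, fun u hu => ?_⟩
  obtain ⟨K, hK⟩ := hK
  have hd : ∀ l, l ≠ j → S.powerIn (S.angularSupport j) l ω < S.β j ^ 2 := by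
    intro l hl
    obtain ⟨c, hc, h⟩ := hpow l hl
    exact S.powerIn_lt_of_eventually_le hI hne _ hc h
  -- Unit vectors exist only for M > 0, so the dominant eigenvectors are available only eventually.
  have hu' : ∀ᶠ q : ℕ × ℕ in atTop ×ˢ atTop,
      IsDominantEigenvector (S.sampleCov j (ε q.1) q.1 q.2 ω) (u q.1 q.2) :=
    ((eventually_gt_atTop 0).prod_mk (eventually_gt_atTop 0)).mono fun q h => hu _ _ h.1 h.2
  have herr := S.tendsto_saEstimate_error j hI hne (S.angularSupport j) (hsupp j) hproj hX hZ hn hK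
    hd (fun q => u q.1 q.2) hu'
  -- The error and the channel norm are both taken per √M; the latter tends to β_j > 0, and √M
  -- cancels in the quotient as soon as M > 0.
  have hlim := (herr.div ((S.tendsto_norm_channel hI hne j).comp tendsto_fst)
    (S.β_pos j).ne').pow 2
  rw [zero_div, zero_pow two_ne_zero] at hlim
  refine hlim.congr' ?_
  filter_upwards [(eventually_gt_atTop 0).prod_inl atTop] with q hq
  have hq' : √(q.1 : ℝ) ≠ 0 := (Real.sqrt_pos.2 (Nat.cast_pos.2 hq)).ne'
  simp only [Pi.div_apply, Function.comp_apply]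
  rw [div_div_div_cancel_right₀ hq', div_pow]
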